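/- \textbf{Theorem (Universal deformation formula).} Let $R$ be a commutative ring containing $\mathbb{Q}$ and let $\mathfrak{g}$ be a Lie algebra over $R$ that is free of finite rank as a module, with basis $e_1,\dots,e_n$, dual basis $e^1,\dots,e^n$ and structure constants $C_{ij}^k=e^k([e_i,e_j])$. Sums over repeated indices are understood. Let $r\in\Lambda^2\mathfrak{g}$ be a non-degenerate $r$-matrix: $[\![r,r]\!]=0$ for the Schouten bracket, and $\sharp\colon\mathfrak{g}^*\to\mathfrak{g}$, $\alpha\mapsto r(\alpha,\cdot)$, is bijective. Put $r^{ij}=r(e^i,e^j)$ and let $\omega\in\Lambda^2\mathfrak{g}^*$ be its inverse, $r^{ik}\omega_{kj}=\delta^i_j$. Let $\nabla\colon\mathfrak{g}\times\mathfrak{g}\to\mathfrak{g}$ be bilinear, torsion-free ($\nabla_XY-\nabla_YX=[X,Y]$) and symplectic ($\nabla_X\omega=0$), and let $s\in\mathrm{Sym}^2\mathfrak{g}$ be covariantly constant ($\nabla_Xs=0$); put $\pi^{ij}=r^{ij}+s^{ij}$ with $s^{ij}=s(e^i,e^j)$. Let $\Omega\in t\,\Lambda^2\mathfrak{g}^*[[t]]$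 be a formal series of Chevalley--Eilenberg-closed two-forms. \emph{The construction.} On $\mathcal{W}\otimes\Lambda=\big(\prod_k\mathrm{Sym}^k\mathfrak{g}^*\otimes\Lambda^\bullet\mathfrak{g}^*\big)[[t]]$ let $\mu(f\otimes\alpha,g\otimes\beta)=f\vee g\otimes\alpha\wedge\beta$ and $a\circ b=\mu\circ e^{\frac t2\mathcal{P}}(a\otimes b)$, $\mathcal{P}=\pi^{ij}\,i_s(e_i)\otimes i_s(e_j)$, where $i_s,i_a$ are the symmetric and antisymmetric insertion derivations. Let $\mathrm{ad}$ denote the graded commutator of $\circ$ with respect to the antisymmetric degree, let $\sigma$ be the projection to symmetric and antisymmetric degree $0$, and let $\delta=e^i\wedge i_s(e_i)$ and $\delta^*=e^i\vee i_a(e_i)$. On symmetric degree $k$ and antisymmetric degree $l$ let $\delta^{-1}=\frac1{k+l}\delta^*$ if $k+l>0$ and $\delta^{-1}=0$ if $k+l=0$. Extend $\nabla_X$ to $\mathrm{Sym}\,\mathfrak{g}^*$ and $\Lambda\mathfrak{g}^*$ as the derivations with $(\nabla_X\alpha)(Y)=-\alpha(\nabla_XY)$ for $\alpha\in\mathfrak{g}^*$,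 and let $D(f\otimes\alpha)=\nabla_{e_i}f\otimes e^i\wedge\alpha+f\otimes e^i\wedge\nabla_{e_i}\alpha$. With $\tilde R(X,Y)Z=\nabla_X\nabla_YZ-\nabla_Y\nabla_XZ-\nabla_{[X,Y]}Z$ let $\mathcal{R}=\frac14\,\omega(e_z,\tilde R(e_i,e_j)e_u)\,e^z\vee e^u\otimes e^i\wedge e^j$. The total degree is the symmetric degree plus twice the $t$-degree. Then there is a unique $\varrho\in\mathcal{W}\otimes\Lambda^1$ of total degree at least $2$ with \[\delta\varrho=\mathcal{R}+D\varrho+\tfrac1t\,\varrho\circ\varrho+\Omega,\qquad \delta^{-1}\varrho=0 .\] Let $A$ be any associative (not necessarily unital) $R$-algebra on which $\mathfrak{g}$ acts by derivations, $(X,\xi)\mapsto X\triangleright\xi$. Extend all operators to $A\otimes\mathcal{W}\otimes\Lambda=\prod_k(A\otimes\mathrm{Sym}^k\mathfrak{g}^*\otimes\Lambda^\bullet\mathfrak{g}^*)[[t]]$, acting trivially on $A$; let $L_A(\xi\otimes f\otimes\alpha)=e_i\triangleright\xi\otimes f\otimes e^i\wedge\alpha$ and let $\mu_A(\xi_1\otimes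 a_1,\xi_2\otimes a_2)=\xi_1\xi_2\otimes a_1\circ a_2$. Then, with the graded commutator $[\cdot,\cdot]$ of operators, $\mathrm{id}-[\delta^{-1},D+L_A+\frac1t\mathrm{ad}(\varrho)]$ is invertible on $A\otimes\mathcal{W}\otimes\Lambda$. Putting, for $\xi\in A[[t]]$, \[\tau_A(\xi)=\frac{1}{\mathrm{id}-[\delta^{-1},D+L_A+\frac1t\mathrm{ad}(\varrho)]}\,(\xi\otimes 1\otimes 1),\] the formula \[\xi\star\eta=\sigma\big(\mu_A(\tau_A(\xi),\tau_A(\eta))\big)\] defines an associative deformation of $A$, that is, an associative $R[[t]]$-bilinear product on $A[[t]]$ which is the product of $A$ in zeroth order of $t$. Moreover, for $\xi,\eta\in A$, \[\xi\star\eta=\xi\eta+\tfrac t2\,\pi^{ij}\,(e_i\triangleright\xi)(e_j\triangleright\eta)+\mathcal{O}(t^2).\] -/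

import Mathlib

open scoped TensorProduct

noncomputable section

namespace Fedosov

/-! ## Exterior algebra: degree scalings, contractions, Schouten bracket, Chevalley-Eilenberg -/

section Exterior

variable {R : Type*} [CommRing R]

/-- The endomorphism of `Λ V` that multiplies the homogeneous component `Λ^l V` by `c l`. -/
def formScale {V : Type*} [AddCommGroup V] [Module R V] (c : ℕ → R) :
    ExteriorAlgebra R V →ₗ[R] ExteriorAlgebra R V :=
  DirectSum.toModule R ℕ (ExteriorAlgebra R V) (fun l => c l • (⋀[R]^l V).subtype) ∘ₗ
    (DirectSum.decomposeLinearEquiv (fun l : ℕ => ⋀[R]^l V)).toLinearMap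

variable {g : Type*} [LieRing g] [LieAlgebra R g]
variable {ι : Type*} [Fintype ι]

/-- Contraction of a multivector in `Λ g` with `α ∈ g*` in the first slot
(antiderivation of degree `-1`, `X ↦ α X` on `g`). -/
def insCovector (α : Module.Dual R g) : ExteriorAlgebra R g →ₗ[R] ExteriorAlgebra R g :=
  CliffordAlgebra.contractLeft α

/-- The antisymmetric insertion `i_a(X)` of `X ∈ g` into forms in `Λ g*`
(antiderivation of degree `-1`, `α ↦ α X` on `g*`). -/
def insVector (X : g) :
    ExteriorAlgebra R (Module.Dual R g) →ₗ[R] ExteriorAlgebra R (Module.Dual R g) :=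
  CliffordAlgebra.contractLeft (Module.Dual.eval R g X)

/-- Left exterior multiplication `α ∧ ·` with `α ∈ g*` on `Λ g*`. -/
def wedgeLeft (α : Module.Dual R g) :
    ExteriorAlgebra R (Module.Dual R g) →ₗ[R] ExteriorAlgebra R (Module.Dual R g) :=
  LinearMap.mulLeft R (ExteriorAlgebra.ι R α)

/-- The Schouten bracket on `Λ g`, i.e. the extension of the Lie bracket with
`⟦X₁∧…∧X_p, Y₁∧…∧Y_q⟧ = ∑_{i,j} (-1)^(i+j) [X_i,Y_j] ∧ X₁∧…X̂_i…∧X_p ∧ Y₁∧…Ŷ_j…∧Y_q`. -/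
def schouten (e : Module.Basis ι R g) (P Q : ExteriorAlgebra R g) : ExteriorAlgebra R g :=
  ∑ i, ∑ j, ExteriorAlgebra.ι R ⁅e i, e j⁆ * insCovector (e.coord i) P * insCovector (e.coord j) Q

/-- A bivector `r ∈ Λ² g` as a bilinear form on `g*`; `r^{ij} = r(e^i, e^j)`, so that
`r = ½ ∑ r^{ij} e_i ∧ e_j`. -/
def bivectorForm (r : ExteriorAlgebra R g) : LinearMap.BilinForm R (Module.Dual R g) :=
  LinearMap.mk₂ R
    (fun α β => ExteriorAlgebra.algebraMapInv (insCovector β (insCovector α r)))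
    (by intros; simp [insCovector]) (by intros; simp [insCovector])
    (by intros; simp [insCovector]) (by intros; simp [insCovector])

/-- The musical map `♯ : g* → g`, `α ↦ r(α, ·)`. -/
def sharp (r : ExteriorAlgebra R g) : Module.Dual R g →ₗ[R] g :=
  ExteriorAlgebra.ιInv ∘ₗ CliffordAlgebra.contractLeft.flip r

/-- `r` is a (strongly) non-degenerate classical `r`-matrix. -/
structure IsNondegenerateRMatrix (e : Module.Basis ι R g) (r : ExteriorAlgebra R g) : Prop where
  mem : r ∈ ⋀[R]^2 g
  schouten_self : schouten e r r = 0
  sharp_bijective : Function.Bijective (sharp r)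

/-- The induced symplectic form `ω`, the inverse of `r`: `ω(X, Y) = (♭X)(Y)` with `♭ = ♯⁻¹`.
In a basis `∑_k r^{ik} ω_{kj} = δ^i_j`. -/
def omega (r : ExteriorAlgebra R g) (hr : Function.Bijective (sharp r)) :
    LinearMap.BilinForm R g :=
  (LinearEquiv.ofBijective (sharp r) hr).symm.toLinearMap

variable [Algebra ℚ R]

/-- The Chevalley-Eilenberg differential on `Λ g*`: the graded derivation of degree `+1` with
`(δ_CE α)(X, Y) = -α([X, Y])` for `α ∈ g*`, i.e.
`δ_CE = -½ ∑ C_{ij}^k e^i ∧ e^j ∧ i_a(e_k)` with `C_{ij}^k = e^k([e_i, e_j])`. -/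
def ceDifferential (e : Module.Basis ι R g) :
    ExteriorAlgebra R (Module.Dual R g) →ₗ[R] ExteriorAlgebra R (Module.Dual R g) :=
  -(algebraMap ℚ R (1 / 2)) • ∑ i, ∑ j, ∑ k, e.coord k ⁅e i, e j⁆ •
    (wedgeLeft (e.coord i) ∘ₗ wedgeLeft (e.coord j) ∘ₗ insVector (e k))

end Exterior

/-! ## Covariant derivatives -/

section Connection

variable {R : Type*} [CommRing R] {g : Type*} [LieRing g] [LieAlgebra R g]

/-- `∇_X Y - ∇_Y X = [X, Y]`. -/
def IsTorsionFree (nabla : g →ₗ[R] g →ₗ[R] g) : Prop :=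
  ∀ X Y : g, nabla X Y - nabla Y X = ⁅X, Y⁆

/-- `∇_X ω = 0` for all `X`. -/
def IsSymplectic (om : LinearMap.BilinForm R g) (nabla : g →ₗ[R] g →ₗ[R] g) : Prop :=
  ∀ X Y Z : g, om (nabla X Y) Z + om Y (nabla X Z) = 0

/-- The covariant derivative on covectors, `(∇_X α)(Y) = -α(∇_X Y)`. -/
def nablaDual (nabla : g →ₗ[R] g →ₗ[R] g) (X : g) (α : Module.Dual R g) : Module.Dual R g :=
  -(α ∘ₗ nabla X)

/-- `∇_X s = 0` for all `X`, for a bivector `s` viewed as a bilinear form on `g*`. -/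
def IsCovariantlyConstant (nabla : g →ₗ[R] g →ₗ[R] g)
    (s : LinearMap.BilinForm R (Module.Dual R g)) : Prop :=
  ∀ (X : g) (α β : Module.Dual R g), s (nablaDual nabla X α) β + s α (nablaDual nabla X β) = 0

/-- The curvature `R̃(X, Y) Z = ∇_X ∇_Y Z - ∇_Y ∇_X Z - ∇_{[X,Y]} Z`. -/
def curvature (nabla : g →ₗ[R] g →ₗ[R] g) (X Y Z : g) : g :=
  nabla X (nabla Y Z) - nabla Y (nabla X Z) - nabla ⁅X, Y⁆ Z

end Connection

/-! ## The (enlarged) Fedosov algebra `A ⊗ W ⊗ Λ` -/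

/-- The enlarged Fedosov algebra `A ⊗ W ⊗ Λ = (∏_k A ⊗ Sym^k g* ⊗ Λ g*)[[t]]`.
With respect to a basis `e` of `g` an element is given by its coefficients in `A ⊗ Λ g*`:
`a m β` is the coefficient of `t^m` and of the monomial `∏_i (e^i)^{β i}` of `Sym g*`.
The algebra `W ⊗ Λ` itself is the case `A = R`. -/
abbrev WL (R ι g A : Type*) [CommRing R] [LieRing g] [LieAlgebra R g]
    [AddCommGroup A] [Module R A] : Type _ :=
  ℕ → (ι →₀ ℕ) → A ⊗[R] ExteriorAlgebra R (Module.Dual R g)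

section Operators

variable {R : Type*} [CommRing R] {g : Type*} [LieRing g] [LieAlgebra R g]
variable {ι : Type*}
variable {A : Type*} [AddCommGroup A] [Module R A]

/-- Apply linear maps `φ k` of the coefficient module `A ⊗ Λ g*` to all coefficients,
where `k` is the symmetric degree. -/
def onCoeff (φ : ℕ → (A ⊗[R] ExteriorAlgebra R (Module.Dual R g)) →ₗ[R]
      (A ⊗[R] ExteriorAlgebra R (Module.Dual R g))) :
    WL R ι g A →ₗ[R] WL R ι g A where
  toFun a := fun m β => φ β.degree (a m β)
  map_add' a b := by ext m β; simp
  map_smul' c a := by ext m β; simp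

/-- A linear operator on `Λ g*` extended to `A ⊗ W ⊗ Λ`. -/
def onForms (φ : ExteriorAlgebra R (Module.Dual R g) →ₗ[R] ExteriorAlgebra R (Module.Dual R g)) :
    WL R ι g A →ₗ[R] WL R ι g A :=
  onCoeff fun _ => LinearMap.lTensor A φ

/-- The symmetric insertion `i_s(e_i)`, i.e. the partial derivative `∂/∂e^i` on `Sym g*`. -/
def insSym (i : ι) : WL R ι g A →ₗ[R] WL R ι g A where
  toFun a := fun m β => ((β i + 1 : ℕ) : R) • a m (β + Finsupp.single i 1)
  map_add' a b := by ext m β; simp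
  map_smul' c a := by ext m β; simp [smul_comm c]

/-- Symmetric multiplication `e^i ∨ ·`. -/
def mulSym (i : ι) : WL R ι g A →ₗ[R] WL R ι g A where
  toFun a := fun m β => if β i = 0 then 0 else a m (β - Finsupp.single i 1)
  map_add' a b := by
    ext m β
    by_cases h : β i = 0 <;> simp [h]
  map_smul' c a := by
    ext m β
    by_cases h : β i = 0 <;> simp [h]

/-- Division by the formal parameter. It is only applied to elements without zeroth order
in `t`, as `(1/t) ad(ϱ) a` and `(1/t) ϱ ∘ ϱ` for `ϱ` of antisymmetric degree one. -/
def divT : WL R ι g A →ₗ[R] WL R ι g A where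
  toFun a := fun m β => a (m + 1) β
  map_add' _ _ := rfl
  map_smul' _ _ := rfl

open Classical in
/-- A formal power series with coefficients in `A ⊗ Λ g*` as element of symmetric degree zero. -/
def ofSeries (x : ℕ → A ⊗[R] ExteriorAlgebra R (Module.Dual R g)) : WL R ι g A :=
  fun m β => if β = 0 then x m else 0

/-- The inclusion `A[[t]] → A ⊗ W ⊗ Λ`, `ξ ↦ ξ ⊗ 1 ⊗ 1`. -/
def incl (ξ : ℕ → A) : WL R ι g A := ofSeries fun m => ξ m ⊗ₜ[R] 1

/-- The projection `σ` to symmetric and antisymmetric degree zero. -/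
def sigma (a : WL R ι g A) : ℕ → A := fun m =>
  TensorProduct.rid R A (LinearMap.lTensor A ExteriorAlgebra.algebraMapInv.toLinearMap (a m 0))

variable [Fintype ι]

/-- `δ = e^i ∧ i_s(e_i)`. -/
def delta (e : Module.Basis ι R g) : WL R ι g A →ₗ[R] WL R ι g A :=
  ∑ i, onForms (wedgeLeft (e.coord i)) ∘ₗ insSym i

/-- `δ* = e^i ∨ i_a(e_i)`. -/
def deltaStar (e : Module.Basis ι R g) : WL R ι g A →ₗ[R] WL R ι g A :=
  ∑ i, mulSym i ∘ₗ onForms (insVector (e i))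

/-- `δ⁻¹ = (k + l)⁻¹ δ*` on elements of symmetric degree `k` and antisymmetric degree `l`
with `k + l > 0`, and `0` on those with `k + l = 0`. -/
def deltaInv [Algebra ℚ R] (e : Module.Basis ι R g) : WL R ι g A →ₗ[R] WL R ι g A :=
  deltaStar e ∘ₗ onCoeff fun k => LinearMap.lTensor A
    (formScale fun l => if k + l = 0 then 0 else algebraMap ℚ R (1 / ((k : ℚ) + (l : ℚ))))

/-- The derivation `D (f ⊗ α) = ∇_{e_i} f ⊗ e^i ∧ α + f ⊗ e^i ∧ ∇_{e_i} α`, where `∇_X` acts as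
the derivation `-∑ e^k(∇_X e_j) e^j ∨ i_s(e_k)` on `Sym g*` and as the derivation
`-∑ e^k(∇_X e_j) e^j ∧ i_a(e_k)` on `Λ g*`, both extending `(∇_X α)(Y) = -α(∇_X Y)`. -/
def connD (e : Module.Basis ι R g) (nabla : g →ₗ[R] g →ₗ[R] g) :
    WL R ι g A →ₗ[R] WL R ι g A :=
  ∑ i, onForms (wedgeLeft (e.coord i)) ∘ₗ
    (-∑ j, ∑ k, e.coord k (nabla (e i) (e j)) •
      (mulSym j ∘ₗ insSym k + onForms (wedgeLeft (e.coord j) ∘ₗ insVector (e k))))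

/-- `L_A (ξ ⊗ f ⊗ α) = e_i ▷ ξ ⊗ f ⊗ e^i ∧ α`. -/
def leftMult (e : Module.Basis ι R g) (act : g →ₗ[R] Module.End R A) :
    WL R ι g A →ₗ[R] WL R ι g A :=
  ∑ i, onCoeff fun _ => TensorProduct.map (act (e i)) (wedgeLeft (e.coord i))

/-- The curvature as an element of `Sym² g* ⊗ Λ² g*`: with `R(Z, U, X, Y) = ω(Z, R̃(X, Y) U)` it is
`¼ ∑ R(e_z, e_u, e_i, e_j) e^z ∨ e^u ⊗ e^i ∧ e^j`. -/
def curvElt [Algebra ℚ R] (e : Module.Basis ι R g) (om : LinearMap.BilinForm R g)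
    (nabla : g →ₗ[R] g →ₗ[R] g) : WL R ι g R :=
  algebraMap ℚ R (1 / 4) • ∑ z, ∑ u, ∑ i, ∑ j,
    om (e z) (curvature nabla (e i) (e j) (e u)) •
      mulSym z (mulSym u (onForms (wedgeLeft (e.coord i) ∘ₗ wedgeLeft (e.coord j))
        (incl (Pi.single 0 1))))

end Operators

/-! ## The deformed product -/

section Product

variable {R : Type*} [CommRing R] {g : Type*} [LieRing g] [LieAlgebra R g]
variable {ι : Type*} [DecidableEq ι]
variable {A₁ A₂ A₃ : Type*} [AddCommGroup A₁] [Module R A₁] [AddCommGroup A₂] [Module R A₂]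
  [AddCommGroup A₃] [Module R A₃]

/-- The undeformed product
`(ξ₁ ⊗ f₁ ⊗ α₁) · (ξ₂ ⊗ f₂ ⊗ α₂) = B(ξ₁, ξ₂) ⊗ f₁ ∨ f₂ ⊗ α₁ ∧ α₂`,
for a bilinear map `B` between the coefficient modules, `R[[t]]`-bilinearly extended. -/
def wmul (B : A₁ →ₗ[R] A₂ →ₗ[R] A₃) : WL R ι g A₁ →ₗ[R] WL R ι g A₂ →ₗ[R] WL R ι g A₃ :=
  LinearMap.mk₂ R
    (fun a b m β => ∑ p ∈ Finset.HasAntidiagonal.antidiagonal m, ∑ q ∈ Finset.HasAntidiagonal.antidiagonal β,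
      TensorProduct.map₂ B (LinearMap.mul R (ExteriorAlgebra R (Module.Dual R g)))
        (a p.1 q.1) (b p.2 q.2))
    (by intros; ext m β; simp [Finset.sum_add_distrib])
    (by intros; ext m β; simp [Finset.smul_sum])
    (by intros; ext m β; simp [Finset.sum_add_distrib])
    (by intros; ext m β; simp [Finset.smul_sum])

variable [Fintype ι]

/-- `μ ∘ P^n (a ⊗ b)` with `P = π^{ij} i_s(e_i) ⊗ i_s(e_j)`. -/
def starTerm (e : Module.Basis ι R g) (bi : LinearMap.BilinForm R (Module.Dual R g))
    (B : A₁ →ₗ[R] A₂ →ₗ[R] A₃) :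
    ℕ → (WL R ι g A₁ →ₗ[R] WL R ι g A₂ →ₗ[R] WL R ι g A₃)
  | 0 => wmul B
  | n + 1 => ∑ i, ∑ j, bi (e.coord i) (e.coord j) •
      (starTerm e bi B n).compl₁₂ (insSym i) (insSym j)

variable [Algebra ℚ R]

/-- The deformed product `a ∘ b = μ ∘ exp((t/2) P) (a ⊗ b) = ∑_n t^n / (2^n n!) μ(P^n (a ⊗ b))`. -/
def star (e : Module.Basis ι R g) (bi : LinearMap.BilinForm R (Module.Dual R g))
    (B : A₁ →ₗ[R] A₂ →ₗ[R] A₃) :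
    WL R ι g A₁ →ₗ[R] WL R ι g A₂ →ₗ[R] WL R ι g A₃ :=
  LinearMap.mk₂ R
    (fun a b m β => ∑ n ∈ Finset.range (m + 1),
      algebraMap ℚ R (1 / (2 ^ n * (n.factorial : ℚ))) • starTerm e bi B n a b (m - n) β)
    (by intros; ext m β; simp [Finset.sum_add_distrib])
    (by intros; ext m β; simp only [map_smul, LinearMap.smul_apply, Pi.smul_apply, Finset.smul_sum]
        exact Finset.sum_congr rfl fun n _ => smul_comm _ _ _)
    (by intros; ext m β; simp [Finset.sum_add_distrib])
    (by intros; ext m β; simp only [map_smul, Pi.smul_apply, Finset.smul_sum]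
        exact Finset.sum_congr rfl fun n _ => smul_comm _ _ _)

end Product

/-! ## The Fedosov construction -/

section Construction

variable {R : Type*} [CommRing R] [Algebra ℚ R] {g : Type*} [LieRing g] [LieAlgebra R g]
variable {ι : Type*} [Fintype ι] [DecidableEq ι]

/-- For `ϱ ∈ W ⊗ Λ^p`, the graded commutator `ad(ϱ)(a) = ϱ ∘ a - (-1)^{pl} a ∘ ϱ` for `a` of
antisymmetric degree `l`, as an operator on `A ⊗ W ⊗ Λ`. -/
def ad {A : Type*} [AddCommGroup A] [Module R A]
    (e : Module.Basis ι R g) (bi : LinearMap.BilinForm R (Module.Dual R g)) (p : ℕ)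
    (ρ : WL R ι g R) : WL R ι g A →ₗ[R] WL R ι g A :=
  star e bi (LinearMap.lsmul R A) ρ -
    (star e bi (LinearMap.lsmul R A).flip).flip ρ ∘ₗ onForms (formScale fun l => (-1) ^ (p * l))

/-- The characterization of `ϱ ∈ W_2 ⊗ Λ^1`: antisymmetric degree one, total degree at least two,
`δ ϱ = R + D ϱ + (1/t) ϱ ∘ ϱ + Ω`, and `δ⁻¹ ϱ = 0`. -/
structure IsFedosovElement (e : Module.Basis ι R g)
    (bi : LinearMap.BilinForm R (Module.Dual R g)) (om : LinearMap.BilinForm R g)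
    (nabla : g →ₗ[R] g →ₗ[R] g) (Om : ℕ → ExteriorAlgebra R (Module.Dual R g))
    (ρ : WL R ι g R) : Prop where
  antisym_degree : ∀ m β, ρ m β ∈ LinearMap.range
    (LinearMap.lTensor R (⋀[R]^1 (Module.Dual R g)).subtype)
  total_degree : ∀ m (β : ι →₀ ℕ), 2 * m + β.degree < 2 → ρ m β = 0
  equation : delta e ρ = curvElt e om nabla + connD e nabla ρ
    + divT (star e bi (LinearMap.mul R R) ρ ρ) + ofSeries fun m => 1 ⊗ₜ[R] Om m
  normalization : deltaInv e ρ = 0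

variable {A : Type*}

/-- The operator `[δ⁻¹, D + L_A + (1/t) ad(ϱ)]` on `A ⊗ W ⊗ Λ`
(graded commutator of operators of degrees `-1` and `+1`). -/
def homotopyOp [AddCommGroup A] [Module R A] (e : Module.Basis ι R g)
    (bi : LinearMap.BilinForm R (Module.Dual R g)) (nabla : g →ₗ[R] g →ₗ[R] g)
    (ρ : WL R ι g R) (act : g →ₗ[R] Module.End R A) : Module.End R (WL R ι g A) :=
  deltaInv e ∘ₗ (connD e nabla + leftMult e act + divT ∘ₗ ad e bi 1 ρ) +
    (connD e nabla + leftMult e act + divT ∘ₗ ad e bi 1 ρ) ∘ₗ deltaInv e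

/-- The extended Fedosov Taylor series
`τ_A(ξ) = (id - [δ⁻¹, D + L_A + (1/t) ad(ϱ)])⁻¹ ξ` for `ξ ∈ A[[t]]`
(the inverse being `0` by convention if it does not exist). -/
def tau [AddCommGroup A] [Module R A] (e : Module.Basis ι R g)
    (bi : LinearMap.BilinForm R (Module.Dual R g)) (nabla : g →ₗ[R] g →ₗ[R] g)
    (ρ : WL R ι g R) (act : g →ₗ[R] Module.End R A) (ξ : ℕ → A) : WL R ι g A :=
  Ring.inverse (1 - homotopyOp e bi nabla ρ act) (incl ξ)

/-- The deformed product `ξ ⋆ η = σ(μ_A(τ_A(ξ), τ_A(η)))` on `A[[t]]`, where `μ_A` is the product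
`(ξ₁ ⊗ a₁, ξ₂ ⊗ a₂) ↦ ξ₁ ξ₂ ⊗ a₁ ∘ a₂` of `A ⊗ W ⊗ Λ`. -/
def fedosovStar [NonUnitalRing A] [Module R A] [IsScalarTower R A A] [SMulCommClass R A A]
    (e : Module.Basis ι R g)
    (bi : LinearMap.BilinForm R (Module.Dual R g)) (nabla : g →ₗ[R] g →ₗ[R] g)
    (ρ : WL R ι g R) (act : g →ₗ[R] Module.End R A) (ξ η : ℕ → A) : ℕ → A :=
  sigma (star e bi (LinearMap.mul R A) (tau e bi nabla ρ act ξ) (tau e bi nabla ρ act η))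

end Construction

/-! ## Actions by derivations and associative deformations -/

/-- `act` is an action of the Lie algebra `g` on the algebra `A` by derivations. -/
structure IsDerivationAction {R g A : Type*} [CommRing R] [LieRing g] [LieAlgebra R g]
    [NonUnitalRing A] [Module R A] (act : g →ₗ[R] Module.End R A) : Prop where
  lie : ∀ (X Y : g) (a : A), act ⁅X, Y⁆ a = act X (act Y a) - act Y (act X a)
  leibniz : ∀ (X : g) (a b : A), act X (a * b) = act X a * b + a * act X b

/-- The `R[[t]]`-module structure of `M[[t]]`, formal series being coefficient sequences. -/
def seriesSMul {R M : Type*} [CommRing R] [AddCommGroup M] [Module R M]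
    (c : PowerSeries R) (ξ : ℕ → M) : ℕ → M :=
  fun m => ∑ p ∈ Finset.HasAntidiagonal.antidiagonal m, PowerSeries.coeff p.1 c • ξ p.2

/-- `⋆` is an associative deformation of `A`: an `R[[t]]`-bilinear associative product on `A[[t]]`
which in zeroth order of `t` is the product of `A`. -/
structure IsAssociativeDeformation (R : Type*) {A : Type*} [CommRing R] [NonUnitalRing A]
    [Module R A] (mstar : (ℕ → A) → (ℕ → A) → (ℕ → A)) : Prop where
  add_left : ∀ ξ ξ' η, mstar (ξ + ξ') η = mstar ξ η + mstar ξ' η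
  add_right : ∀ ξ η η', mstar ξ (η + η') = mstar ξ η + mstar ξ η'
  smul_left : ∀ (c : PowerSeries R) ξ η, mstar (seriesSMul c ξ) η = seriesSMul c (mstar ξ η)
  smul_right : ∀ (c : PowerSeries R) ξ η, mstar ξ (seriesSMul c η) = seriesSMul c (mstar ξ η)
  assoc : ∀ ξ η ζ, mstar (mstar ξ η) ζ = mstar ξ (mstar η ζ)
  order_zero : ∀ ξ η, mstar ξ η 0 = ξ 0 * η 0

end Fedosov

end

noncomputable section

namespace Fedosov

set_option linter.unusedSectionVars false

universe u v w w₁ w₂ w₃ w₄ w₅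

/-! ## Exterior algebra -/

section ExteriorLemmas

variable {R : Type u} [CommRing R] {V : Type w} [AddCommGroup V] [Module R V]

/-! Put 𝒟 = -δ + D + L_A + (1/t) ad(ϱ) on A ⊗ W ⊗ Λ. Two facts carry the theorem: 𝒟 is an odd
derivation of the product made from ∘ and the product of A, and 𝒟² = 0. By the first, the elements
of antisymmetric degree 0 killed by 𝒟 form a subalgebra. By the second, σ maps this subalgebra
bijectively onto A[[t]], with inverse τ_A. Hence ⋆ is a transported associative product
(`fedosovD_tau`, `eq_tau_of_fedosovD_eq_zero`, `tau_fedosovStar`).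

Derivation. The product ∘ is the exponential of a constant bidifferential operator. It is
associative because both bracketings of a triple product are the exponential of the same sum of
three commuting operators (`bidiff_exp_assoc`). The connection differentiates ∘ because π is
parallel: s by assumption, and r as the inverse of the parallel form ω
(`bivectorForm_covariantlyConstant`, `covD_star`).

Square. The operator -δ + D + L_A equals ∑ e^i ∧ d_i with even derivations d_i = -i_s(e_i) + ∇_{e_i}
+ e_i ▷. By torsion-freeness its square is the curvature of ∇, and the first Bianchi identity leaves
only the action on the symmetric factor (`two_smul_sum_W_d_sq`). This operator is (1/t)[𝓡, ·]: the
first contractions of 𝓡 see only the antisymmetric part r of π, and the second contractions cancel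
because the curvature annihilates s (`mulT_totalD_totalD`). Since an operator commutes with its own
square, its value on 𝓡 is central, which yields the second Bianchi identity (`totalD_curvElt`).
After adding (1/t) ad(ϱ) the square becomes (1/t) ad of 𝓡 + (D - δ)ϱ + (1/t) ϱ∘ϱ. The equation for ϱ
makes this -Ω, which is central (`fedosovD_sq_of_isFedosovElement`).

Solving the equations. D, L_A and (1/t) ad(ϱ) do not lower the total degree, while δ⁻¹ raises it by
one, so all equations are solved by contraction (`existsUnique_fixedPoint`). The homotopy identity
δδ⁻¹ + δ⁻¹δ = id - σ (`delta_deltaInv_add`) turns the equation for ϱ into a fixed-point problem;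
that the fixed point solves the original equation follows from the Bianchi identity for its defect
(`isFedosovElement_of_deltaInv_fedosovRhs`). The same identity rewrites the operator to be inverted
for τ_A as σ - δ⁻¹𝒟 - 𝒟δ⁻¹ (`one_sub_homotopyOp_apply`). -/

theorem exterior_linearMap_ext {N : Type*} [AddCommGroup N] [Module R N]
    {f g : ExteriorAlgebra R V →ₗ[R] N} (h : ∀ l, ∀ x ∈ ⋀[R]^l V, f x = g x) : f = g := by
  refine LinearMap.ext fun x => ?_
  induction x using DirectSum.Decomposition.inductionOn (fun l : ℕ => ⋀[R]^l V) with
  | zero => simp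
  | homogeneous m => exact h _ _ m.2
  | add a b ha hb => simp [ha, hb]

theorem formScale_of_mem (c : ℕ → R) {l : ℕ} {x : ExteriorAlgebra R V} (hx : x ∈ ⋀[R]^l V) :
    formScale c x = c l • x := by
  have h := DirectSum.decompose_of_mem (fun l : ℕ => ⋀[R]^l V) hx
  simp only [formScale, LinearMap.comp_apply, LinearEquiv.coe_coe]
  rw [DirectSum.decomposeLinearEquiv_apply, h, ← DirectSum.lof_eq_of R, DirectSum.toModule_lof]
  simp

theorem ι_mul_mem {l : ℕ} (v : V) {x : ExteriorAlgebra R V} (hx : x ∈ ⋀[R]^l V) :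
    ExteriorAlgebra.ι R v * x ∈ ⋀[R]^(l + 1) V := by
  rw [ExteriorAlgebra.exteriorPower, pow_succ']
  exact Submodule.mul_mem_mul ⟨v, rfl⟩ hx

/-- The power Λ^(l+1) is the product of submodules V · Λ^l, so it is additively generated by
products with one vector split off on the left. Degree arguments on forms run through this
induction. -/
theorem exteriorPower_succ_induction {l : ℕ} {p : ∀ x : ExteriorAlgebra R V, x ∈ ⋀[R]^(l + 1) V → Prop}
    (h_mul : ∀ v : V, ∀ x, ∀ hx : x ∈ ⋀[R]^l V, p (ExteriorAlgebra.ι R v * x) (ι_mul_mem v hx))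
    (h_add : ∀ x hx y hy, p x hx → p y hy → p (x + y) (add_mem hx hy)) {x : ExteriorAlgebra R V}
    (hx : x ∈ ⋀[R]^(l + 1) V) : p x hx := by
  suffices ∃ h, p x h from this.2
  have hx' := hx
  rw [ExteriorAlgebra.exteriorPower, pow_succ'] at hx'
  refine Submodule.mul_induction_on hx' ?_ ?_
  · rintro _ ⟨v, rfl⟩ x hx
    exact ⟨ι_mul_mem v hx, h_mul v x hx⟩
  · rintro x y ⟨hx, hx'⟩ ⟨hy, hy'⟩
    exact ⟨add_mem hx hy, h_add _ _ _ _ hx' hy'⟩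

theorem contractLeft_ι_mul' (d : Module.Dual R V) (v : V) (x : ExteriorAlgebra R V) :
    CliffordAlgebra.contractLeft d (ExteriorAlgebra.ι R v * x) =
      d v • x - ExteriorAlgebra.ι R v * CliffordAlgebra.contractLeft d x :=
  CliffordAlgebra.contractLeft_ι_mul (Q := (0 : QuadraticForm R V)) (d := d) v x

theorem contractLeft_of_mem_zero (d : Module.Dual R V) {x : ExteriorAlgebra R V}
    (hx : x ∈ ⋀[R]^0 V) : CliffordAlgebra.contractLeft d x = 0 := by
  rw [ExteriorAlgebra.exteriorPower, pow_zero, Submodule.mem_one] at hx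
  obtain ⟨c, rfl⟩ := hx
  exact CliffordAlgebra.contractLeft_algebraMap (Q := (0 : QuadraticForm R V)) (d := d) c

theorem contractLeft_mem (d : Module.Dual R V) {l : ℕ} {x : ExteriorAlgebra R V}
    (hx : x ∈ ⋀[R]^(l + 1) V) : CliffordAlgebra.contractLeft d x ∈ ⋀[R]^l V := by
  induction l generalizing x with
  | zero =>
    induction hx using exteriorPower_succ_induction with
    | h_mul v x hx =>
      rw [contractLeft_ι_mul', contractLeft_of_mem_zero d hx]
      simpa using Submodule.smul_mem _ _ hx
    | h_add x _ y _ hx hy => rw [map_add]; exact add_mem hx hy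
  | succ l ih =>
    induction hx using exteriorPower_succ_induction with
    | h_mul v x hx =>
      rw [contractLeft_ι_mul']
      exact sub_mem (Submodule.smul_mem _ _ hx) (ι_mul_mem v (ih hx))
    | h_add x _ y _ hx hy => rw [map_add]; exact add_mem hx hy

theorem formScale_comp (c d : ℕ → R) :
    formScale (V := V) c ∘ₗ formScale d = formScale (c * d) := by
  refine exterior_linearMap_ext fun l x hx => ?_
  simp [formScale_of_mem _ hx, smul_smul, mul_comm]

theorem formScale_one : formScale (V := V) (fun _ => (1 : R)) = LinearMap.id := by
  refine exterior_linearMap_ext fun l x hx => ?_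
  simp [formScale_of_mem _ hx]

theorem formScale_ι_mul (c : ℕ → R) (v : V) (x : ExteriorAlgebra R V) :
    formScale c (ExteriorAlgebra.ι R v * x) =
      ExteriorAlgebra.ι R v * formScale (fun l => c (l + 1)) x := by
  have : formScale c ∘ₗ LinearMap.mulLeft R (ExteriorAlgebra.ι R v) =
      LinearMap.mulLeft R (ExteriorAlgebra.ι R v) ∘ₗ formScale (fun l => c (l + 1)) :=
    exterior_linearMap_ext fun l x hx => by
      simp [formScale_of_mem _ hx, formScale_of_mem _ (ι_mul_mem v hx)]
  exact LinearMap.congr_fun this x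

theorem contractLeft_formScale (c : ℕ → R) (d : Module.Dual R V) (x : ExteriorAlgebra R V) :
    CliffordAlgebra.contractLeft d (formScale c x) =
      formScale (fun l => c (l + 1)) (CliffordAlgebra.contractLeft d x) := by
  have : CliffordAlgebra.contractLeft d ∘ₗ formScale c =
      formScale (fun l => c (l + 1)) ∘ₗ (CliffordAlgebra.contractLeft d :
        ExteriorAlgebra R V →ₗ[R] ExteriorAlgebra R V) := by
    refine exterior_linearMap_ext fun l x hx => ?_
    cases l with
    | zero => simp [formScale_of_mem _ hx, contractLeft_of_mem_zero d hx]
    | succ l => simp [formScale_of_mem _ hx, formScale_of_mem _ (contractLeft_mem d hx)]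
  exact LinearMap.congr_fun this x

/-- The grading involution of the exterior algebra as a linear map. -/
def gradeInv : ExteriorAlgebra R V →ₗ[R] ExteriorAlgebra R V :=
  formScale fun l => (-1) ^ l

/-- Scaling by (-1)^l serves the bookkeeping of degrees, while the Clifford involution is visibly an
algebra homomorphism; identifying the two gives access to both. -/
theorem gradeInv_eq_involute (x : ExteriorAlgebra R V) :
    gradeInv x = CliffordAlgebra.involute (Q := (0 : QuadraticForm R V)) x := by
  have : gradeInv (R := R) (V := V) =
      (CliffordAlgebra.involute (Q := (0 : QuadraticForm R V))).toLinearMap := by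
    refine exterior_linearMap_ext fun l => ?_
    induction l with
    | zero =>
      intro x hx
      rw [gradeInv, formScale_of_mem _ hx]
      rw [ExteriorAlgebra.exteriorPower, pow_zero, Submodule.mem_one] at hx
      obtain ⟨c, rfl⟩ := hx
      simp only [pow_zero, one_smul, AlgHom.toLinearMap_apply]
      exact (AlgHom.commutes _ c).symm
    | succ l ih =>
      intro x hx
      induction hx using exteriorPower_succ_induction with
      | h_mul v x hx =>
        have h1 : CliffordAlgebra.involute (Q := (0 : QuadraticForm R V))
          (ExteriorAlgebra.ι R v * x) = -(ExteriorAlgebra.ι R v) * gradeInv x := by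
          rw [ih x hx, map_mul]
          exact congrArg (· * _) (CliffordAlgebra.involute_ι v)
        rw [AlgHom.toLinearMap_apply, h1, gradeInv, formScale_of_mem _ hx,
          formScale_of_mem _ (ι_mul_mem v hx)]
        simp [pow_succ]
      | h_add x _ y _ hx hy => rw [map_add, map_add, hx, hy]
  exact LinearMap.congr_fun this x

theorem gradeInv_mul (x y : ExteriorAlgebra R V) :
    gradeInv (x * y) = gradeInv x * gradeInv y := by
  simp only [gradeInv_eq_involute]
  exact map_mul _ x y

theorem gradeInv_gradeInv (x : ExteriorAlgebra R V) : gradeInv (gradeInv x) = x := by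
  simp only [gradeInv_eq_involute]
  exact CliffordAlgebra.involute_involute x

theorem gradeInv_ι (v : V) : gradeInv (ExteriorAlgebra.ι R v) = -ExteriorAlgebra.ι R v := by
  rw [gradeInv_eq_involute]; exact CliffordAlgebra.involute_ι v

theorem gradeInv_one : gradeInv (1 : ExteriorAlgebra R V) = 1 := by
  rw [gradeInv_eq_involute]; exact map_one _

theorem ι_mul_ι_comm (v w : V) :
    ExteriorAlgebra.ι R v * ExteriorAlgebra.ι R w =
      -(ExteriorAlgebra.ι R w * ExteriorAlgebra.ι R v) :=
  eq_neg_of_add_eq_zero_left (ExteriorAlgebra.ι_add_mul_swap v w)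

/-- Each vector crossed costs one sign, and `gradeInv` collects these signs for inhomogeneous
elements too. Both sides are compatible with products in x, so generators suffice. -/
theorem ι_mul_eq_gradeInv_mul_ι (v : V) (x : ExteriorAlgebra R V) :
    ExteriorAlgebra.ι R v * x = gradeInv x * ExteriorAlgebra.ι R v := by
  induction x using ExteriorAlgebra.induction with
  | algebraMap c =>
    rw [Algebra.algebraMap_eq_smul_one, map_smul, gradeInv_one]; simp
  | ι w => rw [gradeInv_ι, ι_mul_ι_comm, neg_mul]
  | mul a b ha hb => rw [gradeInv_mul, ← mul_assoc, ha, mul_assoc, hb, mul_assoc]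
  | add a b ha hb => rw [map_add, mul_add, add_mul, ha, hb]

theorem ι_mul_gradeInv (v : V) (x : ExteriorAlgebra R V) :
    ExteriorAlgebra.ι R v * gradeInv x = x * ExteriorAlgebra.ι R v := by
  rw [ι_mul_eq_gradeInv_mul_ι, gradeInv_gradeInv]

theorem contractLeft_mul (d : Module.Dual R V) (x y : ExteriorAlgebra R V) :
    CliffordAlgebra.contractLeft d (x * y) =
      CliffordAlgebra.contractLeft d x * y + gradeInv x * CliffordAlgebra.contractLeft d y := by
  induction x using ExteriorAlgebra.induction generalizing y with
  | algebraMap c =>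
    rw [Algebra.algebraMap_eq_smul_one]
    simp only [map_smul, gradeInv_one, smul_mul_assoc, one_mul]
    rw [show CliffordAlgebra.contractLeft d (1 : ExteriorAlgebra R V) = 0 from
      CliffordAlgebra.contractLeft_one (Q := (0 : QuadraticForm R V)) (d := d)]; simp
  | ι w =>
    have := CliffordAlgebra.contractLeft_ι (Q := (0 : QuadraticForm R V)) d w
    rw [contractLeft_ι_mul', gradeInv_ι, neg_mul, sub_eq_add_neg]
    congr 1
    erw [this, ← Algebra.smul_def]
  | mul a b ha hb =>
    rw [mul_assoc, ha, hb, ha, gradeInv_mul]; simp only [mul_add, add_mul, mul_assoc, add_assoc]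
  | add a b ha hb => simp only [add_mul, map_add, ha, hb]; abel

/-- Moving two vectors across y produces the same sign twice. Therefore two-forms such as the
curvature and Ω cause no signs in commutators. -/
theorem mem_center_of_mem_two {x : ExteriorAlgebra R V} (hx : x ∈ ⋀[R]^2 V)
    (y : ExteriorAlgebra R V) : x * y = y * x := by
  induction hx using exteriorPower_succ_induction with
  | h_mul v x hx =>
    rw [ExteriorAlgebra.exteriorPower, pow_one] at hx
    obtain ⟨w, rfl⟩ := hx
    rw [mul_assoc, ι_mul_eq_gradeInv_mul_ι w, ← mul_assoc, ι_mul_gradeInv, mul_assoc]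
  | h_add a _ b _ ha hb => rw [add_mul, mul_add, ha, hb]

theorem mul_eq_gradeInv_mul_of_mem_one {x : ExteriorAlgebra R V} (hx : x ∈ ⋀[R]^1 V)
    (y : ExteriorAlgebra R V) : x * y = gradeInv y * x := by
  rw [ExteriorAlgebra.exteriorPower, pow_one] at hx
  obtain ⟨w, rfl⟩ := hx
  exact ι_mul_eq_gradeInv_mul_ι w y

theorem formScale_neg_one_pow_succ (x : ExteriorAlgebra R V) :
    formScale (fun l => (-1 : R) ^ (l + 1)) x = -gradeInv x := by
  have : formScale (fun l => (-1 : R) ^ (l + 1)) = -gradeInv (R := R) (V := V) := by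
    refine exterior_linearMap_ext fun l x hx => ?_
    simp [gradeInv, formScale_of_mem _ hx, pow_succ]
  rw [this, LinearMap.neg_apply]

end ExteriorLemmas

/-! ### Forms on the Lie algebra: wedging, insertion and the degree operator. -/

section Forms

variable {R : Type u} [CommRing R] {g : Type v} [LieRing g] [LieAlgebra R g]

/-- The grading involution of the algebra of forms. -/
def gradingInv : ExteriorAlgebra R (Module.Dual R g) →ₗ[R] ExteriorAlgebra R (Module.Dual R g) :=
  gradeInv.{u, max v u}

theorem gradingInv_mul (x y : ExteriorAlgebra R (Module.Dual R g)) :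
    gradingInv (x * y) = gradingInv x * gradingInv y := gradeInv_mul.{u, max v u} x y

theorem gradingInv_gradingInv (x : ExteriorAlgebra R (Module.Dual R g)) :
    gradingInv (gradingInv x) = x := gradeInv_gradeInv.{u, max v u} x

theorem gradingInv_ι (α : Module.Dual R g) :
    gradingInv (ExteriorAlgebra.ι R α) = -ExteriorAlgebra.ι R α := gradeInv_ι.{u, max v u} α

theorem ι_mul_gradingInv (α : Module.Dual R g) (x : ExteriorAlgebra R (Module.Dual R g)) :
    ExteriorAlgebra.ι R α * gradingInv x = x * ExteriorAlgebra.ι R α :=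
  ι_mul_gradeInv.{u, max v u} α x

theorem wedgeLeft_apply (α : Module.Dual R g) (x : ExteriorAlgebra R (Module.Dual R g)) :
    wedgeLeft α x = ExteriorAlgebra.ι R α * x := by
  rw [wedgeLeft, LinearMap.mulLeft_apply]

theorem insVector_apply (X : g) (x : ExteriorAlgebra R (Module.Dual R g)) :
    insVector X x = CliffordAlgebra.contractLeft (Module.Dual.eval R g X) x := by
  rw [insVector]

theorem wedgeLeft_wedgeLeft (α β : Module.Dual R g) :
    wedgeLeft α ∘ₗ wedgeLeft β = -(wedgeLeft β ∘ₗ wedgeLeft α) := by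
  refine LinearMap.ext fun x => ?_
  simp only [LinearMap.comp_apply, LinearMap.neg_apply, wedgeLeft_apply, ← mul_assoc]
  rw [ι_mul_ι_comm, neg_mul]

theorem insVector_insVector (X Y : g) :
    insVector (R := R) X ∘ₗ insVector Y = -(insVector Y ∘ₗ insVector X) := by
  refine LinearMap.ext fun x => ?_
  exact CliffordAlgebra.contractLeft_comm (Q := (0 : QuadraticForm R (Module.Dual R g))) _ _ x

theorem insVector_wedgeLeft (X : g) (α : Module.Dual R g) :
    insVector X ∘ₗ wedgeLeft α + wedgeLeft α ∘ₗ insVector X = α X • LinearMap.id := by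
  refine LinearMap.ext fun x => ?_
  simp [wedgeLeft_apply, insVector_apply, contractLeft_ι_mul']

/-- The number operator on forms. In the inductive step the insertions that hit the leading factor α
reproduce α ∧ x, and the remaining ones pass α with two cancelling signs and count the degree of x.
-/
theorem sum_wedgeLeft_insVector {ι : Type*} [Fintype ι] (e : Module.Basis ι R g) :
    ∑ i, wedgeLeft (e.coord i) ∘ₗ insVector (e i) = formScale fun l : ℕ => (l : R) := by
  refine exterior_linearMap_ext fun l => ?_
  induction l with
  | zero =>
    intro x hx
    simp [formScale_of_mem _ hx, insVector_apply, contractLeft_of_mem_zero _ hx]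
  | succ l ih =>
    intro x hx
    induction hx using exteriorPower_succ_induction with
    | h_mul α x hx =>
      have h1 := ih x hx
      rw [formScale_of_mem _ hx] at h1
      rw [formScale_of_mem _ (ι_mul_mem α hx)]
      simp only [LinearMap.sum_apply, LinearMap.comp_apply, wedgeLeft_apply, insVector_apply,
        contractLeft_ι_mul', mul_sub, Finset.sum_sub_distrib] at h1 ⊢
      have h2 : ∀ i, ExteriorAlgebra.ι R (e.coord i) * (ExteriorAlgebra.ι R α *
          CliffordAlgebra.contractLeft (Module.Dual.eval R g (e i)) x) =
          -(ExteriorAlgebra.ι R α * (ExteriorAlgebra.ι R (e.coord i) *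
          CliffordAlgebra.contractLeft (Module.Dual.eval R g (e i)) x)) := fun i => by
        rw [← mul_assoc, ι_mul_ι_comm, neg_mul, mul_assoc]
      simp only [h2, Finset.sum_neg_distrib, ← Finset.mul_sum, h1]
      have h3 : ∑ i, α (e i) • e.coord i = α := by
        refine e.ext fun j => ?_
        simp
      have h4 : ∑ i, ExteriorAlgebra.ι R (e.coord i) *
          (Module.Dual.eval R g (e i)) α • x = ExteriorAlgebra.ι R α * x := by
        conv_rhs => rw [← h3, map_sum, Finset.sum_mul]
        simp
      rw [h4]
      simp [add_smul, add_comm]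
    | h_add x _ y _ hx hy => rw [map_add, map_add, hx, hy]

theorem insVector_mul (X : g) (x y : ExteriorAlgebra R (Module.Dual R g)) :
    insVector X (x * y) = insVector X x * y + gradingInv x * insVector X y :=
  contractLeft_mul.{u, max v u} _ x y

/-- An insertion followed by a wedge is even, so the signs of the two odd operations cancel. This is
why ∇ acts on forms by a derivation without signs. -/
theorem wedgeLeft_insVector_mul (α : Module.Dual R g) (X : g)
    (x y : ExteriorAlgebra R (Module.Dual R g)) :
    wedgeLeft α (insVector X (x * y)) =
      wedgeLeft α (insVector X x) * y + x * wedgeLeft α (insVector X y) := by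
  rw [insVector_mul, wedgeLeft_apply, wedgeLeft_apply, wedgeLeft_apply, mul_add, ← mul_assoc,
    ← mul_assoc, ← mul_assoc, ι_mul_gradingInv]

theorem gradingInv_wedgeLeft (α : Module.Dual R g) (x : ExteriorAlgebra R (Module.Dual R g)) :
    gradingInv (wedgeLeft α x) = -wedgeLeft α (gradingInv x) := by
  have h : gradingInv (ExteriorAlgebra.ι R α * x) =
      -(ExteriorAlgebra.ι R α * gradingInv x) := by
    rw [gradingInv_mul, gradingInv_ι, neg_mul]
  rw [wedgeLeft_apply, wedgeLeft_apply, h]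

theorem wedgeLeft_mul (α : Module.Dual R g) (x y : ExteriorAlgebra R (Module.Dual R g)) :
    wedgeLeft α (x * y) = wedgeLeft α x * y :=
  (mul_assoc (ExteriorAlgebra.ι R α) x y).symm

/-- The involution on the left factor absorbs the sign of bringing α to the front; it becomes the
sign in the Leibniz rule for odd derivations. -/
theorem gradingInv_mul_wedgeLeft (α : Module.Dual R g)
    (x y : ExteriorAlgebra R (Module.Dual R g)) :
    gradingInv x * wedgeLeft α y = wedgeLeft α (x * y) := by
  rw [wedgeLeft_apply, wedgeLeft_apply, ← mul_assoc, ← mul_assoc, ← ι_mul_gradingInv, gradingInv_gradingInv]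

theorem wedgeLeft_mem {l : ℕ} (α : Module.Dual R g) {x : ExteriorAlgebra R (Module.Dual R g)}
    (hx : x ∈ ⋀[R]^l (Module.Dual R g)) : wedgeLeft α x ∈ ⋀[R]^(l + 1) (Module.Dual R g) :=
  ι_mul_mem α hx

theorem insVector_mem {l : ℕ} (X : g) {x : ExteriorAlgebra R (Module.Dual R g)}
    (hx : x ∈ ⋀[R]^(l + 1) (Module.Dual R g)) : insVector X x ∈ ⋀[R]^l (Module.Dual R g) :=
  contractLeft_mem _ hx

theorem insVector_of_mem_zero (X : g) {x : ExteriorAlgebra R (Module.Dual R g)}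
    (hx : x ∈ ⋀[R]^0 (Module.Dual R g)) : insVector X x = 0 :=
  contractLeft_of_mem_zero _ hx

theorem formScale_wedgeLeft (c : ℕ → R) (α : Module.Dual R g)
    (x : ExteriorAlgebra R (Module.Dual R g)) :
    formScale c (wedgeLeft α x) = wedgeLeft α (formScale (fun l => c (l + 1)) x) :=
  formScale_ι_mul c α x

theorem insVector_formScale (c : ℕ → R) (X : g) (x : ExteriorAlgebra R (Module.Dual R g)) :
    insVector X (formScale c x) = formScale (fun l => c (l + 1)) (insVector X x) :=
  contractLeft_formScale c _ x

theorem insVector_gradingInv (X : g) (x : ExteriorAlgebra R (Module.Dual R g)) :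
    insVector X (gradingInv x) = -gradingInv (insVector X x) :=
  (contractLeft_formScale.{u, max v u} _ _ x).trans (formScale_neg_one_pow_succ.{u, max v u} _)

end Forms

/-! ## Operator identities in an abstract algebra of operators -/

/-- As R is a ℚ-algebra, integers can be divided out in every R-module. Several identities below are
proved in a doubled or tripled form and finished by this. -/
theorem eq_zero_of_nsmul_eq_zero {R : Type*} [CommRing R] [Algebra ℚ R] {M : Type*}
    [AddCommGroup M] [Module R M] {n : ℕ} (hn : n ≠ 0) {x : M} (h : n • x = 0) : x = 0 := by
  have h1 : algebraMap ℚ R (1 / n) • ((n : R) • x) = x := by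
    rw [smul_smul, ← map_natCast (algebraMap ℚ R), ← map_mul, one_div,
      inv_mul_cancel₀ (by exact_mod_cast hn), map_one, one_smul]
  rw [← h1, Nat.cast_smul_eq_nsmul, h, smul_zero]

/-! ### Canonical commutation and anticommutation relations. -/

section CanonicalCommutators

variable {E : Type w} [Ring E] {ι : Type*} [DecidableEq ι]

/-- After normal ordering, the terms with two M and two D agree in both products and cancel; a
single contraction remains from each. These are the relations of the matrix units of gl_n. -/
theorem bosonic_commutator (M D : ι → E) (hM : ∀ i j, M i * M j = M j * M i)
    (hD : ∀ i j, D i * D j = D j * D i) (hDM : ∀ i j, D i * M j = M j * D i + if i = j then 1 else 0)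
    (j k a b : ι) : M j * D k * (M a * D b) - M a * D b * (M j * D k) =
      (if k = a then M j * D b else 0) - (if b = j then M a * D k else 0) := by
  have h : ∀ j k a b, M j * D k * (M a * D b) =
      M j * M a * (D k * D b) + if k = a then M j * D b else 0 := fun j k a b => by
    rw [mul_assoc, ← mul_assoc (D k), hDM, add_mul, mul_add, ite_mul, mul_ite, one_mul, zero_mul,
      mul_zero]
    simp only [mul_assoc]
  rw [h, h a b j k, hM a j, hD b k]
  abel

/-- Exchanging the two W and exchanging the two I gives two signs that cancel, so the quadratic
expressions obey the same gl_n relations as in the bosonic case. -/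
theorem fermionic_commutator (W I : ι → E) (hW : ∀ i j, W i * W j = -(W j * W i))
    (hI : ∀ i j, I i * I j = -(I j * I i)) (hIW : ∀ i j, I i * W j = (if i = j then 1 else 0) - W j * I i)
    (j k a b : ι) : W j * I k * (W a * I b) - W a * I b * (W j * I k) =
      (if k = a then W j * I b else 0) - (if b = j then W a * I k else 0) := by
  have h : ∀ j k a b, W j * I k * (W a * I b) =
      (if k = a then W j * I b else 0) - W j * W a * (I k * I b) := fun j k a b => by
    rw [mul_assoc, ← mul_assoc (I k), hIW, sub_mul, mul_sub, ite_mul, mul_ite, one_mul, zero_mul,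
      mul_zero]
    simp only [mul_assoc]
  rw [h, h a b j k, hW a j, hI b k, neg_mul_neg]
  abel

/-- Bosonic and fermionic creation and annihilation operators with a fermion parity. -/
structure CanonicalOperators (ι E : Type*) [DecidableEq ι] [Ring E] where
  /-- bosonic creation operators -/
  M : ι → E
  /-- bosonic annihilation operators -/
  D : ι → E
  /-- fermionic creation operators -/
  W : ι → E
  /-- fermionic annihilation operators -/
  I : ι → E
  /-- fermion parity -/
  P : E
  M_M : ∀ i j, M i * M j = M j * M i
  D_D : ∀ i j, D i * D j = D j * D i
  D_M : ∀ i j, D i * M j = M j * D i + if i = j then 1 else 0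
  W_W : ∀ i j, W i * W j = -(W j * W i)
  I_I : ∀ i j, I i * I j = -(I j * I i)
  I_W : ∀ i j, I i * W j = (if i = j then 1 else 0) - W j * I i
  W_M : ∀ i j, Commute (W i) (M j)
  W_D : ∀ i j, Commute (W i) (D j)
  I_M : ∀ i j, Commute (I i) (M j)
  I_D : ∀ i j, Commute (I i) (D j)
  P_M : ∀ i, Commute P (M i)
  P_D : ∀ i, Commute P (D i)
  P_W : ∀ i, P * W i = -(W i * P)
  P_I : ∀ i, P * I i = -(I i * P)

namespace CanonicalOperators

variable (O : CanonicalOperators ι E)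

/-- The matrix units acting on bosons and fermions. -/
def G (j k : ι) : E := O.M j * O.D k + O.W j * O.I k

/-- The bosonic and fermionic summands commute with each other and each satisfies the gl_n
relations, hence so does their sum. This is the simultaneous action on symmetric and exterior
powers. -/
theorem G_G (j k a b : ι) : O.G j k * O.G a b - O.G a b * O.G j k =
    (if k = a then O.G j b else 0) - (if b = j then O.G a k else 0) := by
  have hc : ∀ j k a b, O.W j * O.I k * (O.M a * O.D b) = O.M a * O.D b * (O.W j * O.I k) :=
    fun j k a b => (((O.W_M j a).mul_right (O.W_D j b)).mul_left ((O.I_M k a).mul_right (O.I_D k b)))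
  have hb := bosonic_commutator O.M O.D O.M_M O.D_D O.D_M j k a b
  have hf := fermionic_commutator O.W O.I O.W_W O.I_I O.I_W j k a b
  calc O.G j k * O.G a b - O.G a b * O.G j k
      = (O.M j * O.D k * (O.M a * O.D b) - O.M a * O.D b * (O.M j * O.D k)) +
        (O.W j * O.I k * (O.W a * O.I b) - O.W a * O.I b * (O.W j * O.I k)) := by
        simp only [G, mul_add, add_mul, hc]; abel
    _ = _ := by
        rw [hb, hf]; simp only [G]
        split_ifs <;> abel

theorem G_D (j k i : ι) : O.G j k * O.D i - O.D i * O.G j k = -(if j = i then O.D k else 0) := by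
  have h2 : O.W j * O.I k * O.D i = O.D i * (O.W j * O.I k) := (O.W_D j i).mul_left (O.I_D k i)
  rw [G, add_mul, mul_add, h2, ← mul_assoc (O.D i) (O.M j), O.D_M, add_mul, mul_assoc,
    mul_assoc, O.D_D k i, ite_mul, one_mul, zero_mul]
  simp only [eq_comm (a := i)]
  abel

theorem G_W (j k i : ι) : O.G j k * O.W i - O.W i * O.G j k = if k = i then O.W j else 0 := by
  have h2 : O.M j * O.D k * O.W i = O.W i * (O.M j * O.D k) :=
    ((O.W_M i j).mul_right (O.W_D i k)).symm
  rw [G, add_mul, mul_add, h2, mul_assoc, O.I_W, mul_sub, ← mul_assoc, ← mul_assoc,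
    O.W_W j i, mul_ite, mul_one, mul_zero]
  simp only [neg_mul, mul_assoc]
  abel

theorem P_G (j k : ι) : Commute O.P (O.G j k) := by
  have h1 : Commute O.P (O.M j * O.D k) := (O.P_M j).mul_right (O.P_D k)
  refine h1.add_right ?_
  rw [commute_iff_eq, ← mul_assoc, O.P_W, neg_mul, mul_assoc, O.P_I, mul_neg, neg_neg, mul_assoc]

variable [Fintype ι]

/-- The algebraic core of the Poincaré lemma. Normal ordering yields the same mixed term in both
products with opposite signs; what remains are the diagonal contractions, which add up to the two
number operators. -/
theorem delta_deltaStar : (∑ i, O.W i * O.D i) * (∑ i, O.M i * O.I i) +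
    (∑ i, O.M i * O.I i) * (∑ i, O.W i * O.D i) = ∑ i, O.W i * O.I i + ∑ i, O.M i * O.D i := by
  have h1 : ∀ i j, O.W i * O.D i * (O.M j * O.I j) + O.M j * O.I j * (O.W i * O.D i) =
      if j = i then O.W i * O.I i + O.M i * O.D i else 0 := fun i j => by
    have ha : O.W i * O.D i * (O.M j * O.I j) =
        O.M j * O.D i * (O.W i * O.I j) + if i = j then O.W i * O.I j else 0 := by
      rw [mul_assoc, ← mul_assoc (O.D i), O.D_M, add_mul, mul_add, ite_mul, mul_ite, one_mul,
        zero_mul, mul_zero, mul_assoc (O.M j), ← (O.I_D j i).eq, ← mul_assoc (O.M j), ← mul_assoc,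
        ← mul_assoc, (O.W_M i j).eq, mul_assoc (O.M j) (O.W i), mul_assoc (O.M j), mul_assoc (O.M j),
        mul_assoc (O.W i), (O.I_D j i).eq, ← mul_assoc (O.W i), (O.W_D i i).eq, mul_assoc (O.D i)]
    have hb : O.M j * O.I j * (O.W i * O.D i) =
        (if j = i then O.M j * O.D i else 0) - O.M j * O.D i * (O.W i * O.I j) := by
      rw [mul_assoc, ← mul_assoc (O.I j), O.I_W, sub_mul, mul_sub, ite_mul, mul_ite, one_mul,
        zero_mul, mul_zero, mul_assoc (O.W i), (O.I_D j i).eq, ← mul_assoc (O.W i), (O.W_D i i).eq]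
      simp only [mul_assoc]
    rw [ha, hb]
    rcases eq_or_ne j i with rfl | h
    · simp only [if_true]; abel
    · simp [h, h.symm]
  rw [Finset.sum_mul_sum, Finset.sum_mul_sum, Finset.sum_comm (s := Finset.univ) (t := Finset.univ)
    (f := fun i j => O.M i * O.I i * (O.W j * O.D j)), ← Finset.sum_add_distrib,
    ← Finset.sum_add_distrib]
  refine Finset.sum_congr rfl fun i _ => ?_
  rw [← Finset.sum_add_distrib]
  simp [h1]

/-- The products of creation operators are symmetric in the indices and those of annihilation
operators antisymmetric. Only twice the square is asserted, since 2 need not be invertible in E. -/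
theorem deltaStar_deltaStar : (∑ i, O.M i * O.I i) * (∑ i, O.M i * O.I i) +
    (∑ i, O.M i * O.I i) * (∑ i, O.M i * O.I i) = 0 := by
  have h : ∀ i j, O.M i * O.I i * (O.M j * O.I j) = -(O.M j * O.I j * (O.M i * O.I i)) :=
    fun i j => by
      have h' : ∀ i j, O.M i * O.I i * (O.M j * O.I j) = O.M i * O.M j * (O.I i * O.I j) :=
        fun i j => by
          rw [mul_assoc, ← mul_assoc (O.I i), (O.I_M i j).eq]; simp only [mul_assoc]
      rw [h', h', O.M_M, O.I_I i j, mul_neg]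
  rw [Finset.sum_mul_sum]
  nth_rw 2 [Finset.sum_comm]
  rw [← Finset.sum_add_distrib]
  refine Finset.sum_eq_zero fun i _ => ?_
  rw [← Finset.sum_add_distrib]
  refine Finset.sum_eq_zero fun j _ => ?_
  rw [h i j, neg_add_cancel]

end CanonicalOperators

end CanonicalCommutators

/-! ### The action of gl(g) and squares of odd derivations. -/

section AbstractOperators

variable {R : Type u} [CommRing R] {g : Type v} [LieRing g] [LieAlgebra R g]
variable {ι : Type*} [Fintype ι] {E : Type w} [Ring E] [Algebra R E]

/-- The action of `φ ∈ gl(g)` on functions of covectors, through matrix units `G j k`. -/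
def glAct (e : Module.Basis ι R g) (G : ι → ι → E) (φ : g →ₗ[R] g) : E :=
  -∑ j, ∑ k, e.coord k (φ (e j)) • G j k

/-- The linear extension of a family indexed by the basis. -/
def extend (e : Module.Basis ι R g) (d : ι → E) (X : g) : E := ∑ k, e.coord k X • d k

variable (e : Module.Basis ι R g) (G : ι → ι → E)

theorem glAct_sub (φ ψ : g →ₗ[R] g) : glAct e G (φ - ψ) = glAct e G φ - glAct e G ψ := by
  simp only [glAct, LinearMap.sub_apply, map_sub, sub_smul, Finset.sum_sub_distrib]
  abel

theorem extend_sub (d : ι → E) (X Y : g) : extend e d (X - Y) = extend e d X - extend e d Y := by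
  simp only [extend, map_sub, sub_smul, Finset.sum_sub_distrib]

theorem coord_comp (φ ψ : g →ₗ[R] g) (j k : ι) :
    e.coord k (φ (ψ (e j))) = ∑ l, e.coord k (φ (e l)) * e.coord l (ψ (e j)) := by
  conv_lhs => rw [← e.sum_repr (ψ (e j)), map_sum, map_sum]
  simp [mul_comm]

/-- The square of an odd derivation `∑ W_i d_i` is governed by the curvature of the `d_i`. -/
theorem two_smul_sum_mul_sq (W d : ι → E) (Γ : ι → ι → ι → R) (K : ι → ι → E)
    (hW : ∀ i j, W i * W j = -(W j * W i))
    (hdW : ∀ i j, d i * W j - W j * d i = -∑ k, Γ i k j • W k)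
    (hd : ∀ i k, d i * d k - d k * d i = ∑ j, (Γ i k j - Γ k i j) • d j + K i k) :
    (∑ i, W i * d i) * (∑ i, W i * d i) + (∑ i, W i * d i) * (∑ i, W i * d i) =
      ∑ i, ∑ k, W i * W k * K i k := by
  have h1 : (∑ i, W i * d i) * (∑ i, W i * d i) =
      ∑ i, ∑ j, W i * W j * (d i * d j) - ∑ i, ∑ k, ∑ j, Γ i k j • (W i * W k * d j) := by
    rw [Finset.sum_mul, ← Finset.sum_sub_distrib]
    refine Finset.sum_congr rfl fun i _ => ?_
    rw [Finset.sum_comm (f := fun k j => Γ i k j • (W i * W k * d j)), Finset.mul_sum,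
      ← Finset.sum_sub_distrib]
    refine Finset.sum_congr rfl fun j _ => ?_
    have h2 : d i * W j = W j * d i - ∑ k, Γ i k j • W k := by
      rw [sub_eq_add_neg, ← hdW i j]; abel
    have h3 : W i * d i * (W j * d j) = W i * (d i * W j) * d j := by simp only [mul_assoc]
    rw [h3, h2]
    simp only [mul_sub, sub_mul, Finset.mul_sum, Finset.sum_mul, mul_smul_comm, smul_mul_assoc,
      mul_assoc]
  -- The same square with the two summation indices exchanged and the anticommutation of the W used.
  -- Adding `h1` and `h2` antisymmetrizes both d_i d_j and the coefficients Γ.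
  have h2 : (∑ i, W i * d i) * (∑ i, W i * d i) =
      -∑ i, ∑ j, W i * W j * (d j * d i) + ∑ i, ∑ k, ∑ j, Γ k i j • (W i * W k * d j) := by
    rw [h1, sub_eq_add_neg]
    congr 1
    · rw [Finset.sum_comm, ← Finset.sum_neg_distrib]
      refine Finset.sum_congr rfl fun i _ => ?_
      rw [← Finset.sum_neg_distrib]
      refine Finset.sum_congr rfl fun j _ => ?_
      rw [hW j i, neg_mul]
    · rw [Finset.sum_comm, ← Finset.sum_neg_distrib]
      refine Finset.sum_congr rfl fun i _ => ?_
      rw [← Finset.sum_neg_distrib]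
      refine Finset.sum_congr rfl fun k _ => ?_
      rw [← Finset.sum_neg_distrib]
      refine Finset.sum_congr rfl fun j _ => ?_
      rw [hW k i, neg_mul, smul_neg, neg_neg]
  have h3 : ∀ i k, K i k = d i * d k - d k * d i - ∑ j, (Γ i k j - Γ k i j) • d j := fun i k => by
    rw [hd]; abel
  nth_rw 1 [h1]
  rw [h2]
  simp only [h3, mul_sub, Finset.sum_sub_distrib, sub_smul, Finset.mul_sum, mul_smul_comm]
  abel

/-- First Bianchi identity in operator form. -/
theorem sum_wedge_cyclic_eq_zero [Algebra ℚ R] (W : ι → E) (hW : ∀ i j, W i * W j = -(W j * W i))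
    (c : ι → ι → ι → R) (hc : ∀ i k j, c i k j + c k j i + c j i k = 0) :
    ∑ i, ∑ k, ∑ j, c i k j • (W i * W k * W j) = 0 := by
  -- A triple product of W is invariant under cyclic rotation, so c may be replaced by each of its
  -- rotations. The three resulting copies of the sum add to zero by `hc`, and 3 is invertible.
  have hcyc : ∀ i k j, W k * W j * W i = W i * W k * W j := fun i k j => by
    rw [mul_assoc, hW j i, mul_neg, ← mul_assoc, hW k i, neg_mul, neg_neg]
  have hrel : ∀ F : ι → ι → ι → E, ∑ i, ∑ k, ∑ j, F i k j = ∑ i, ∑ k, ∑ j, F k j i := fun F => by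
    conv_rhs => rw [Finset.sum_comm]
    exact Finset.sum_congr rfl fun k _ => Finset.sum_comm
  have h1 : ∑ i, ∑ k, ∑ j, c i k j • (W i * W k * W j) =
      ∑ i, ∑ k, ∑ j, c k j i • (W i * W k * W j) := by
    rw [hrel]; simp only [hcyc]
  have h2 : ∑ i, ∑ k, ∑ j, c k j i • (W i * W k * W j) =
      ∑ i, ∑ k, ∑ j, c j i k • (W i * W k * W j) := by
    rw [hrel]; simp only [hcyc]
  refine eq_zero_of_nsmul_eq_zero (R := R) (n := 3) (by norm_num) ?_
  have h3 : ∑ i, ∑ k, ∑ j, c i k j • (W i * W k * W j) +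
      ∑ i, ∑ k, ∑ j, c i k j • (W i * W k * W j) +
      ∑ i, ∑ k, ∑ j, c i k j • (W i * W k * W j) = 0 := by
    conv_lhs => enter [2]; rw [h1, h2]
    nth_rw 2 [h1]
    simp only [← Finset.sum_add_distrib, ← add_smul, hc, zero_smul, Finset.sum_const_zero]
  rw [← h3]; abel

variable [DecidableEq ι]

/-- The coefficients of φ enter `glAct` transposed, which reverses the order of composition; the
minus sign in the definition restores it. Hence `glAct` is a Lie algebra homomorphism, namely the
dual action. -/
theorem glAct_commutator
    (hG : ∀ j k a b, G j k * G a b - G a b * G j k =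
      (if k = a then G j b else 0) - (if b = j then G a k else 0))
    (φ ψ : g →ₗ[R] g) :
    glAct e G φ * glAct e G ψ - glAct e G ψ * glAct e G φ = glAct e G (φ ∘ₗ ψ - ψ ∘ₗ φ) := by
  have h1 : ∀ a b, glAct e G φ * G a b - G a b * glAct e G φ =
      ∑ k, e.coord k (φ (e b)) • G a k - ∑ j, e.coord a (φ (e j)) • G j b := fun a b => by
    have : glAct e G φ * G a b - G a b * glAct e G φ =
        -∑ j, ∑ k, e.coord k (φ (e j)) • (G j k * G a b - G a b * G j k) := by
      simp only [glAct, neg_mul, mul_neg, Finset.sum_mul, Finset.mul_sum, smul_mul_assoc,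
        mul_smul_comm, smul_sub, Finset.sum_sub_distrib]
      abel
    rw [this]
    simp only [hG, smul_sub, Finset.sum_sub_distrib, smul_ite, smul_zero, Finset.sum_ite_eq',
      Finset.mem_univ, if_true, neg_sub]
    congr 1
    rw [Finset.sum_comm]
    simp
  have h2 : glAct e G φ * glAct e G ψ - glAct e G ψ * glAct e G φ =
      -∑ a, ∑ b, e.coord b (ψ (e a)) • (glAct e G φ * G a b - G a b * glAct e G φ) := by
    conv_lhs => rw [show glAct e G ψ = -∑ a, ∑ b, e.coord b (ψ (e a)) • G a b from rfl]
    simp only [neg_mul, mul_neg, Finset.sum_mul, Finset.mul_sum, smul_mul_assoc,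
      mul_smul_comm, smul_sub, Finset.sum_sub_distrib]
    abel
  rw [h2, glAct_sub]
  simp only [h1, smul_sub, Finset.sum_sub_distrib, Finset.smul_sum, smul_smul]
  simp only [glAct, LinearMap.comp_apply, coord_comp, Finset.sum_smul]
  have h3 : ∑ a, ∑ b, ∑ k, (e.coord b (ψ (e a)) * e.coord k (φ (e b))) • G a k =
      ∑ a, ∑ k, ∑ b, (e.coord k (φ (e b)) * e.coord b (ψ (e a))) • G a k :=
    Finset.sum_congr rfl fun a _ => by
      rw [Finset.sum_comm]; simp only [mul_comm]
  have h4 : ∑ a, ∑ b, ∑ j, (e.coord b (ψ (e a)) * e.coord a (φ (e j))) • G j b =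
      ∑ j, ∑ b, ∑ a, (e.coord b (ψ (e a)) * e.coord a (φ (e j))) • G j b := by
    rw [Finset.sum_comm]
    conv_rhs => rw [Finset.sum_comm]
    exact Finset.sum_congr rfl fun b _ => Finset.sum_comm
  rw [h3, h4]
  abel

/-- The annihilation operators transform like the basis vectors themselves: in the application,
insertion of vectors is equivariant. -/
theorem glAct_extend_commutator (d : ι → E)
    (hd : ∀ j k i, G j k * d i - d i * G j k = -(if j = i then d k else 0)) (φ : g →ₗ[R] g) (i : ι) :
    glAct e G φ * d i - d i * glAct e G φ = extend e d (φ (e i)) := by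
  have h1 : glAct e G φ * d i - d i * glAct e G φ =
      -∑ j, ∑ k, e.coord k (φ (e j)) • (G j k * d i - d i * G j k) := by
    simp only [glAct, neg_mul, mul_neg, Finset.sum_mul, Finset.mul_sum, smul_mul_assoc,
      mul_smul_comm, smul_sub, Finset.sum_sub_distrib]
    abel
  rw [h1]
  simp only [hd, smul_neg, Finset.sum_neg_distrib, neg_neg, smul_ite, smul_zero]
  rw [Finset.sum_comm]
  simp [extend]

/-- The creation operators transform like the dual basis, which accounts for the Christoffel symbols
with a minus sign. -/
theorem glAct_dual_commutator (W : ι → E)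
    (hW : ∀ j k i, G j k * W i - W i * G j k = if k = i then W j else 0) (φ : g →ₗ[R] g) (i : ι) :
    glAct e G φ * W i - W i * glAct e G φ = -∑ k, e.coord i (φ (e k)) • W k := by
  have h1 : glAct e G φ * W i - W i * glAct e G φ =
      -∑ j, ∑ k, e.coord k (φ (e j)) • (G j k * W i - W i * G j k) := by
    simp only [glAct, neg_mul, mul_neg, Finset.sum_mul, Finset.mul_sum, smul_mul_assoc,
      mul_smul_comm, smul_sub, Finset.sum_sub_distrib]
    abel
  rw [h1]
  simp [hW]

end AbstractOperators

/-! ### Curvature of a torsion-free connection in operator form. -/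

section FlatOperator

variable {R : Type u} [CommRing R] {g : Type v} [LieRing g] [LieAlgebra R g]
variable {ι : Type*} [Fintype ι] [DecidableEq ι] {E : Type w} [Ring E] [Algebra R E]

/-- First Bianchi identity: when torsion-freeness is used to express the nested brackets through ∇,
the Jacobi identity becomes the cyclic sum of curvatures. -/
theorem curvature_cyclic {nabla : g →ₗ[R] g →ₗ[R] g} (hT : IsTorsionFree nabla) (X Y Z : g) :
    curvature nabla X Y Z + curvature nabla Y Z X + curvature nabla Z X Y = 0 := by
  have h : ∀ X Y Z : g, ⁅X, ⁅Y, Z⁆⁆ = nabla X (nabla Y Z) - nabla X (nabla Z Y) - nabla ⁅Y, Z⁆ X :=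
    fun X Y Z => by rw [← hT X ⁅Y, Z⁆, ← hT Y Z, map_sub]
  have hJ := lie_jacobi X Y Z
  rw [h X Y Z, h Y Z X, h Z X Y] at hJ
  rw [← hJ]
  simp only [curvature]
  abel

namespace CanonicalOperators

variable (O : CanonicalOperators ι E) (e : Module.Basis ι R g) (nabla : g →ₗ[R] g →ₗ[R] g)
  (act : ι → E)

/-- The even derivations `-i_s(e_i) + ∇_{e_i} + e_i ▷`. -/
def d (i : ι) : E := -O.D i + glAct e O.G (nabla (e i)) + act i

theorem G_commute {x : E} (hM : ∀ i, Commute x (O.M i)) (hD : ∀ i, Commute x (O.D i))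
    (hW : ∀ i, Commute x (O.W i)) (hI : ∀ i, Commute x (O.I i)) (j k : ι) : Commute x (O.G j k) :=
  ((hM j).mul_right (hD k)).add_right ((hW j).mul_right (hI k))

theorem glAct_commute {G : ι → ι → E} {x : E} (hG : ∀ j k, Commute x (G j k)) (φ : g →ₗ[R] g) :
    Commute x (glAct e G φ) :=
  (Commute.sum_right _ _ _ fun j _ => Commute.sum_right _ _ _ fun k _ =>
    (hG j k).smul_right _).neg_right

variable {act}

theorem d_W (haW : ∀ i j, Commute (act i) (O.W j)) (i j : ι) :
    O.d e nabla act i * O.W j - O.W j * O.d e nabla act i =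
      -∑ k, e.coord j (nabla (e i) (e k)) • O.W k := by
  rw [← glAct_dual_commutator e O.G O.W O.G_W, d]
  simp only [add_mul, mul_add, neg_mul, mul_neg, (haW i j).eq, (O.W_D j i).eq]
  abel

theorem d_D (haD : ∀ i j, Commute (act i) (O.D j)) (i j : ι) :
    O.d e nabla act i * O.D j - O.D j * O.d e nabla act i = extend e O.D (nabla (e i) (e j)) := by
  rw [← glAct_extend_commutator e O.G O.D O.G_D, d]
  simp only [add_mul, mul_add, neg_mul, mul_neg, (haD i j).eq, O.D_D i j]
  abel

theorem P_d (haP : ∀ i, Commute (act i) O.P) (i : ι) : Commute O.P (O.d e nabla act i) :=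
  ((O.P_D i).neg_right.add_right (glAct_commute e O.P_G _)).add_right (haP i).symm

/-- Torsion-freeness turns the commutators of the translations `-O.D i` with ∇ into the translation
along -[e_i, e_k]. Thus translations and action follow the bracket exactly, while ∇ does so up to
its curvature; the coefficients match the Christoffel terms in `two_smul_sum_mul_sq`. -/
theorem d_d (hT : IsTorsionFree nabla) (haM : ∀ i j, Commute (act i) (O.M j))
    (haD : ∀ i j, Commute (act i) (O.D j)) (haW : ∀ i j, Commute (act i) (O.W j))
    (haI : ∀ i j, Commute (act i) (O.I j))
    (ha : ∀ i k, act i * act k - act k * act i = extend e act ⁅e i, e k⁆) (i k : ι) :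
    O.d e nabla act i * O.d e nabla act k - O.d e nabla act k * O.d e nabla act i =
      ∑ j, (e.coord j (nabla (e i) (e k)) - e.coord j (nabla (e k) (e i))) • O.d e nabla act j +
        glAct e O.G (nabla (e i) ∘ₗ nabla (e k) - nabla (e k) ∘ₗ nabla (e i) -
          nabla ⁅e i, e k⁆) := by
  have hN := glAct_commutator e O.G O.G_G (nabla (e i)) (nabla (e k))
  have hDi := glAct_extend_commutator e O.G O.D O.G_D (nabla (e i)) k
  have hDk := glAct_extend_commutator e O.G O.D O.G_D (nabla (e k)) i
  have hca : ∀ i k, act i * glAct e O.G (nabla (e k)) = glAct e O.G (nabla (e k)) * act i :=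
    fun i k => glAct_commute e (O.G_commute (haM i) (haD i) (haW i) (haI i)) _
  have h1 : O.d e nabla act i * O.d e nabla act k - O.d e nabla act k * O.d e nabla act i =
      (glAct e O.G (nabla (e k)) * O.D i - O.D i * glAct e O.G (nabla (e k))) -
      (glAct e O.G (nabla (e i)) * O.D k - O.D k * glAct e O.G (nabla (e i))) +
      (glAct e O.G (nabla (e i)) * glAct e O.G (nabla (e k)) -
        glAct e O.G (nabla (e k)) * glAct e O.G (nabla (e i))) +
      (act i * act k - act k * act i) := by
    simp only [d, add_mul, mul_add, neg_mul, mul_neg, hca, (haD i k).eq, (haD k i).eq, O.D_D i k]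
    abel
  have h2 : ∑ j, (e.coord j (nabla (e i) (e k)) - e.coord j (nabla (e k) (e i))) •
      O.d e nabla act j = -extend e O.D ⁅e i, e k⁆ + glAct e O.G (nabla ⁅e i, e k⁆) +
        extend e act ⁅e i, e k⁆ := by
    have h3 : glAct e O.G (nabla ⁅e i, e k⁆) =
        ∑ j, e.coord j ⁅e i, e k⁆ • glAct e O.G (nabla (e j)) := by
      conv_lhs => rw [← e.sum_repr ⁅e i, e k⁆]
      simp only [glAct, map_sum, map_smul, LinearMap.sum_apply, LinearMap.smul_apply, smul_neg,
        Finset.sum_smul, Finset.smul_sum, smul_eq_mul, ← smul_smul, Finset.sum_neg_distrib,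
        Module.Basis.coord_apply]
      congr 1
      conv_rhs => rw [Finset.sum_comm]
      refine Finset.sum_congr rfl fun j _ => ?_
      conv_rhs => rw [Finset.sum_comm]
    simp only [← map_sub, hT (e i) (e k), d, smul_add, Finset.sum_add_distrib, h3, extend, smul_neg,
      Finset.sum_neg_distrib]
  have h4 : extend e O.D ⁅e i, e k⁆ =
      extend e O.D (nabla (e i) (e k)) - extend e O.D (nabla (e k) (e i)) := by
    rw [← hT, extend_sub]
  rw [h1, hN, hDi, hDk, h2, ha, glAct_sub _ _ (_ - _), h4]
  abel

theorem curvature_eq (nabla : g →ₗ[R] g →ₗ[R] g) (X Y Z : g) : curvature nabla X Y Z =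
    (nabla X ∘ₗ nabla Y - nabla Y ∘ₗ nabla X - nabla ⁅X, Y⁆) Z := rfl

/-- The curvature acts through `G`, that is, on the bosonic and the fermionic factor. The fermionic
part carries the antisymmetrization of the curvature over three indices and dies by the first
Bianchi identity. -/
theorem two_smul_sum_W_d_sq [Algebra ℚ R] (hT : IsTorsionFree nabla)
    (haM : ∀ i j, Commute (act i) (O.M j))
    (haD : ∀ i j, Commute (act i) (O.D j)) (haW : ∀ i j, Commute (act i) (O.W j))
    (haI : ∀ i j, Commute (act i) (O.I j))
    (ha : ∀ i k, act i * act k - act k * act i = extend e act ⁅e i, e k⁆) :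
    (∑ i, O.W i * O.d e nabla act i) * (∑ i, O.W i * O.d e nabla act i) +
      (∑ i, O.W i * O.d e nabla act i) * (∑ i, O.W i * O.d e nabla act i) =
    -∑ i, ∑ k, ∑ j, ∑ l, e.coord l (curvature nabla (e i) (e k) (e j)) •
      (O.W i * O.W k * (O.M j * O.D l)) := by
  rw [two_smul_sum_mul_sq O.W (O.d e nabla act) (fun i k j => e.coord j (nabla (e i) (e k))) _ O.W_W
    (O.d_W e nabla haW) (O.d_d e nabla hT haM haD haW haI ha)]
  have h0 : ∑ i, ∑ k, ∑ j, ∑ l, e.coord l (curvature nabla (e i) (e k) (e j)) •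
      (O.W i * O.W k * (O.W j * O.I l)) = 0 := by
    have h : ∀ l, ∑ i, ∑ k, ∑ j, e.coord l (curvature nabla (e i) (e k) (e j)) •
        (O.W i * O.W k * O.W j) = 0 := fun l =>
      sum_wedge_cyclic_eq_zero (R := R) O.W O.W_W _ fun i k j => by
        rw [← map_add, ← map_add, curvature_cyclic hT, map_zero]
    have h' : ∑ i, ∑ k, ∑ j, ∑ l, e.coord l (curvature nabla (e i) (e k) (e j)) •
      (O.W i * O.W k * (O.W j * O.I l)) = ∑ l, (∑ i, ∑ k, ∑ j,
        e.coord l (curvature nabla (e i) (e k) (e j)) • (O.W i * O.W k * O.W j)) * O.I l := by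
      simp only [Finset.sum_mul, smul_mul_assoc, mul_assoc]
      conv_rhs => rw [Finset.sum_comm]
      refine Finset.sum_congr rfl fun i _ => ?_
      conv_rhs => rw [Finset.sum_comm]
      refine Finset.sum_congr rfl fun k _ => ?_
      rw [Finset.sum_comm]
    rw [h']
    simp only [h, zero_mul, Finset.sum_const_zero]
  rw [← sub_zero (-_), ← h0]
  simp only [glAct, ← curvature_eq, G, mul_neg, Finset.mul_sum, mul_smul_comm, mul_add, smul_add,
    Finset.sum_add_distrib, Finset.sum_neg_distrib]
  abel

end CanonicalOperators

end FlatOperator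

/-! ## Formal series of bidifferential operators -/

section FormalSums

variable {R : Type*} [CommRing R] {X Y : Type*} [AddCommGroup X] [Module R X]
  [AddCommGroup Y] [Module R Y]

/-- Multiplication of formal series by the formal parameter. -/
def shiftT : Module.End R (ℕ → X) where
  toFun a := fun m => match m with
    | 0 => 0
    | m + 1 => a m
  map_add' a b := by ext m; cases m <;> simp
  map_smul' c a := by ext m; cases m <;> simp

/-- The formal sum `∑ tⁿ x_n` of formal series `x_n`. -/
def formalSum (x : ℕ → ℕ → X) : ℕ → X :=
  fun m => ∑ p ∈ Finset.HasAntidiagonal.antidiagonal m, x p.1 p.2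

theorem shiftT_pow_apply (n m : ℕ) (a : ℕ → X) :
    (shiftT (R := R) ^ n) a m = if n ≤ m then a (m - n) else 0 := by
  induction n generalizing m with
  | zero => simp
  | succ n ih =>
    rw [pow_succ', Module.End.mul_apply]
    cases m with
    | zero => simp [shiftT]
    | succ m => simpa [shiftT] using ih m

theorem formalSum_apply (R : Type*) [CommRing R] [Module R X] {x : ℕ → ℕ → X} {m N : ℕ} (h : m < N) :
    formalSum x m = (∑ n ∈ Finset.range N, (shiftT (R := R) ^ n) (x n)) m := by
  rw [formalSum, Finset.sum_apply, Finset.Nat.sum_antidiagonal_eq_sum_range_succ (fun i j => x i j)]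
  simp only [shiftT_pow_apply]
  rw [← Finset.sum_subset (Finset.range_subset_range.2 (Nat.succ_le_of_lt h))]
  · exact Finset.sum_congr rfl fun n hn => by
      rw [if_pos (Nat.lt_succ_iff.1 (Finset.mem_range.1 hn))]
  · intro n _ hn
    rw [if_neg]
    simpa using hn

/-- Linearity over t implies t-adic continuity: a series vanishing up to order m is a multiple of
t^(m+1), and so is its image. -/
theorem apply_eq_zero_of_shiftT {Φ : (ℕ → X) →ₗ[R] (ℕ → Y)}
    (hΦ : ∀ a, Φ (shiftT (R := R) a) = shiftT (R := R) (Φ a)) {a : ℕ → X} {m : ℕ}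
    (ha : ∀ k ≤ m, a k = 0) : Φ a m = 0 := by
  have h1 : a = (shiftT (R := R) ^ (m + 1)) fun k => a (k + (m + 1)) := by
    ext k
    rw [shiftT_pow_apply]
    split_ifs with h
    · rw [Nat.sub_add_cancel h]
    · exact ha k (by omega)
  have h2 : ∀ n b, Φ ((shiftT (R := R) ^ n) b) = (shiftT (R := R) ^ n) (Φ b) := fun n => by
    induction n with
    | zero => intro b; simp
    | succ n ih => intro b; rw [pow_succ', Module.End.mul_apply, hΦ, ih, ← Module.End.mul_apply, ← pow_succ']
  rw [h1, h2, shiftT_pow_apply, if_neg (by omega)]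

/-- Modulo t^(m+1) the infinite sum agrees with a finite one, on which linearity suffices; the
remainder is handled by `apply_eq_zero_of_shiftT`. -/
theorem map_formalSum {Φ : (ℕ → X) →ₗ[R] (ℕ → Y)}
    (hΦ : ∀ a, Φ (shiftT (R := R) a) = shiftT (R := R) (Φ a)) (x : ℕ → ℕ → X) :
    Φ (formalSum x) = formalSum fun n => Φ (x n) := by
  have h2 : ∀ n b, Φ ((shiftT (R := R) ^ n) b) = (shiftT (R := R) ^ n) (Φ b) := fun n => by
    induction n with
    | zero => intro b; simp
    | succ n ih => intro b; rw [pow_succ', Module.End.mul_apply, hΦ, ih, ← Module.End.mul_apply, ← pow_succ']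
  ext m
  have h3 : Φ (formalSum x - ∑ n ∈ Finset.range (m + 1), (shiftT (R := R) ^ n) (x n)) m = 0 := by
    refine apply_eq_zero_of_shiftT hΦ fun k hk => ?_
    rw [Pi.sub_apply, formalSum_apply R (Nat.lt_succ_of_le hk), sub_self]
  rw [map_sub, Pi.sub_apply, sub_eq_zero, map_sum] at h3
  rw [h3, formalSum_apply R (Nat.lt_succ_self m)]
  simp only [h2]

theorem formalSum_formalSum (x : ℕ → ℕ → ℕ → X) :
    (formalSum fun n => formalSum (x n)) =
      formalSum fun N => ∑ p ∈ Finset.HasAntidiagonal.antidiagonal N, x p.1 p.2 := by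
  ext m
  simp only [formalSum, Finset.sum_apply, Finset.sum_sigma']
  apply Finset.sum_nbij' (fun ⟨⟨i, _⟩, ⟨k, l⟩⟩ ↦ ⟨(i + k, l), (i, k)⟩)
    (fun ⟨⟨_, j⟩, ⟨k, l⟩⟩ ↦ ⟨(k, l + j), (l, j)⟩) <;> simp +contextual [add_assoc] <;> grind

theorem formalSum_add (x y : ℕ → ℕ → X) :
    formalSum (fun n => x n + y n) = formalSum x + formalSum y := by
  ext m; simp [formalSum, Finset.sum_add_distrib]

theorem formalSum_smul (c : R) (x : ℕ → ℕ → X) :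
    formalSum (fun n => c • x n) = c • formalSum x := by
  ext m; simp [formalSum, Finset.smul_sum]

theorem formalSum_zero_succ (x : ℕ → ℕ → X) (h : x 0 = 0) :
    formalSum x = shiftT (R := R) (formalSum fun n => x (n + 1)) := by
  ext m
  cases m with
  | zero => simp [formalSum, h, shiftT]
  | succ m => simp [formalSum, shiftT, Finset.Nat.sum_antidiagonal_succ, h]

theorem formalSum_eq_of_succ (x : ℕ → ℕ → X) (h : ∀ n, x (n + 1) = 0) : formalSum x = x 0 := by
  ext m
  cases m with
  | zero => simp [formalSum]
  | succ m => simp [formalSum, Finset.Nat.sum_antidiagonal_succ, h]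

end FormalSums

/-! ### Coefficients of the exponential series. -/

section DividedPowers

variable (R : Type*) [CommRing R] [Algebra ℚ R]

/-- The coefficients `1 / (2ⁿ n!)`. -/
def expCoeff (n : ℕ) : R := algebraMap ℚ R (1 / (2 ^ n * (n.factorial : ℚ)))

theorem expCoeff_zero : expCoeff R 0 = 1 := by simp [expCoeff]

theorem nsmul_expCoeff_succ (n : ℕ) :
    ((n + 1 : ℕ) : R) * expCoeff R (n + 1) = algebraMap ℚ R (1 / 2) * expCoeff R n := by
  rw [expCoeff, expCoeff, ← map_natCast (algebraMap ℚ R), ← map_mul, ← map_mul]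
  congr 1
  have : (n.factorial : ℚ) ≠ 0 := by exact_mod_cast n.factorial_ne_zero
  have : ((n : ℚ) + 1) ≠ 0 := by positivity
  push_cast [Nat.factorial_succ, pow_succ]
  field_simp

theorem expCoeff_mul (p q : ℕ) :
    expCoeff R p * expCoeff R q = expCoeff R (p + q) * ((p + q).choose p : ℕ) := by
  rw [expCoeff, expCoeff, expCoeff, ← map_natCast (algebraMap ℚ R), ← map_mul, ← map_mul]
  congr 1
  have h := Nat.add_choose_mul_factorial_mul_factorial q p
  rw [add_comm q p, mul_right_comm] at h
  have hp : (p.factorial : ℚ) ≠ 0 := by exact_mod_cast p.factorial_ne_zero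
  have hq : (q.factorial : ℚ) ≠ 0 := by exact_mod_cast q.factorial_ne_zero
  have hpq : ((p + q).factorial : ℚ) ≠ 0 := by exact_mod_cast (p + q).factorial_ne_zero
  have h' : (((p + q).choose p : ℕ) : ℚ) * p.factorial * q.factorial = (p + q).factorial := by
    exact_mod_cast h
  field_simp
  rw [← h', pow_add]; ring

variable {R}

theorem sum_expCoeff_pow {E : Type*} [Ring E] [Algebra R E] {x y : E} (h : Commute x y) (N : ℕ) :
    ∑ p ∈ Finset.HasAntidiagonal.antidiagonal N, (expCoeff R p.1 * expCoeff R p.2) • (x ^ p.1 * y ^ p.2) =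
      expCoeff R N • (x + y) ^ N := by
  rw [h.add_pow', Finset.smul_sum]
  refine Finset.sum_congr rfl fun p hp => ?_
  rw [Finset.HasAntidiagonal.mem_antidiagonal] at hp
  rw [expCoeff_mul, hp, mul_smul, Nat.cast_smul_eq_nsmul]

/-- This is exp(y+z) exp(x) = exp(x+y) exp(z) in degree N: for commuting elements both sides are the
N-th term of exp(x+y+z). It is the algebraic content of associativity. -/
theorem sum_expCoeff_pow_exchange {E : Type*} [Ring E] [Algebra R E] {x y z : E}
    (hxy : Commute x y) (hxz : Commute x z) (hyz : Commute y z) (N : ℕ) :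
    ∑ p ∈ Finset.HasAntidiagonal.antidiagonal N,
        (expCoeff R p.1 * expCoeff R p.2) • ((y + z) ^ p.1 * x ^ p.2) =
      ∑ p ∈ Finset.HasAntidiagonal.antidiagonal N,
        (expCoeff R p.1 * expCoeff R p.2) • ((x + y) ^ p.1 * z ^ p.2) := by
  rw [sum_expCoeff_pow (hxy.symm.add_left hxz.symm), sum_expCoeff_pow (hxz.add_left hyz),
    add_comm, add_assoc]

/-- The exponential of `∑ π^{ij} S_i T_j` for commuting families of operators on a module. -/
theorem sum_expCoeff_biquadratic {ι : Type*} [Fintype ι] {L : Type*} [AddCommGroup L] [Module R L]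
    (π : ι → ι → R) {X Y Z : ι → Module.End R L}
    (hXX : ∀ i j, Commute (X i) (X j)) (hYY : ∀ i j, Commute (Y i) (Y j))
    (hZZ : ∀ i j, Commute (Z i) (Z j)) (hXY : ∀ i j, Commute (X i) (Y j))
    (hXZ : ∀ i j, Commute (X i) (Z j)) (hYZ : ∀ i j, Commute (Y i) (Z j)) (N : ℕ) (F : L) :
    ∑ p ∈ Finset.HasAntidiagonal.antidiagonal N, (expCoeff R p.1 * expCoeff R p.2) •
        ((∑ i, ∑ j, π i j • ((X i + Y i) * Z j)) ^ p.1 *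
          (∑ i, ∑ j, π i j • (X i * Y j)) ^ p.2) F =
      ∑ p ∈ Finset.HasAntidiagonal.antidiagonal N, (expCoeff R p.1 * expCoeff R p.2) •
        ((∑ i, ∑ j, π i j • (X i * (Y j + Z j))) ^ p.1 *
          (∑ i, ∑ j, π i j • (Y i * Z j)) ^ p.2) F := by
  have hPc : ∀ S T S' T' : ι → Module.End R L, (∀ i j, Commute (S i) (S' j)) →
      (∀ i j, Commute (S i) (T' j)) →
      (∀ i j, Commute (T i) (S' j)) → (∀ i j, Commute (T i) (T' j)) →
      Commute (∑ i, ∑ j, π i j • (S i * T j)) (∑ i, ∑ j, π i j • (S' i * T' j)) :=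
    fun S T S' T' h1 h2 h3 h4 =>
    Commute.sum_left _ _ _ fun i _ => Commute.sum_left _ _ _ fun j _ =>
      Commute.sum_right _ _ _ fun k _ => Commute.sum_right _ _ _ fun l _ =>
        (((h1 i k).mul_right (h2 i l)).mul_left ((h3 j k).mul_right (h4 j l))).smul_right _
          |>.smul_left _
  -- Here x, y, z are the contractions of type XY, XZ and YZ, so that y + z is the contraction of X
  -- + Y with Z, and x + y that of X with Y + Z.
  have h := congrArg (fun S : Module.End R L => S F) (sum_expCoeff_pow_exchange (R := R)
    (hPc X Y X Z hXX hXZ (fun i j => (hXY j i).symm) hYZ)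
    (hPc X Y Y Z hXY hXZ hYY hYZ)
    (hPc X Z Y Z hXY hXZ (fun i j => (hYZ j i).symm) hZZ) N)
  simpa only [LinearMap.sum_apply, LinearMap.smul_apply, add_mul, mul_add, smul_add,
    Finset.sum_add_distrib] using h

end DividedPowers

/-! ### Bidifferential operators with constant coefficients. -/

section Bidifferential

variable {R : Type*} [CommRing R] {ι : Type*} [Fintype ι]
variable {V₁ V₂ V₃ V₁₂ V₂₃ V : Type*} [AddCommGroup V₁] [Module R V₁] [AddCommGroup V₂] [Module R V₂]
  [AddCommGroup V₃] [Module R V₃] [AddCommGroup V₁₂] [Module R V₁₂] [AddCommGroup V₂₃]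
  [Module R V₂₃] [AddCommGroup V] [Module R V]

/-- Precomposition of a bilinear map with `∑ π^{ij} ∂_i ⊗ ∂_j`. -/
def bidiff (π : ι → ι → R) (D₁ : ι → Module.End R V₁) (D₂ : ι → Module.End R V₂) :
    Module.End R (V₁ →ₗ[R] V₂ →ₗ[R] V) where
  toFun F := ∑ i, ∑ j, π i j • F.compl₁₂ (D₁ i) (D₂ j)
  map_add' F G := by
    ext a b; simp [Finset.sum_add_distrib]
  map_smul' c F := by
    ext a b; simp [Finset.smul_sum, smul_smul, mul_comm]

variable (π : ι → ι → R) (D₁ : ι → Module.End R V₁) (D₂ : ι → Module.End R V₂)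
  (D₃ : ι → Module.End R V₃)

theorem bidiff_apply (F : V₁ →ₗ[R] V₂ →ₗ[R] V) (a : V₁) (b : V₂) :
    bidiff π D₁ D₂ F a b = ∑ i, ∑ j, π i j • F (D₁ i a) (D₂ j b) := by
  simp [bidiff]

theorem bidiff_pow_succ_apply (n : ℕ) (F : V₁ →ₗ[R] V₂ →ₗ[R] V) (a : V₁) (b : V₂) :
    (bidiff π D₁ D₂ ^ (n + 1)) F a b =
      ∑ i, ∑ j, π i j • (bidiff π D₁ D₂ ^ n) F (D₁ i a) (D₂ j b) := by
  rw [pow_succ', Module.End.mul_apply, bidiff_apply]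

variable {π D₁ D₂ D₃}

/-- Multiplicative triples of operators are compatible with bidifferential operators. -/
theorem bidiff_pow_of_mul {W₁ W₂ W : Type*} [AddCommGroup W₁] [Module R W₁]
    [AddCommGroup W₂] [Module R W₂] [AddCommGroup W] [Module R W]
    {D₁' : ι → Module.End R W₁} {D₂' : ι → Module.End R W₂}
    {F : V₁ →ₗ[R] V₂ →ₗ[R] V} {F' : W₁ →ₗ[R] W₂ →ₗ[R] W}
    {φ₁ : V₁ →ₗ[R] W₁} {φ₂ : V₂ →ₗ[R] W₂} {φ : V →ₗ[R] W}
    (hF : ∀ a b, φ (F a b) = F' (φ₁ a) (φ₂ b))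
    (h₁ : ∀ i a, φ₁ (D₁ i a) = D₁' i (φ₁ a)) (h₂ : ∀ i b, φ₂ (D₂ i b) = D₂' i (φ₂ b))
    (n : ℕ) (a : V₁) (b : V₂) :
    φ ((bidiff π D₁ D₂ ^ n) F a b) = (bidiff π D₁' D₂' ^ n) F' (φ₁ a) (φ₂ b) := by
  induction n generalizing a b with
  | zero => exact hF a b
  | succ n ih => simp only [bidiff_pow_succ_apply, map_sum, map_smul, ih, h₁, h₂]

/-- Derivations preserving `π` are derivations of the bidifferential operators. -/
theorem bidiff_pow_derivation {F : V₁ →ₗ[R] V₂ →ₗ[R] V} {d₁ : Module.End R V₁}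
    {d₂ : Module.End R V₂} {d : Module.End R V}
    (hF : ∀ a b, d (F a b) = F (d₁ a) b + F a (d₂ b)) (c : ι → ι → R)
    (h₁ : ∀ i a, d₁ (D₁ i a) = D₁ i (d₁ a) + ∑ k, c i k • D₁ k a)
    (h₂ : ∀ i a, d₂ (D₂ i a) = D₂ i (d₂ a) + ∑ k, c i k • D₂ k a)
    (hc : ∀ k l, ∑ i, (c i k * π i l + c i l * π k i) = 0)
    (n : ℕ) (a : V₁) (b : V₂) :
    d ((bidiff π D₁ D₂ ^ n) F a b) =
      (bidiff π D₁ D₂ ^ n) F (d₁ a) b + (bidiff π D₁ D₂ ^ n) F a (d₂ b) := by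
  induction n generalizing a b with
  | zero => exact hF a b
  | succ n ih =>
    simp only [bidiff_pow_succ_apply, map_sum, map_smul, ih, h₁, h₂, map_add, LinearMap.add_apply,
      LinearMap.sum_apply, LinearMap.smul_apply, smul_add, Finset.sum_add_distrib]
    set Q := (bidiff π D₁ D₂ ^ n) F with hQ
    -- The commutators of the derivation with the ∂_i contribute the derivative of π, written out in
    -- components. Condition `hc` says that it vanishes.
    have h0 : ∑ i, ∑ j, π i j • ∑ k, c i k • Q (D₁ k a) (D₂ j b) +
        ∑ i, ∑ j, π i j • ∑ k, c j k • Q (D₁ i a) (D₂ k b) = 0 := by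
      have e1 : ∑ i, ∑ j, π i j • ∑ k, c i k • Q (D₁ k a) (D₂ j b) =
          ∑ k, ∑ l, (∑ i, c i k * π i l) • Q (D₁ k a) (D₂ l b) := by
        simp only [Finset.smul_sum, smul_smul, Finset.sum_smul]
        conv_lhs => enter [2, i]; rw [Finset.sum_comm]
        rw [Finset.sum_comm]
        refine Finset.sum_congr rfl fun k _ => ?_
        rw [Finset.sum_comm]
        simp only [mul_comm]
      have e2 : ∑ i, ∑ j, π i j • ∑ k, c j k • Q (D₁ i a) (D₂ k b) =
          ∑ k, ∑ l, (∑ i, c i l * π k i) • Q (D₁ k a) (D₂ l b) := by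
        simp only [Finset.smul_sum, smul_smul, Finset.sum_smul]
        refine Finset.sum_congr rfl fun k _ => ?_
        rw [Finset.sum_comm]
        simp only [mul_comm]
      rw [e1, e2]
      simp only [← Finset.sum_add_distrib, ← add_smul, hc, zero_smul, Finset.sum_const_zero]
    calc _ = _ + (∑ i, ∑ j, π i j • ∑ k, c i k • Q (D₁ k a) (D₂ j b) +
        ∑ i, ∑ j, π i j • ∑ k, c j k • Q (D₁ i a) (D₂ k b)) := ?_
      _ = _ := by rw [h0, add_zero]
    abel

/-- Compatibility of bidifferential operators with multiplication by a generator on the left. -/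
theorem bidiff_pow_mul_left {F : V₁ →ₗ[R] V₂ →ₗ[R] V} {M₁ : Module.End R V₁} {M : Module.End R V}
    [DecidableEq ι] {z : ι}
    (hF : ∀ a b, F (M₁ a) b = M (F a b))
    (h₁ : ∀ i a, D₁ i (M₁ a) = M₁ (D₁ i a) + if i = z then a else 0)
    (hD : ∀ i j b, D₂ i (D₂ j b) = D₂ j (D₂ i b)) (n : ℕ) (a : V₁) (b : V₂) :
    (bidiff π D₁ D₂ ^ (n + 1)) F (M₁ a) b = M ((bidiff π D₁ D₂ ^ (n + 1)) F a b) +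
      ((n + 1 : ℕ) : R) • ∑ j, π z j • (bidiff π D₁ D₂ ^ n) F a (D₂ j b) := by
  have hz : ∀ (G : V₁ →ₗ[R] V₂ →ₗ[R] V) (a : V₁) (b : V₂),
      ∑ i, ∑ j, π i j • G (if i = z then a else 0) (D₂ j b) = ∑ j, π z j • G a (D₂ j b) :=
    fun G a b => by
      rw [Finset.sum_eq_single z (fun i _ h => by simp [h]) (by simp)]
      simp
  induction n generalizing a b with
  | zero =>
    rw [bidiff_pow_succ_apply, bidiff_pow_succ_apply]
    simp only [h₁, map_add, LinearMap.add_apply, smul_add, Finset.sum_add_distrib, hz, pow_zero,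
      Module.End.one_apply, hF, map_sum, map_smul]
    simp
  | succ n ih =>
    rw [bidiff_pow_succ_apply]
    simp only [h₁, map_add, LinearMap.add_apply, smul_add, Finset.sum_add_distrib]
    rw [hz]
    simp only [ih, smul_add, Finset.sum_add_distrib]
    have e1 : ∑ i, ∑ j, π i j • M ((bidiff π D₁ D₂ ^ (n + 1)) F (D₁ i a) (D₂ j b)) =
        M ((bidiff π D₁ D₂ ^ (n + 1 + 1)) F a b) := by
      rw [bidiff_pow_succ_apply (n := n + 1)]; simp only [map_sum, map_smul]
    have e2 : ∑ i, ∑ j, π i j • ((n + 1 : ℕ) : R) •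
        ∑ k, π z k • (bidiff π D₁ D₂ ^ n) F (D₁ i a) (D₂ k (D₂ j b)) =
        ((n + 1 : ℕ) : R) • ∑ k, π z k • (bidiff π D₁ D₂ ^ (n + 1)) F a (D₂ k b) := by
      simp only [bidiff_pow_succ_apply, Finset.smul_sum]
      conv_lhs => enter [2, i]; rw [Finset.sum_comm]
      rw [Finset.sum_comm]
      refine Finset.sum_congr rfl fun k _ => Finset.sum_congr rfl fun i _ =>
        Finset.sum_congr rfl fun j _ => ?_
      rw [hD k j]
      simp only [smul_smul]
      congr 1; ring
    -- The outermost contraction adds one term to the n + 1 terms supplied by the induction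
    -- hypothesis.
    rw [e1, e2, add_assoc, Nat.cast_succ (n + 1), add_smul, one_smul]

/-- Exchanging the arguments transposes `π`. -/
theorem bidiff_pow_swap {F : V₁ →ₗ[R] V₂ →ₗ[R] V} {F' : V₂ →ₗ[R] V₁ →ₗ[R] V}
    (S : Set V₁) (hF : ∀ a ∈ S, ∀ b, F a b = F' b a) (hS : ∀ i, ∀ a ∈ S, D₁ i a ∈ S)
    (n : ℕ) {a : V₁} (ha : a ∈ S) (b : V₂) :
    (bidiff π D₂ D₁ ^ n) F' b a = (bidiff (fun i j => π j i) D₁ D₂ ^ n) F a b := by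
  induction n generalizing a b with
  | zero => exact (hF a ha b).symm
  | succ n ih =>
    simp only [bidiff_pow_succ_apply]
    rw [Finset.sum_comm]
    refine Finset.sum_congr rfl fun i _ => Finset.sum_congr rfl fun j _ => ?_
    rw [ih (hS i a ha)]

/-- Associativity of the exponential of a constant bidifferential operator. -/
theorem bidiff_exp_assoc [Algebra ℚ R] {D₁₂ : ι → Module.End R V₁₂} {D₂₃ : ι → Module.End R V₂₃}
    {μ₁₂ : V₁ →ₗ[R] V₂ →ₗ[R] V₁₂} {μ₂₃ : V₂ →ₗ[R] V₃ →ₗ[R] V₂₃}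
    {μ : V₁₂ →ₗ[R] V₃ →ₗ[R] V} {μ' : V₁ →ₗ[R] V₂₃ →ₗ[R] V}
    (hμ : ∀ a b c, μ (μ₁₂ a b) c = μ' a (μ₂₃ b c))
    (h₁₂ : ∀ i a b, D₁₂ i (μ₁₂ a b) = μ₁₂ (D₁ i a) b + μ₁₂ a (D₂ i b))
    (h₂₃ : ∀ i a b, D₂₃ i (μ₂₃ a b) = μ₂₃ (D₂ i a) b + μ₂₃ a (D₃ i b))
    (c₁ : ∀ i j a, D₁ i (D₁ j a) = D₁ j (D₁ i a)) (c₂ : ∀ i j a, D₂ i (D₂ j a) = D₂ j (D₂ i a))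
    (c₃ : ∀ i j a, D₃ i (D₃ j a) = D₃ j (D₃ i a)) (N : ℕ) (a : V₁) (b : V₂) (c : V₃) :
    ∑ p ∈ Finset.HasAntidiagonal.antidiagonal N, (expCoeff R p.1 * expCoeff R p.2) •
        (bidiff π D₁₂ D₃ ^ p.1) μ ((bidiff π D₁ D₂ ^ p.2) μ₁₂ a b) c =
      ∑ p ∈ Finset.HasAntidiagonal.antidiagonal N, (expCoeff R p.1 * expCoeff R p.2) •
        (bidiff π D₁ D₂₃ ^ p.1) μ' a ((bidiff π D₂ D₃ ^ p.2) μ₂₃ b c) := by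
  -- The derivatives act on trilinear maps by precomposition in the first, second or third argument.
  -- They commute, and both bracketings become polynomials in X, Y, Z applied to the single
  -- trilinear product τ.
  let X : ι → Module.End R (V₁ →ₗ[R] V₂ →ₗ[R] V₃ →ₗ[R] V) := fun i =>
    { toFun := fun F => F ∘ₗ D₁ i
      map_add' := fun _ _ => rfl
      map_smul' := fun _ _ => rfl }
  let Y : ι → Module.End R (V₁ →ₗ[R] V₂ →ₗ[R] V₃ →ₗ[R] V) := fun i =>
    { toFun := fun F => F.compl₂ (D₂ i)
      map_add' := fun _ _ => rfl
      map_smul' := fun _ _ => rfl }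
  let Z : ι → Module.End R (V₁ →ₗ[R] V₂ →ₗ[R] V₃ →ₗ[R] V) := fun i =>
    { toFun := fun F => F.compr₂ (LinearMap.lcomp R V (D₃ i))
      map_add' := fun _ _ => rfl
      map_smul' := fun _ _ => rfl }
  have hX : ∀ i F a b c, X i F a b c = F (D₁ i a) b c := fun _ _ _ _ _ => rfl
  have hY : ∀ i F a b c, Y i F a b c = F a (D₂ i b) c := fun _ _ _ _ _ => rfl
  have hZ : ∀ i F a b c, Z i F a b c = F a b (D₃ i c) := fun _ _ _ _ _ => rfl
  have hXX : ∀ i j, Commute (X i) (X j) := fun i j => LinearMap.ext fun F =>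
    LinearMap.ext fun a => LinearMap.ext fun b => LinearMap.ext fun c => by
      rw [Module.End.mul_apply, Module.End.mul_apply]; simp only [hX]; rw [c₁]
  have hYY : ∀ i j, Commute (Y i) (Y j) := fun i j => LinearMap.ext fun F =>
    LinearMap.ext fun a => LinearMap.ext fun b => LinearMap.ext fun c => by
      rw [Module.End.mul_apply, Module.End.mul_apply]; simp only [hY]; rw [c₂]
  have hZZ : ∀ i j, Commute (Z i) (Z j) := fun i j => LinearMap.ext fun F =>
    LinearMap.ext fun a => LinearMap.ext fun b => LinearMap.ext fun c => by
      rw [Module.End.mul_apply, Module.End.mul_apply]; simp only [hZ]; rw [c₃]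
  have hXY : ∀ i j, Commute (X i) (Y j) := fun i j => rfl
  have hXZ : ∀ i j, Commute (X i) (Z j) := fun i j => rfl
  have hYZ : ∀ i j, Commute (Y i) (Z j) := fun i j => rfl
  let τ : V₁ →ₗ[R] V₂ →ₗ[R] V₃ →ₗ[R] V := μ₁₂.compr₂ μ
  have hτ : ∀ a b c, τ a b c = μ (μ₁₂ a b) c := fun _ _ _ => rfl
  have hP : ∀ (S T : ι → Module.End R (V₁ →ₗ[R] V₂ →ₗ[R] V₃ →ₗ[R] V)) F a b c,
      (∑ i, ∑ j, π i j • (S i * T j)) F a b c = ∑ i, ∑ j, π i j • S i (T j F) a b c :=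
    fun S T F a b c => by
      simp only [LinearMap.sum_apply, LinearMap.smul_apply, Module.End.mul_apply]
  have hL : ∀ n p a b c, (bidiff π D₁₂ D₃ ^ n) μ ((bidiff π D₁ D₂ ^ p) μ₁₂ a b) c =
      ((∑ i, ∑ j, π i j • ((X i + Y i) * Z j)) ^ n *
        (∑ i, ∑ j, π i j • (X i * Y j)) ^ p) τ a b c := by
    intro n
    induction n with
    | zero =>
      intro p
      induction p with
      | zero => intro a b c; simp [hτ]
      | succ p ih =>
        intro a b c
        simp only [pow_zero, one_mul, Module.End.one_apply] at ih ⊢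
        rw [bidiff_pow_succ_apply, pow_succ', Module.End.mul_apply, hP X Y]
        simp only [map_sum, map_smul, LinearMap.sum_apply, LinearMap.smul_apply, ih, hX, hY]
    | succ n ih =>
      intro p a b c
      -- Leibniz rule for the inner product, a case of `bidiff_pow_derivation` with c = 0: an outer
      -- derivative in its slot acts as X + Y.
      have hd : ∀ i, D₁₂ i ((bidiff π D₁ D₂ ^ p) μ₁₂ a b) =
          (bidiff π D₁ D₂ ^ p) μ₁₂ (D₁ i a) b + (bidiff π D₁ D₂ ^ p) μ₁₂ a (D₂ i b) := fun i =>
        bidiff_pow_derivation (h₁₂ i) (fun _ _ => 0)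
          (fun j a => by simp [c₁ i j])
          (fun j a => by simp [c₂ i j]) (by simp) p a b
      rw [bidiff_pow_succ_apply, pow_succ', mul_assoc, Module.End.mul_apply, hP (fun i => X i + Y i) Z]
      simp only [hd, map_add, LinearMap.add_apply, ih, hX, hY, hZ, LinearMap.add_apply]
  have hR : ∀ n p a b c, (bidiff π D₁ D₂₃ ^ n) μ' a ((bidiff π D₂ D₃ ^ p) μ₂₃ b c) =
      ((∑ i, ∑ j, π i j • (X i * (Y j + Z j))) ^ n *
        (∑ i, ∑ j, π i j • (Y i * Z j)) ^ p) τ a b c := by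
    intro n
    induction n with
    | zero =>
      intro p
      induction p with
      | zero => intro a b c; simp [hτ, hμ]
      | succ p ih =>
        intro a b c
        simp only [pow_zero, one_mul, Module.End.one_apply] at ih ⊢
        rw [bidiff_pow_succ_apply, pow_succ', Module.End.mul_apply, hP Y Z]
        simp only [map_sum, map_smul, ih, hZ, hY]
    | succ n ih =>
      intro p a b c
      have hd : ∀ i, D₂₃ i ((bidiff π D₂ D₃ ^ p) μ₂₃ b c) =
          (bidiff π D₂ D₃ ^ p) μ₂₃ (D₂ i b) c + (bidiff π D₂ D₃ ^ p) μ₂₃ b (D₃ i c) := fun i =>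
        bidiff_pow_derivation (h₂₃ i) (fun _ _ => 0)
          (fun j a => by simp [c₂ i j])
          (fun j a => by simp [c₃ i j]) (by simp) p b c
      rw [bidiff_pow_succ_apply, pow_succ', mul_assoc, Module.End.mul_apply, hP X (fun i => Y i + Z i)]
      simp only [hd, map_add, LinearMap.add_apply, ih, hX, hY, hZ, LinearMap.add_apply]
  have h := congrArg (fun S : V₁ →ₗ[R] V₂ →ₗ[R] V₃ →ₗ[R] V => S a b c)
    (sum_expCoeff_biquadratic π hXX hYY hZZ hXY hXZ hYZ N τ)
  simp only [LinearMap.sum_apply, LinearMap.smul_apply] at h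
  simp only [hL, hR, h]

end Bidifferential

/-! ### The exponential product of formal series. -/

section FormalStar

variable {R : Type*} [CommRing R] [Algebra ℚ R] {ι : Type*} [Fintype ι]
variable {X₁ X₂ X₃ X₁₂ X₂₃ X : Type*} [AddCommGroup X₁] [Module R X₁] [AddCommGroup X₂] [Module R X₂]
  [AddCommGroup X₃] [Module R X₃] [AddCommGroup X₁₂] [Module R X₁₂] [AddCommGroup X₂₃]
  [Module R X₂₃] [AddCommGroup X] [Module R X]

/-- `∑ tⁿ / (2ⁿ n!) μ (Pⁿ (a ⊗ b))` with `P = ∑ π^{ij} D_i ⊗ D_j`. -/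
def formalStar (π : ι → ι → R) (D₁ : ι → Module.End R (ℕ → X₁)) (D₂ : ι → Module.End R (ℕ → X₂))
    (μ : (ℕ → X₁) →ₗ[R] (ℕ → X₂) →ₗ[R] (ℕ → X)) (a : ℕ → X₁) (b : ℕ → X₂) : ℕ → X :=
  formalSum fun n => expCoeff R n • (bidiff π D₁ D₂ ^ n) μ a b

variable {π : ι → ι → R} {D₁ : ι → Module.End R (ℕ → X₁)} {D₂ : ι → Module.End R (ℕ → X₂)}
  {D₃ : ι → Module.End R (ℕ → X₃)}

theorem map_formalStar {Y₁ Y₂ Y : Type*} [AddCommGroup Y₁] [Module R Y₁]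
    [AddCommGroup Y₂] [Module R Y₂] [AddCommGroup Y] [Module R Y]
    {D₁' : ι → Module.End R (ℕ → Y₁)} {D₂' : ι → Module.End R (ℕ → Y₂)}
    {μ : (ℕ → X₁) →ₗ[R] (ℕ → X₂) →ₗ[R] (ℕ → X)} {μ' : (ℕ → Y₁) →ₗ[R] (ℕ → Y₂) →ₗ[R] (ℕ → Y)}
    {φ₁ : (ℕ → X₁) →ₗ[R] (ℕ → Y₁)} {φ₂ : (ℕ → X₂) →ₗ[R] (ℕ → Y₂)} {φ : (ℕ → X) →ₗ[R] (ℕ → Y)}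
    (hφ : ∀ a, φ (shiftT (R := R) a) = shiftT (R := R) (φ a))
    (hμ : ∀ a b, φ (μ a b) = μ' (φ₁ a) (φ₂ b))
    (h₁ : ∀ i a, φ₁ (D₁ i a) = D₁' i (φ₁ a)) (h₂ : ∀ i b, φ₂ (D₂ i b) = D₂' i (φ₂ b))
    (a : ℕ → X₁) (b : ℕ → X₂) :
    φ (formalStar π D₁ D₂ μ a b) = formalStar π D₁' D₂' μ' (φ₁ a) (φ₂ b) := by
  rw [formalStar, map_formalSum hφ]
  simp only [map_smul, bidiff_pow_of_mul hμ h₁ h₂, formalStar]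

theorem formalStar_derivation {μ : (ℕ → X₁) →ₗ[R] (ℕ → X₂) →ₗ[R] (ℕ → X)}
    {d₁ : Module.End R (ℕ → X₁)} {d₂ : Module.End R (ℕ → X₂)} {d : Module.End R (ℕ → X)}
    (hd : ∀ a, d (shiftT (R := R) a) = shiftT (R := R) (d a))
    (hμ : ∀ a b, d (μ a b) = μ (d₁ a) b + μ a (d₂ b)) (c : ι → ι → R)
    (h₁ : ∀ i a, d₁ (D₁ i a) = D₁ i (d₁ a) + ∑ k, c i k • D₁ k a)
    (h₂ : ∀ i a, d₂ (D₂ i a) = D₂ i (d₂ a) + ∑ k, c i k • D₂ k a)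
    (hc : ∀ k l, ∑ i, (c i k * π i l + c i l * π k i) = 0)
    (a : ℕ → X₁) (b : ℕ → X₂) :
    d (formalStar π D₁ D₂ μ a b) =
      formalStar π D₁ D₂ μ (d₁ a) b + formalStar π D₁ D₂ μ a (d₂ b) := by
  rw [formalStar, map_formalSum hd, formalStar, formalStar, ← formalSum_add]
  simp only [map_smul, bidiff_pow_derivation hμ c h₁ h₂ hc, smul_add]

/-- A generator in the left argument is either left alone or contracted exactly once. In order n + 1
there are n + 1 ways to contract it, and (n+1) / (2^(n+1) (n+1)!) is half the coefficient of order
n, which leaves t/2 times the product. -/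
theorem formalStar_mul_left {μ : (ℕ → X₁) →ₗ[R] (ℕ → X₂) →ₗ[R] (ℕ → X)}
    {M₁ : Module.End R (ℕ → X₁)} {M : Module.End R (ℕ → X)} [DecidableEq ι] {z : ι}
    (hM : ∀ a, M (shiftT (R := R) a) = shiftT (R := R) (M a))
    (hμ : ∀ a b, μ (M₁ a) b = M (μ a b))
    (h₁ : ∀ i a, D₁ i (M₁ a) = M₁ (D₁ i a) + if i = z then a else 0)
    (hD : ∀ i j b, D₂ i (D₂ j b) = D₂ j (D₂ i b)) (a : ℕ → X₁) (b : ℕ → X₂) :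
    formalStar π D₁ D₂ μ (M₁ a) b = M (formalStar π D₁ D₂ μ a b) +
      shiftT (R := R) (algebraMap ℚ R (1 / 2) • ∑ j, π z j • formalStar π D₁ D₂ μ a (D₂ j b)) := by
  have h0 : ∀ n, expCoeff R n • (bidiff π D₁ D₂ ^ n) μ (M₁ a) b =
      M (expCoeff R n • (bidiff π D₁ D₂ ^ n) μ a b) + (match n with
        | 0 => 0
        | n + 1 => (algebraMap ℚ R (1 / 2)) • ∑ j, π z j • (expCoeff R n •
            (bidiff π D₁ D₂ ^ n) μ a (D₂ j b)) : ℕ → X) := fun n => by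
    cases n with
    | zero => simp [hμ]
    | succ n =>
      rw [bidiff_pow_mul_left hμ h₁ hD, smul_add, map_smul]
      congr 1
      rw [smul_smul, mul_comm, nsmul_expCoeff_succ, mul_smul, Finset.smul_sum]
      congr 1
      exact Finset.sum_congr rfl fun j _ => smul_comm _ _ _
  rw [formalStar]
  simp only [h0]
  rw [formalSum_add, formalStar, map_formalSum hM]
  congr 1
  rw [formalSum_zero_succ (R := R) _ rfl]
  congr 1
  rw [formalSum_smul]
  congr 1
  ext m
  simp only [formalStar, formalSum, Finset.sum_apply, Pi.smul_apply, Finset.smul_sum]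
  rw [Finset.sum_comm]

theorem formalStar_swap {μ : (ℕ → X₁) →ₗ[R] (ℕ → X₂) →ₗ[R] (ℕ → X)}
    {μ' : (ℕ → X₂) →ₗ[R] (ℕ → X₁) →ₗ[R] (ℕ → X)}
    (S : Set (ℕ → X₁)) (hμ : ∀ a ∈ S, ∀ b, μ a b = μ' b a) (hS : ∀ i, ∀ a ∈ S, D₁ i a ∈ S)
    {a : ℕ → X₁} (ha : a ∈ S) (b : ℕ → X₂) :
    formalStar π D₂ D₁ μ' b a = formalStar (fun i j => π j i) D₁ D₂ μ a b := by
  simp only [formalStar, bidiff_pow_swap S hμ hS _ ha b]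

theorem formalStar_of_annihilated {μ : (ℕ → X₁) →ₗ[R] (ℕ → X₂) →ₗ[R] (ℕ → X)} {a : ℕ → X₁}
    (ha : ∀ i, D₁ i a = 0) (b : ℕ → X₂) : formalStar π D₁ D₂ μ a b = μ a b := by
  rw [formalStar, formalSum_eq_of_succ]
  · simp [expCoeff_zero]
  · intro n
    simp [bidiff_pow_succ_apply, ha]

/-- Linearity in t lets the inner series be pulled through the outer operators. Regrouping by total
order N gives the expressions compared in `bidiff_exp_assoc`. -/
theorem formalStar_formalStar_left {D₁₂ : ι → Module.End R (ℕ → X₁₂)}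
    {μ₁₂ : (ℕ → X₁) →ₗ[R] (ℕ → X₂) →ₗ[R] (ℕ → X₁₂)}
    {μ : (ℕ → X₁₂) →ₗ[R] (ℕ → X₃) →ₗ[R] (ℕ → X)}
    (t₁₂ : ∀ i a, D₁₂ i (shiftT (R := R) a) = shiftT (R := R) (D₁₂ i a))
    (hl : ∀ a b, μ (shiftT (R := R) a) b = shiftT (R := R) (μ a b))
    (a : ℕ → X₁) (b : ℕ → X₂) (c : ℕ → X₃) :
    formalStar π D₁₂ D₃ μ (formalStar π D₁ D₂ μ₁₂ a b) c =
      formalSum fun N => ∑ p ∈ Finset.HasAntidiagonal.antidiagonal N,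
        (expCoeff R p.1 * expCoeff R p.2) •
          (bidiff π D₁₂ D₃ ^ p.1) μ ((bidiff π D₁ D₂ ^ p.2) μ₁₂ a b) c := by
  rw [formalStar, ← formalSum_formalSum
    (fun n p => (expCoeff R n * expCoeff R p) •
      (bidiff π D₁₂ D₃ ^ n) μ ((bidiff π D₁ D₂ ^ p) μ₁₂ a b) c)]
  congr 1
  ext1 n
  have hΦ : ∀ a, (((bidiff π D₁₂ D₃ ^ n) μ).flip c) (shiftT (R := R) a) =
      shiftT (R := R) (((bidiff π D₁₂ D₃ ^ n) μ).flip c a) := fun a =>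
    (bidiff_pow_of_mul (F := μ) (F' := μ) (D₁ := D₁₂) (D₁' := D₁₂) (D₂ := D₃) (D₂' := D₃)
      (φ₁ := shiftT (R := R)) (φ₂ := LinearMap.id) (φ := shiftT (R := R))
      (fun a b => (hl a b).symm) (fun i a => (t₁₂ i a).symm) (fun _ _ => rfl) n a c).symm
  have h := map_formalSum hΦ (fun p => expCoeff R p • (bidiff π D₁ D₂ ^ p) μ₁₂ a b)
  simp only [LinearMap.flip_apply] at h
  rw [formalStar, h, ← formalSum_smul]
  simp only [map_smul, LinearMap.smul_apply, smul_smul]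

theorem formalStar_formalStar_right {D₂₃ : ι → Module.End R (ℕ → X₂₃)}
    {μ₂₃ : (ℕ → X₂) →ₗ[R] (ℕ → X₃) →ₗ[R] (ℕ → X₂₃)}
    {μ' : (ℕ → X₁) →ₗ[R] (ℕ → X₂₃) →ₗ[R] (ℕ → X)}
    (t₂₃ : ∀ i a, D₂₃ i (shiftT (R := R) a) = shiftT (R := R) (D₂₃ i a))
    (hr : ∀ a b, μ' a (shiftT (R := R) b) = shiftT (R := R) (μ' a b))
    (a : ℕ → X₁) (b : ℕ → X₂) (c : ℕ → X₃) :
    formalStar π D₁ D₂₃ μ' a (formalStar π D₂ D₃ μ₂₃ b c) =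
      formalSum fun N => ∑ p ∈ Finset.HasAntidiagonal.antidiagonal N,
        (expCoeff R p.1 * expCoeff R p.2) •
          (bidiff π D₁ D₂₃ ^ p.1) μ' a ((bidiff π D₂ D₃ ^ p.2) μ₂₃ b c) := by
  rw [formalStar, ← formalSum_formalSum
    (fun n p => (expCoeff R n * expCoeff R p) •
      (bidiff π D₁ D₂₃ ^ n) μ' a ((bidiff π D₂ D₃ ^ p) μ₂₃ b c))]
  congr 1
  ext1 n
  have hΦ : ∀ b, ((bidiff π D₁ D₂₃ ^ n) μ' a) (shiftT (R := R) b) =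
      shiftT (R := R) ((bidiff π D₁ D₂₃ ^ n) μ' a b) := fun b =>
    (bidiff_pow_of_mul (F := μ') (F' := μ') (D₁ := D₁) (D₁' := D₁) (D₂ := D₂₃) (D₂' := D₂₃)
      (φ₁ := LinearMap.id) (φ₂ := shiftT (R := R)) (φ := shiftT (R := R))
      (fun a b => (hr a b).symm) (fun _ _ => rfl) (fun i a => (t₂₃ i a).symm) n a b).symm
  have h := map_formalSum hΦ (fun p => expCoeff R p • (bidiff π D₂ D₃ ^ p) μ₂₃ b c)
  rw [formalStar, h, ← formalSum_smul]
  simp only [map_smul, smul_smul]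

theorem formalStar_assoc {D₁₂ : ι → Module.End R (ℕ → X₁₂)} {D₂₃ : ι → Module.End R (ℕ → X₂₃)}
    {μ₁₂ : (ℕ → X₁) →ₗ[R] (ℕ → X₂) →ₗ[R] (ℕ → X₁₂)}
    {μ₂₃ : (ℕ → X₂) →ₗ[R] (ℕ → X₃) →ₗ[R] (ℕ → X₂₃)}
    {μ : (ℕ → X₁₂) →ₗ[R] (ℕ → X₃) →ₗ[R] (ℕ → X)} {μ' : (ℕ → X₁) →ₗ[R] (ℕ → X₂₃) →ₗ[R] (ℕ → X)}
    (hμ : ∀ a b c, μ (μ₁₂ a b) c = μ' a (μ₂₃ b c))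
    (h₁₂ : ∀ i a b, D₁₂ i (μ₁₂ a b) = μ₁₂ (D₁ i a) b + μ₁₂ a (D₂ i b))
    (h₂₃ : ∀ i a b, D₂₃ i (μ₂₃ a b) = μ₂₃ (D₂ i a) b + μ₂₃ a (D₃ i b))
    (c₁ : ∀ i j a, D₁ i (D₁ j a) = D₁ j (D₁ i a)) (c₂ : ∀ i j a, D₂ i (D₂ j a) = D₂ j (D₂ i a))
    (c₃ : ∀ i j a, D₃ i (D₃ j a) = D₃ j (D₃ i a))
    (t₁₂ : ∀ i a, D₁₂ i (shiftT (R := R) a) = shiftT (R := R) (D₁₂ i a))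
    (t₂₃ : ∀ i a, D₂₃ i (shiftT (R := R) a) = shiftT (R := R) (D₂₃ i a))
    (hl : ∀ a b, μ (shiftT (R := R) a) b = shiftT (R := R) (μ a b))
    (hr : ∀ a b, μ' a (shiftT (R := R) b) = shiftT (R := R) (μ' a b))
    (a : ℕ → X₁) (b : ℕ → X₂) (c : ℕ → X₃) :
    formalStar π D₁₂ D₃ μ (formalStar π D₁ D₂ μ₁₂ a b) c =
      formalStar π D₁ D₂₃ μ' a (formalStar π D₂ D₃ μ₂₃ b c) := by
  rw [formalStar_formalStar_left t₁₂ hl, formalStar_formalStar_right t₂₃ hr]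
  simp only [bidiff_exp_assoc hμ h₁₂ h₂₃ c₁ c₂ c₃]

end FormalStar

/-! ## Elementary operators on `A ⊗ W ⊗ Λ` -/

section ElementaryOperators

variable {R : Type u} [CommRing R] {g : Type v} [LieRing g] [LieAlgebra R g]
variable {ι : Type*} {A : Type w} [AddCommGroup A] [Module R A]

theorem onForms_apply (φ : ExteriorAlgebra R (Module.Dual R g) →ₗ[R]
    ExteriorAlgebra R (Module.Dual R g)) (a : WL R ι g A) (m : ℕ) (β : ι →₀ ℕ) :
    onForms φ a m β = LinearMap.lTensor A φ (a m β) := rfl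

theorem onCoeff_apply (φ : ℕ → (A ⊗[R] ExteriorAlgebra R (Module.Dual R g)) →ₗ[R]
      (A ⊗[R] ExteriorAlgebra R (Module.Dual R g))) (a : WL R ι g A) (m : ℕ) (β : ι →₀ ℕ) :
    onCoeff φ a m β = φ β.degree (a m β) := rfl

theorem insSym_apply (i : ι) (a : WL R ι g A) (m : ℕ) (β : ι →₀ ℕ) :
    insSym i a m β = ((β i + 1 : ℕ) : R) • a m (β + Finsupp.single i 1) := rfl

theorem mulSym_apply (i : ι) (a : WL R ι g A) (m : ℕ) (β : ι →₀ ℕ) :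
    mulSym i a m β = if β i = 0 then 0 else a m (β - Finsupp.single i 1) := rfl

theorem onForms_mul (φ ψ : ExteriorAlgebra R (Module.Dual R g) →ₗ[R]
    ExteriorAlgebra R (Module.Dual R g)) :
    (onForms φ * onForms ψ : Module.End R (WL R ι g A)) = onForms (φ ∘ₗ ψ) := by
  refine LinearMap.ext fun a => funext fun m => funext fun β => ?_
  rw [Module.End.mul_apply, onForms_apply, onForms_apply, onForms_apply, LinearMap.lTensor_comp,
    LinearMap.comp_apply]

theorem onForms_add (φ ψ : ExteriorAlgebra R (Module.Dual R g) →ₗ[R]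
    ExteriorAlgebra R (Module.Dual R g)) :
    (onForms (φ + ψ) : Module.End R (WL R ι g A)) = onForms φ + onForms ψ := by
  refine LinearMap.ext fun a => funext fun m => funext fun β => ?_
  rw [onForms_apply, LinearMap.lTensor_add]; rfl

theorem onForms_neg (φ : ExteriorAlgebra R (Module.Dual R g) →ₗ[R]
    ExteriorAlgebra R (Module.Dual R g)) :
    (onForms (-φ) : Module.End R (WL R ι g A)) = -onForms φ := by
  refine LinearMap.ext fun a => funext fun m => funext fun β => ?_
  rw [onForms_apply, LinearMap.lTensor_neg]; rfl

theorem onForms_smul (c : R) (φ : ExteriorAlgebra R (Module.Dual R g) →ₗ[R]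
    ExteriorAlgebra R (Module.Dual R g)) :
    (onForms (c • φ) : Module.End R (WL R ι g A)) = c • onForms φ := by
  refine LinearMap.ext fun a => funext fun m => funext fun β => ?_
  rw [onForms_apply, LinearMap.lTensor_smul]; rfl

theorem onForms_id : (onForms LinearMap.id : Module.End R (WL R ι g A)) = 1 := by
  refine LinearMap.ext fun a => funext fun m => funext fun β => ?_
  rw [onForms_apply, LinearMap.lTensor_id]; rfl

theorem onForms_insSym (φ : ExteriorAlgebra R (Module.Dual R g) →ₗ[R]
    ExteriorAlgebra R (Module.Dual R g)) (i : ι) :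
    (onForms φ * insSym i : Module.End R (WL R ι g A)) = insSym i * onForms φ := by
  refine LinearMap.ext fun a => funext fun m => funext fun β => ?_
  rw [Module.End.mul_apply, Module.End.mul_apply, onForms_apply, insSym_apply, insSym_apply,
    onForms_apply, map_smul]

theorem onForms_mulSym (φ : ExteriorAlgebra R (Module.Dual R g) →ₗ[R]
    ExteriorAlgebra R (Module.Dual R g)) (i : ι) :
    (onForms φ * mulSym i : Module.End R (WL R ι g A)) = mulSym i * onForms φ := by
  refine LinearMap.ext fun a => funext fun m => funext fun β => ?_
  rw [Module.End.mul_apply, Module.End.mul_apply, onForms_apply, mulSym_apply, mulSym_apply,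
    onForms_apply]
  split_ifs <;> simp

theorem insSym_insSym (i j : ι) :
    (insSym i * insSym j : Module.End R (WL R ι g A)) = insSym j * insSym i := by
  classical
  refine LinearMap.ext fun a => funext fun m => funext fun β => ?_
  rw [Module.End.mul_apply, Module.End.mul_apply]
  simp only [insSym_apply, smul_smul, add_right_comm β (Finsupp.single j 1)]
  rcases eq_or_ne i j with rfl | h
  · rfl
  · simp [h, h.symm, mul_comm]

theorem mulSym_mulSym (i j : ι) :
    (mulSym i * mulSym j : Module.End R (WL R ι g A)) = mulSym j * mulSym i := by
  classical
  refine LinearMap.ext fun a => funext fun m => funext fun β => ?_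
  rw [Module.End.mul_apply, Module.End.mul_apply]
  rcases eq_or_ne i j with rfl | h
  · rfl
  · simp only [mulSym_apply, Finsupp.tsub_apply, Finsupp.single_apply, h, h.symm, if_false,
      tsub_zero, tsub_right_comm (c := Finsupp.single j 1)]
    split_ifs <;> rfl

theorem insSym_mulSym [DecidableEq ι] (i j : ι) :
    (insSym i * mulSym j : Module.End R (WL R ι g A)) =
      mulSym j * insSym i + if i = j then 1 else 0 := by
  refine LinearMap.ext fun a => funext fun m => funext fun β => ?_
  rw [LinearMap.add_apply, Module.End.mul_apply, Module.End.mul_apply, Pi.add_apply, Pi.add_apply]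
  simp only [mulSym_apply, insSym_apply]
  rcases eq_or_ne i j with rfl | h
  · rcases eq_or_ne (β i) 0 with h0 | h0
    · simp [h0]
    · have h1 : β - Finsupp.single i 1 + Finsupp.single i 1 = β :=
        tsub_add_cancel_of_le (by simpa [Nat.one_le_iff_ne_zero] using h0)
      simp [h0, h1, add_smul, Nat.cast_pred (Nat.pos_of_ne_zero h0)]
  · rcases eq_or_ne (β j) 0 with h0 | h0
    · simp [h0, h]
    · have h1 : β + Finsupp.single i 1 - Finsupp.single j 1 =
          β - Finsupp.single j 1 + Finsupp.single i 1 :=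
        tsub_add_eq_add_tsub (by simpa [Nat.one_le_iff_ne_zero] using h0) |>.symm
      simp [h0, h, h.symm, h1]

/-- A linear endomorphism of the coefficient module, extended to `A ⊗ W ⊗ Λ`. -/
def onAct (f : Module.End R A) : Module.End R (WL R ι g A) :=
  onCoeff fun _ => LinearMap.rTensor (ExteriorAlgebra R (Module.Dual R g)) f

theorem onAct_apply (f : Module.End R A) (a : WL R ι g A) (m : ℕ) (β : ι →₀ ℕ) :
    onAct f a m β = LinearMap.rTensor (ExteriorAlgebra R (Module.Dual R g)) f (a m β) := rfl

theorem onAct_mul (f h : Module.End R A) :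
    (onAct f * onAct h : Module.End R (WL R ι g A)) = onAct (f * h) := by
  refine LinearMap.ext fun a => funext fun m => funext fun β => ?_
  rw [Module.End.mul_apply, onAct_apply, onAct_apply, onAct_apply, Module.End.mul_eq_comp,
    LinearMap.rTensor_comp, LinearMap.comp_apply]

theorem onAct_sub (f h : Module.End R A) :
    (onAct (f - h) : Module.End R (WL R ι g A)) = onAct f - onAct h := by
  refine LinearMap.ext fun a => funext fun m => funext fun β => ?_
  rw [onAct_apply, LinearMap.rTensor_sub]; rfl

theorem onAct_onForms (f : Module.End R A) (φ : ExteriorAlgebra R (Module.Dual R g) →ₗ[R]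
    ExteriorAlgebra R (Module.Dual R g)) :
    (onAct f * onForms φ : Module.End R (WL R ι g A)) = onForms φ * onAct f := by
  refine LinearMap.ext fun a => funext fun m => funext fun β => ?_
  rw [Module.End.mul_apply, Module.End.mul_apply, onAct_apply, onForms_apply, onForms_apply,
    onAct_apply, ← LinearMap.comp_apply, ← LinearMap.comp_apply, LinearMap.rTensor_comp_lTensor,
    LinearMap.lTensor_comp_rTensor]

theorem onAct_insSym (f : Module.End R A) (i : ι) :
    (onAct f * insSym i : Module.End R (WL R ι g A)) = insSym i * onAct f := by
  refine LinearMap.ext fun a => funext fun m => funext fun β => ?_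
  rw [Module.End.mul_apply, Module.End.mul_apply, onAct_apply, insSym_apply, insSym_apply,
    onAct_apply, map_smul]

theorem onAct_mulSym (f : Module.End R A) (i : ι) :
    (onAct f * mulSym i : Module.End R (WL R ι g A)) = mulSym i * onAct f := by
  refine LinearMap.ext fun a => funext fun m => funext fun β => ?_
  rw [Module.End.mul_apply, Module.End.mul_apply, onAct_apply, mulSym_apply, mulSym_apply,
    onAct_apply]
  split_ifs <;> simp

/-- Multiplication by the formal parameter. -/
def mulT : Module.End R (WL R ι g A) := shiftT

theorem mulT_zero (a : WL R ι g A) (β : ι →₀ ℕ) : mulT a 0 β = 0 := rfl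

theorem divT_apply (a : WL R ι g A) (m : ℕ) (β : ι →₀ ℕ) : divT a m β = a (m + 1) β := rfl

theorem divT_mulT (a : WL R ι g A) : divT (mulT a) = a := rfl

theorem mulT_divT {a : WL R ι g A} (h : a 0 = 0) : mulT (divT a) = a := by
  refine funext fun m => funext fun β => ?_
  cases m with
  | zero => rw [mulT_zero, h]; rfl
  | succ m => rfl

/-- Identities involving 1/t are proved below after multiplication by t, and t is then cancelled by
this injectivity; `divT` alone inverts multiplication by t on one side only. -/
theorem mulT_injective : Function.Injective (mulT : WL R ι g A → WL R ι g A) :=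
  fun a b h => by rw [← divT_mulT a, h, divT_mulT]

theorem onCoeff_mulT (φ : ℕ → (A ⊗[R] ExteriorAlgebra R (Module.Dual R g)) →ₗ[R]
      (A ⊗[R] ExteriorAlgebra R (Module.Dual R g))) :
    Commute (onCoeff φ : Module.End R (WL R ι g A)) mulT := by
  refine LinearMap.ext fun a => funext fun m => funext fun β => ?_
  rw [Module.End.mul_apply, Module.End.mul_apply]
  cases m with
  | zero => rw [onCoeff_apply, mulT_zero, mulT_zero, map_zero]
  | succ m => rfl

theorem onForms_mulT (φ : ExteriorAlgebra R (Module.Dual R g) →ₗ[R]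
    ExteriorAlgebra R (Module.Dual R g)) :
    Commute (onForms φ : Module.End R (WL R ι g A)) mulT := onCoeff_mulT _

theorem onAct_mulT (f : Module.End R A) : Commute (onAct f : Module.End R (WL R ι g A)) mulT :=
  onCoeff_mulT _

theorem insSym_mulT (i : ι) : Commute (insSym i : Module.End R (WL R ι g A)) mulT := by
  refine LinearMap.ext fun a => funext fun m => funext fun β => ?_
  rw [Module.End.mul_apply, Module.End.mul_apply]
  cases m with
  | zero => rw [insSym_apply, mulT_zero, mulT_zero, smul_zero]
  | succ m => rfl

theorem mulSym_mulT (i : ι) : Commute (mulSym i : Module.End R (WL R ι g A)) mulT := by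
  refine LinearMap.ext fun a => funext fun m => funext fun β => ?_
  rw [Module.End.mul_apply, Module.End.mul_apply]
  cases m with
  | zero => rw [mulSym_apply, mulT_zero, mulT_zero, ite_self]
  | succ m => rfl

end ElementaryOperators

/-! ### Creation and annihilation operators on A ⊗ W ⊗ Λ. -/

section CanonicalRelations

variable {R : Type u} [CommRing R] {g : Type v} [LieRing g] [LieAlgebra R g]
variable {ι : Type*} {A : Type w} [AddCommGroup A] [Module R A]
  (e : Module.Basis ι R g)

/-- Left multiplication by `1 ⊗ 1 ⊗ e^i`. -/
def opW (i : ι) : Module.End R (WL R ι g A) := onForms (wedgeLeft (e.coord i))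

/-- The antisymmetric insertion of `e_i`. -/
def opI (i : ι) : Module.End R (WL R ι g A) := onForms (insVector (e i))

/-- The grading involution with respect to the antisymmetric degree. -/
def parity : Module.End R (WL R ι g A) := onForms gradingInv

theorem opW_opW (i j : ι) : (opW e i * opW e j : Module.End R (WL R ι g A)) = -(opW e j * opW e i) := by
  rw [opW, opW, onForms_mul, onForms_mul, wedgeLeft_wedgeLeft, onForms_neg]

theorem opI_opI (i j : ι) : (opI e i * opI e j : Module.End R (WL R ι g A)) = -(opI e j * opI e i) := by
  rw [opI, opI, onForms_mul, onForms_mul, insVector_insVector, onForms_neg]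

theorem opI_opW [DecidableEq ι] (i j : ι) : (opI e i * opW e j : Module.End R (WL R ι g A)) =
    (if i = j then 1 else 0) - opW e j * opI e i := by
  have h := congrArg (onForms : _ → Module.End R (WL R ι g A)) (insVector_wedgeLeft (e i) (e.coord j))
  rw [onForms_add, onForms_smul, onForms_id] at h
  rw [opI, opW, onForms_mul, onForms_mul, eq_sub_iff_add_eq, h, Module.Basis.coord_apply,
    Module.Basis.repr_self, Finsupp.single_apply]
  split_ifs <;> simp

theorem opW_parity (i : ι) :
    (parity * opW e i : Module.End R (WL R ι g A)) = -(opW e i * parity) := by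
  rw [opW, parity, onForms_mul, onForms_mul, ← onForms_neg]
  congr 1
  refine LinearMap.ext fun x => ?_
  rw [LinearMap.comp_apply, gradingInv_wedgeLeft]; rfl

theorem opI_parity (i : ι) :
    (parity * opI e i : Module.End R (WL R ι g A)) = -(opI e i * parity) := by
  rw [opI, parity, onForms_mul, onForms_mul, ← onForms_neg]
  congr 1
  refine LinearMap.ext fun x => ?_
  rw [LinearMap.neg_apply, LinearMap.comp_apply, LinearMap.comp_apply, insVector_gradingInv, neg_neg]

theorem parity_parity : (parity * parity : Module.End R (WL R ι g A)) = 1 := by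
  rw [parity, onForms_mul, ← onForms_id]
  congr 1
  exact LinearMap.ext fun x => gradingInv_gradingInv x

/-- The creation and annihilation operators on `A ⊗ W ⊗ Λ`. -/
def canonicalOperators [DecidableEq ι] : CanonicalOperators ι (Module.End R (WL R ι g A)) where
  M := mulSym
  D := insSym
  W := opW e
  I := opI e
  P := parity
  M_M := mulSym_mulSym
  D_D := insSym_insSym
  D_M := insSym_mulSym
  W_W := opW_opW e
  I_I := opI_opI e
  I_W := opI_opW e
  W_M _ j := onForms_mulSym _ j
  W_D _ j := onForms_insSym _ j
  I_M _ j := onForms_mulSym _ j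
  I_D _ j := onForms_insSym _ j
  P_M j := onForms_mulSym _ j
  P_D j := onForms_insSym _ j
  P_W := opW_parity e
  P_I := opI_parity e

end CanonicalRelations

/-! ## Convolution products -/

section Convolution

variable {R : Type*} [CommRing R] {M : Type*} [AddCommMonoid M] [Finset.HasAntidiagonal M]
variable {X₁ X₂ X₃ X₁₂ X₂₃ X : Type*} [AddCommGroup X₁] [Module R X₁] [AddCommGroup X₂] [Module R X₂]
  [AddCommGroup X₃] [Module R X₃] [AddCommGroup X₁₂] [Module R X₁₂] [AddCommGroup X₂₃]
  [Module R X₂₃] [AddCommGroup X] [Module R X]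

/-- The convolution product of families indexed by `M`. -/
def conv (M : Type*) [AddCommMonoid M] [Finset.HasAntidiagonal M] (μ : X₁ →ₗ[R] X₂ →ₗ[R] X) :
    (M → X₁) →ₗ[R] (M → X₂) →ₗ[R] (M → X) :=
  LinearMap.mk₂ R
    (fun a b m => ∑ p ∈ Finset.HasAntidiagonal.antidiagonal m, μ (a p.1) (b p.2))
    (by intros; ext m; simp [Finset.sum_add_distrib])
    (by intros; ext m; simp [Finset.smul_sum])
    (by intros; ext m; simp [Finset.sum_add_distrib])
    (by intros; ext m; simp [Finset.smul_sum])

theorem sum_antidiagonal_swap {Z : Type*} [AddCommMonoid Z] (m : M) (f : M × M → Z) :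
    ∑ p ∈ Finset.HasAntidiagonal.antidiagonal m, f p.swap =
      ∑ p ∈ Finset.HasAntidiagonal.antidiagonal m, f p := by
  refine Finset.sum_nbij' Prod.swap Prod.swap ?_ ?_ ?_ ?_ ?_ <;>
    simp +contextual [Finset.HasAntidiagonal.mem_antidiagonal, add_comm]

theorem conv_apply (μ : X₁ →ₗ[R] X₂ →ₗ[R] X) (a : M → X₁) (b : M → X₂) (m : M) :
    conv M μ a b m = ∑ p ∈ Finset.HasAntidiagonal.antidiagonal m, μ (a p.1) (b p.2) := rfl

theorem conv_assoc {μ₁₂ : X₁ →ₗ[R] X₂ →ₗ[R] X₁₂} {μ₂₃ : X₂ →ₗ[R] X₃ →ₗ[R] X₂₃}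
    {μ : X₁₂ →ₗ[R] X₃ →ₗ[R] X} {μ' : X₁ →ₗ[R] X₂₃ →ₗ[R] X}
    (h : ∀ a b c, μ (μ₁₂ a b) c = μ' a (μ₂₃ b c)) (a : M → X₁) (b : M → X₂) (c : M → X₃) :
    conv M μ (conv M μ₁₂ a b) c = conv M μ' a (conv M μ₂₃ b c) := by
  ext m
  simp only [conv_apply, map_sum, LinearMap.sum_apply, h, Finset.sum_sigma']
  apply Finset.sum_nbij' (fun ⟨⟨_, j⟩, ⟨k, l⟩⟩ ↦ ⟨(k, l + j), (l, j)⟩)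
    (fun ⟨⟨i, _⟩, ⟨k, l⟩⟩ ↦ ⟨(i + k, l), (i, k)⟩) <;>
    simp +contextual [Finset.HasAntidiagonal.mem_antidiagonal, add_assoc] <;> grind

theorem map_conv {Y₁ Y₂ Y : Type*} [AddCommGroup Y₁] [Module R Y₁]
    [AddCommGroup Y₂] [Module R Y₂] [AddCommGroup Y] [Module R Y]
    {μ : X₁ →ₗ[R] X₂ →ₗ[R] X} {μ' : Y₁ →ₗ[R] Y₂ →ₗ[R] Y}
    {φ₁ : X₁ → Y₁} {φ₂ : X₂ → Y₂} {φ : X →ₗ[R] Y} (h : ∀ a b, φ (μ a b) = μ' (φ₁ a) (φ₂ b))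
    (a : M → X₁) (b : M → X₂) (m : M) :
    φ (conv M μ a b m) = conv M μ' (fun k => φ₁ (a k)) (fun k => φ₂ (b k)) m := by
  simp only [conv_apply, map_sum, h]

theorem conv_derivation {μ : X₁ →ₗ[R] X₂ →ₗ[R] X}
    {d₁ : X₁ → X₁} {d₂ : X₂ → X₂} {d : Module.End R X}
    (h : ∀ a b, d (μ a b) = μ (d₁ a) b + μ a (d₂ b)) (a : M → X₁) (b : M → X₂) (m : M) :
    d (conv M μ a b m) =
      conv M μ (fun k => d₁ (a k)) b m + conv M μ a (fun k => d₂ (b k)) m := by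
  simp only [conv_apply, map_sum, h, Finset.sum_add_distrib]

theorem conv_swap {μ : X₁ →ₗ[R] X₂ →ₗ[R] X} {μ' : X₂ →ₗ[R] X₁ →ₗ[R] X} {S : Set X₁} {φ : X₂ → X₂}
    (h : ∀ a ∈ S, ∀ b, μ a b = μ' (φ b) a) {a : M → X₁} (ha : ∀ m, a m ∈ S) (b : M → X₂) :
    conv M μ a b = conv M μ' (fun k => φ (b k)) a := by
  ext m
  rw [conv_apply, conv_apply, ← sum_antidiagonal_swap]
  exact Finset.sum_congr rfl fun p _ => h _ (ha _) _

theorem conv_flip (μ : X₁ →ₗ[R] X₂ →ₗ[R] X) (a : M → X₁) (b : M → X₂) :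
    conv M μ.flip b a = conv M μ a b :=
  (conv_swap (S := Set.univ) (φ := fun b => b) (fun _ _ _ => rfl) (fun _ => trivial) b).symm

theorem conv_shiftT_left (μ : X₁ →ₗ[R] X₂ →ₗ[R] X) (a : ℕ → X₁) (b : ℕ → X₂) :
    conv ℕ μ (shiftT (R := R) a) b = shiftT (R := R) (conv ℕ μ a b) := by
  ext m
  cases m with
  | zero => simp [conv_apply, shiftT]
  | succ m => simp [conv_apply, shiftT, Finset.Nat.sum_antidiagonal_succ]

theorem conv_shiftT_right (μ : X₁ →ₗ[R] X₂ →ₗ[R] X) (a : ℕ → X₁) (b : ℕ → X₂) :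
    conv ℕ μ a (shiftT (R := R) b) = shiftT (R := R) (conv ℕ μ a b) := by
  rw [← conv_flip, conv_shiftT_left, conv_flip]

variable {ι : Type*} [DecidableEq ι]

/-- The partial derivative on polynomials with coefficients. -/
def polyDeriv (i : ι) : Module.End R ((ι →₀ ℕ) → X) where
  toFun a := fun β => ((β i + 1 : ℕ) : R) • a (β + Finsupp.single i 1)
  map_add' a b := by ext β; simp
  map_smul' c a := by ext β; simp [smul_comm c]

/-- Multiplication of polynomials by a variable. -/
def polyVar (i : ι) : Module.End R ((ι →₀ ℕ) → X) where
  toFun a := fun β => if β i = 0 then 0 else a (β - Finsupp.single i 1)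
  map_add' a b := by
    ext β
    by_cases h : β i = 0 <;> simp [h]
  map_smul' c a := by
    ext β
    by_cases h : β i = 0 <;> simp [h]

/-- Only exponents p that contain the variable i contribute, and these are the shifts by one of
exponents for β. Both multiplication by a variable and differentiation reduce to this reindexing. -/
theorem sum_antidiagonal_add_single {Z : Type*} [AddCommMonoid Z] (i : ι) (β : ι →₀ ℕ)
    (f : (ι →₀ ℕ) → (ι →₀ ℕ) → Z) (hf : ∀ p q, p i = 0 → f p q = 0) :
    ∑ p ∈ Finset.HasAntidiagonal.antidiagonal (β + Finsupp.single i 1), f p.1 p.2 =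
      ∑ p ∈ Finset.HasAntidiagonal.antidiagonal β, f (p.1 + Finsupp.single i 1) p.2 := by
  symm
  refine Finset.sum_of_injOn (fun p => (p.1 + Finsupp.single i 1, p.2)) ?_ ?_ ?_ fun _ _ => rfl
  · rintro ⟨p, q⟩ _ ⟨p', q'⟩ _ h
    simpa using h
  · rintro ⟨p, q⟩ h
    have h' := Finset.HasAntidiagonal.mem_antidiagonal.1 h
    refine Finset.HasAntidiagonal.mem_antidiagonal.2 ?_
    simp only at h' ⊢
    rw [← h', add_right_comm]
  · rintro ⟨p, q⟩ h hn
    refine hf p q (by_contra fun hp => hn ⟨(p - Finsupp.single i 1, q), ?_, ?_⟩)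
    · have h' := Finset.HasAntidiagonal.mem_antidiagonal.1 h
      refine Finset.HasAntidiagonal.mem_antidiagonal.2 ?_
      simp only at h' ⊢
      have hs : Finsupp.single i 1 ≤ p := by simpa [Nat.one_le_iff_ne_zero] using hp
      rw [tsub_add_eq_add_tsub hs, h', add_tsub_cancel_right]
    · have hs : Finsupp.single i 1 ≤ p := by simpa [Nat.one_le_iff_ne_zero] using hp
      simp [tsub_add_cancel_of_le hs]

theorem conv_polyVar_left (i : ι) (μ : X₁ →ₗ[R] X₂ →ₗ[R] X) (a : (ι →₀ ℕ) → X₁)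
    (b : (ι →₀ ℕ) → X₂) :
    conv (ι →₀ ℕ) μ (polyVar (R := R) i a) b = polyVar (R := R) i (conv (ι →₀ ℕ) μ a b) := by
  ext β
  by_cases h : β i = 0
  · rw [conv_apply]
    refine (Finset.sum_eq_zero fun p hp => ?_).trans (if_pos h).symm
    have h' : p.1 i = 0 := by
      have := congrArg (fun γ => γ i) (Finset.HasAntidiagonal.mem_antidiagonal.1 hp)
      simp only [Finsupp.add_apply] at this
      omega
    simp [polyVar, h']
  · have hs : Finsupp.single i 1 ≤ β := by simpa [Nat.one_le_iff_ne_zero] using h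
    have h1 := sum_antidiagonal_add_single i (β - Finsupp.single i 1)
      (fun p q => μ (polyVar (R := R) i a p) (b q)) (fun p q hp => by simp [polyVar, hp])
    rw [tsub_add_cancel_of_le hs] at h1
    rw [conv_apply, h1]
    refine Eq.trans ?_ (if_neg h).symm
    rw [conv_apply]
    simp [polyVar]

theorem conv_polyVar_right (i : ι) (μ : X₁ →ₗ[R] X₂ →ₗ[R] X) (a : (ι →₀ ℕ) → X₁)
    (b : (ι →₀ ℕ) → X₂) :
    conv (ι →₀ ℕ) μ a (polyVar (R := R) i b) = polyVar (R := R) i (conv (ι →₀ ℕ) μ a b) := by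
  rw [← conv_flip, conv_polyVar_left, conv_flip]

/-- The derivative of one factor is expressed as the weight p_i on the undifferentiated product. The
Leibniz rule then becomes the additivity of exponents, p_i + q_i = β_i + 1. -/
theorem conv_polyDeriv_apply (i : ι) (μ : X₁ →ₗ[R] X₂ →ₗ[R] X) (a : (ι →₀ ℕ) → X₁)
    (b : (ι →₀ ℕ) → X₂) (β : ι →₀ ℕ) :
    conv (ι →₀ ℕ) μ (polyDeriv (R := R) i a) b β =
      ∑ p ∈ Finset.HasAntidiagonal.antidiagonal (β + Finsupp.single i 1),
        (((Prod.fst p : ι →₀ ℕ) i : ℕ) : R) • μ (a p.1) (b p.2) := by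
  rw [sum_antidiagonal_add_single i β (fun p q => ((p i : ℕ) : R) • μ (a p) (b q))
    (fun p q hp => by simp [hp]), conv_apply]
  simp [polyDeriv]

theorem polyDeriv_conv (i : ι) (μ : X₁ →ₗ[R] X₂ →ₗ[R] X) (a : (ι →₀ ℕ) → X₁)
    (b : (ι →₀ ℕ) → X₂) :
    polyDeriv (R := R) i (conv (ι →₀ ℕ) μ a b) =
      conv (ι →₀ ℕ) μ (polyDeriv (R := R) i a) b + conv (ι →₀ ℕ) μ a (polyDeriv (R := R) i b) := by
  ext β
  rw [Pi.add_apply, conv_polyDeriv_apply, ← conv_flip μ a (polyDeriv (R := R) i b), conv_polyDeriv_apply, 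
    ← sum_antidiagonal_swap _ fun p : (ι →₀ ℕ) × (ι →₀ ℕ) => ((p.1 i : ℕ) : R) • μ.flip (b p.1) (a p.2),
    ← Finset.sum_add_distrib]
  simp only [polyDeriv, LinearMap.coe_mk, AddHom.coe_mk, conv_apply, Finset.smul_sum]
  refine Finset.sum_congr rfl fun p hp => ?_
  have := congrArg (fun γ => γ i) (Finset.HasAntidiagonal.mem_antidiagonal.1 hp)
  simp only [Finsupp.add_apply, Finsupp.single_eq_same] at this
  rw [← this, Prod.fst_swap, Prod.snd_swap, LinearMap.flip_apply, ← add_smul, Nat.cast_add]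

end Convolution

/-! ## The deformed product -/

section WLProduct

variable {R : Type u} [CommRing R] {g : Type v} [LieRing g] [LieAlgebra R g]
variable {ι : Type*} [DecidableEq ι]
variable {A₁ : Type w₁} {A₂ : Type w₂} {A₃ : Type w₃} {A₁₂ : Type w₄} {A₂₃ : Type w₅} {A : Type w}
  [AddCommGroup A₁] [Module R A₁] [AddCommGroup A₂] [Module R A₂]
  [AddCommGroup A₃] [Module R A₃] [AddCommGroup A₁₂] [Module R A₁₂] [AddCommGroup A₂₃]
  [Module R A₂₃] [AddCommGroup A] [Module R A]

variable (g) in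
/-- The product of coefficients in `A ⊗ Λ g*`. -/
def coeffMul (B : A₁ →ₗ[R] A₂ →ₗ[R] A) :
    A₁ ⊗[R] ExteriorAlgebra R (Module.Dual R g) →ₗ[R]
      A₂ ⊗[R] ExteriorAlgebra R (Module.Dual R g) →ₗ[R]
        A ⊗[R] ExteriorAlgebra R (Module.Dual R g) :=
  TensorProduct.map₂ B (LinearMap.mul R (ExteriorAlgebra R (Module.Dual R g)))

theorem coeffMul_tmul (B : A₁ →ₗ[R] A₂ →ₗ[R] A) (a : A₁) (b : A₂)
    (x y : ExteriorAlgebra R (Module.Dual R g)) :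
    coeffMul g B (a ⊗ₜ x) (b ⊗ₜ y) = B a b ⊗ₜ (x * y) := by
  rw [coeffMul, TensorProduct.map₂_apply_tmul, TensorProduct.map_tmul, LinearMap.mul_apply']

theorem coeffMul_assoc {B₁₂ : A₁ →ₗ[R] A₂ →ₗ[R] A₁₂} {B₂₃ : A₂ →ₗ[R] A₃ →ₗ[R] A₂₃}
    {B : A₁₂ →ₗ[R] A₃ →ₗ[R] A} {B' : A₁ →ₗ[R] A₂₃ →ₗ[R] A}
    (h : ∀ a b c, B (B₁₂ a b) c = B' a (B₂₃ b c))
    (a : A₁ ⊗[R] ExteriorAlgebra R (Module.Dual R g))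
    (b : A₂ ⊗[R] ExteriorAlgebra R (Module.Dual R g))
    (c : A₃ ⊗[R] ExteriorAlgebra R (Module.Dual R g)) :
    coeffMul g B (coeffMul g B₁₂ a b) c = coeffMul g B' a (coeffMul g B₂₃ b c) := by
  induction a using TensorProduct.induction_on with
  | zero => simp only [map_zero, LinearMap.zero_apply]
  | add a a' ha ha' => simp only [map_add, LinearMap.add_apply, ha, ha']
  | tmul a x =>
    induction b using TensorProduct.induction_on with
    | zero => simp only [map_zero, LinearMap.zero_apply]
    | add b b' hb hb' => simp only [map_add, LinearMap.add_apply, hb, hb']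
    | tmul b y =>
      induction c using TensorProduct.induction_on with
      | zero => simp only [map_zero]
      | add c c' hc hc' => simp only [map_add, hc, hc']
      | tmul c z => simp only [coeffMul_tmul, h, mul_assoc]

/-- Compatibility of maps of coefficients with products may be checked on pure tensors. -/
theorem coeffMul_ext {N : Type*} [AddCommGroup N] [Module R N]
    {F G : A₁ ⊗[R] ExteriorAlgebra R (Module.Dual R g) →ₗ[R]
      A₂ ⊗[R] ExteriorAlgebra R (Module.Dual R g) →ₗ[R] N}
    (h : ∀ a x b y, F (a ⊗ₜ x) (b ⊗ₜ y) = G (a ⊗ₜ x) (b ⊗ₜ y)) (p q) : F p q = G p q := by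
  have : F = G := TensorProduct.ext' fun a x => TensorProduct.ext' fun b y => h a x b y
  rw [this]

theorem coeffMul_wedgeLeft (B : A₁ →ₗ[R] A₂ →ₗ[R] A) (α : Module.Dual R g) (p q) :
    LinearMap.lTensor A (wedgeLeft α) (coeffMul g B p q) =
      coeffMul g B (LinearMap.lTensor A₁ (wedgeLeft α) p) q :=
  coeffMul_ext (F := (coeffMul g B).compr₂ (LinearMap.lTensor A (wedgeLeft α)))
    (G := coeffMul g B ∘ₗ (LinearMap.lTensor A₁ (wedgeLeft α)))
    (fun a x b y => by
      rw [LinearMap.compr₂_apply, LinearMap.comp_apply, coeffMul_tmul, LinearMap.lTensor_tmul,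
        LinearMap.lTensor_tmul, coeffMul_tmul, wedgeLeft_mul]) p q

theorem coeffMul_gradingInv (B : A₁ →ₗ[R] A₂ →ₗ[R] A) (p q) :
    LinearMap.lTensor A (gradingInv (g := g)) (coeffMul g B p q) =
      coeffMul g B (LinearMap.lTensor A₁ gradingInv p) (LinearMap.lTensor A₂ gradingInv q) :=
  coeffMul_ext (F := (coeffMul g B).compr₂ (LinearMap.lTensor A gradingInv))
    (G := (coeffMul g B).compl₁₂ (LinearMap.lTensor A₁ gradingInv) (LinearMap.lTensor A₂ gradingInv))
    (fun a x b y => by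
      rw [LinearMap.compr₂_apply, LinearMap.compl₁₂_apply, coeffMul_tmul, LinearMap.lTensor_tmul,
        LinearMap.lTensor_tmul, LinearMap.lTensor_tmul, coeffMul_tmul, gradingInv_mul]) p q

theorem coeffMul_gradingInv_wedgeLeft (B : A₁ →ₗ[R] A₂ →ₗ[R] A) (α : Module.Dual R g) (p q) :
    LinearMap.lTensor A (wedgeLeft α) (coeffMul g B p q) =
      coeffMul g B (LinearMap.lTensor A₁ gradingInv p) (LinearMap.lTensor A₂ (wedgeLeft α) q) :=
  coeffMul_ext (F := (coeffMul g B).compr₂ (LinearMap.lTensor A (wedgeLeft α)))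
    (G := (coeffMul g B).compl₁₂ (LinearMap.lTensor A₁ gradingInv)
      (LinearMap.lTensor A₂ (wedgeLeft α)))
    (fun a x b y => by
      rw [LinearMap.compr₂_apply, LinearMap.compl₁₂_apply, coeffMul_tmul, LinearMap.lTensor_tmul,
        LinearMap.lTensor_tmul, LinearMap.lTensor_tmul, coeffMul_tmul, gradingInv_mul_wedgeLeft])
    p q

theorem coeffMul_derivation_forms (B : A₁ →ₗ[R] A₂ →ₗ[R] A)
    {φ : ExteriorAlgebra R (Module.Dual R g) →ₗ[R] ExteriorAlgebra R (Module.Dual R g)}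
    (hφ : ∀ x y, φ (x * y) = φ x * y + x * φ y) (p q) :
    LinearMap.lTensor A φ (coeffMul g B p q) =
      coeffMul g B (LinearMap.lTensor A₁ φ p) q + coeffMul g B p (LinearMap.lTensor A₂ φ q) :=
  coeffMul_ext (F := (coeffMul g B).compr₂ (LinearMap.lTensor A φ))
    (G := coeffMul g B ∘ₗ (LinearMap.lTensor A₁ φ) +
      (coeffMul g B).compl₂ (LinearMap.lTensor A₂ φ))
    (fun a x b y => by
      rw [LinearMap.compr₂_apply, LinearMap.add_apply, LinearMap.add_apply, LinearMap.comp_apply,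
        LinearMap.compl₂_apply, coeffMul_tmul, LinearMap.lTensor_tmul, LinearMap.lTensor_tmul,
        LinearMap.lTensor_tmul, coeffMul_tmul, coeffMul_tmul, hφ, TensorProduct.tmul_add]) p q

theorem coeffMul_derivation_act {B : A₁ →ₗ[R] A₂ →ₗ[R] A} {f₁ : Module.End R A₁}
    {f₂ : Module.End R A₂} {f : Module.End R A}
    (hf : ∀ a b, f (B a b) = B (f₁ a) b + B a (f₂ b)) (p q) :
    LinearMap.rTensor (ExteriorAlgebra R (Module.Dual R g)) f (coeffMul g B p q) =
      coeffMul g B (LinearMap.rTensor _ f₁ p) q + coeffMul g B p (LinearMap.rTensor _ f₂ q) :=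
  coeffMul_ext (F := (coeffMul g B).compr₂ (LinearMap.rTensor _ f))
    (G := coeffMul g B ∘ₗ (LinearMap.rTensor _ f₁) +
      (coeffMul g B).compl₂ (LinearMap.rTensor _ f₂))
    (fun a x b y => by
      rw [LinearMap.compr₂_apply, LinearMap.add_apply, LinearMap.add_apply, LinearMap.comp_apply,
        LinearMap.compl₂_apply, coeffMul_tmul, LinearMap.rTensor_tmul, LinearMap.rTensor_tmul,
        LinearMap.rTensor_tmul, coeffMul_tmul, coeffMul_tmul, hf, TensorProduct.add_tmul]) p q

variable (R g A) in
/-- The coefficients of antisymmetric degree `l`. -/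
def coeffDegree (l : ℕ) : Submodule R (A ⊗[R] ExteriorAlgebra R (Module.Dual R g)) :=
  LinearMap.range (LinearMap.lTensor A (⋀[R]^l (Module.Dual R g)).subtype)

theorem tmul_mem_coeffDegree (a : A) {l : ℕ} {x : ExteriorAlgebra R (Module.Dual R g)}
    (hx : x ∈ ⋀[R]^l (Module.Dual R g)) : a ⊗ₜ x ∈ coeffDegree R g A l :=
  ⟨a ⊗ₜ ⟨x, hx⟩, LinearMap.lTensor_tmul _ _ _ _⟩

theorem coeffDegree_induction {l : ℕ} {p : A ⊗[R] ExteriorAlgebra R (Module.Dual R g) → Prop}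
    (h0 : p 0) (h1 : ∀ a, ∀ x ∈ ⋀[R]^l (Module.Dual R g), p (a ⊗ₜ x))
    (h2 : ∀ x y, p x → p y → p (x + y)) {x} (hx : x ∈ coeffDegree R g A l) : p x := by
  obtain ⟨y, rfl⟩ := hx
  induction y using TensorProduct.induction_on with
  | zero => rwa [map_zero]
  | add y z hy hz => rw [map_add]; exact h2 _ _ hy hz
  | tmul a x => rw [LinearMap.lTensor_tmul]; exact h1 a _ x.2

/-- The map φ carries the sign rule: it is the identity when l is even and the grading involution
when l = 1, so both cases are treated at once. -/
theorem coeffMul_swap {B : A₁ →ₗ[R] A₂ →ₗ[R] A} {l : ℕ}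
    {φ : ExteriorAlgebra R (Module.Dual R g) →ₗ[R] ExteriorAlgebra R (Module.Dual R g)}
    (hφ : ∀ x ∈ ⋀[R]^l (Module.Dual R g), ∀ y, x * y = φ y * x) (p) (hp : p ∈ coeffDegree R g A₁ l)
    (q) : coeffMul g B p q = coeffMul g B.flip (LinearMap.lTensor A₂ φ q) p := by
  refine coeffDegree_induction (p := fun p => coeffMul g B p q =
    coeffMul g B.flip (LinearMap.lTensor A₂ φ q) p) ?_ (fun a x hx => ?_) (fun x y hx hy => ?_) hp
  · rw [map_zero, map_zero, LinearMap.zero_apply]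
  · induction q using TensorProduct.induction_on with
    | zero => rw [map_zero, map_zero, map_zero, LinearMap.zero_apply]
    | add b c hb hc => rw [map_add, map_add, map_add, LinearMap.add_apply, hb, hc]
    | tmul b y => rw [LinearMap.lTensor_tmul, coeffMul_tmul, coeffMul_tmul, hφ x hx,
        LinearMap.flip_apply]
  · rw [map_add, map_add, LinearMap.add_apply, hx, hy]

theorem coeffMul_mem (B : A₁ →ₗ[R] A₂ →ₗ[R] A) {k l : ℕ} {p q}
    (hp : p ∈ coeffDegree R g A₁ k) (hq : q ∈ coeffDegree R g A₂ l) :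
    coeffMul g B p q ∈ coeffDegree R g A (k + l) := by
  refine coeffDegree_induction (p := fun p => coeffMul g B p q ∈ coeffDegree R g A (k + l))
    ?_ (fun a x hx => ?_) (fun x y hx hy => ?_) hp
  · rw [map_zero, LinearMap.zero_apply]; exact zero_mem _
  · refine coeffDegree_induction
      (p := fun q => coeffMul g B (a ⊗ₜ x) q ∈ coeffDegree R g A (k + l))
      ?_ (fun b y hy => ?_) (fun y z hy hz => ?_) hq
    · rw [map_zero]; exact zero_mem _
    · rw [coeffMul_tmul]
      refine tmul_mem_coeffDegree _ ?_
      rw [ExteriorAlgebra.exteriorPower, pow_add]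
      exact Submodule.mul_mem_mul hx hy
    · rw [map_add]; exact add_mem hy hz
  · rw [map_add, LinearMap.add_apply]; exact add_mem hx hy

theorem wmul_apply (B : A₁ →ₗ[R] A₂ →ₗ[R] A) (a : WL R ι g A₁) (b : WL R ι g A₂) (m : ℕ)
    (β : ι →₀ ℕ) : wmul B a b m β = ∑ p ∈ Finset.HasAntidiagonal.antidiagonal m,
      ∑ q ∈ Finset.HasAntidiagonal.antidiagonal β, coeffMul g B (a p.1 q.1) (b p.2 q.2) := rfl

/-- The product is a convolution in t over a convolution in the symmetric variables over the
coefficient product, so its properties can be checked on each of the three levels separately. -/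
theorem wmul_eq_conv (B : A₁ →ₗ[R] A₂ →ₗ[R] A) (a : WL R ι g A₁) (b : WL R ι g A₂) :
    wmul B a b = conv ℕ (conv (ι →₀ ℕ) (coeffMul g B)) a b := by
  refine funext fun m => funext fun β => ?_
  rw [conv_apply, Finset.sum_apply]
  rfl

theorem wmul_assoc {B₁₂ : A₁ →ₗ[R] A₂ →ₗ[R] A₁₂} {B₂₃ : A₂ →ₗ[R] A₃ →ₗ[R] A₂₃}
    {B : A₁₂ →ₗ[R] A₃ →ₗ[R] A} {B' : A₁ →ₗ[R] A₂₃ →ₗ[R] A}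
    (h : ∀ a b c, B (B₁₂ a b) c = B' a (B₂₃ b c))
    (a : WL R ι g A₁) (b : WL R ι g A₂) (c : WL R ι g A₃) :
    wmul B (wmul B₁₂ a b) c = wmul B' a (wmul B₂₃ b c) := by
  simp only [wmul_eq_conv]
  exact conv_assoc (fun a b c => conv_assoc (coeffMul_assoc h) a b c) a b c

theorem insSym_wmul (B : A₁ →ₗ[R] A₂ →ₗ[R] A) (i : ι) (a : WL R ι g A₁) (b : WL R ι g A₂) :
    insSym i (wmul B a b) = wmul B (insSym i a) b + wmul B a (insSym i b) := by
  simp only [wmul_eq_conv]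
  exact funext fun m => conv_derivation (polyDeriv_conv i (coeffMul g B)) a b m

theorem wmul_mulSym_left (B : A₁ →ₗ[R] A₂ →ₗ[R] A) (i : ι) (a : WL R ι g A₁) (b : WL R ι g A₂) :
    wmul B (mulSym i a) b = mulSym i (wmul B a b) := by
  simp only [wmul_eq_conv]
  exact funext fun m => (map_conv (φ₁ := polyVar (R := R) i) (φ₂ := fun b => b)
    (φ := polyVar (R := R) i) (μ := conv (ι →₀ ℕ) (coeffMul g B))
    (μ' := conv (ι →₀ ℕ) (coeffMul g B)) (fun a b => (conv_polyVar_left i (coeffMul g B) a b).symm) a b m).symm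

theorem wmul_mulSym_right (B : A₁ →ₗ[R] A₂ →ₗ[R] A) (i : ι) (a : WL R ι g A₁) (b : WL R ι g A₂) :
    wmul B a (mulSym i b) = mulSym i (wmul B a b) := by
  simp only [wmul_eq_conv]
  exact funext fun m => (map_conv (φ₁ := fun a => a) (φ₂ := polyVar (R := R) i)
    (φ := polyVar (R := R) i) (μ := conv (ι →₀ ℕ) (coeffMul g B))
    (μ' := conv (ι →₀ ℕ) (coeffMul g B)) (fun a b => (conv_polyVar_right i (coeffMul g B) a b).symm) a b m).symm

theorem onForms_wmul {B : A₁ →ₗ[R] A₂ →ₗ[R] A}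
    {φ φ₁ φ₂ : ExteriorAlgebra R (Module.Dual R g) →ₗ[R] ExteriorAlgebra R (Module.Dual R g)}
    (h : ∀ p q, LinearMap.lTensor A φ (coeffMul g B p q) =
      coeffMul g B (LinearMap.lTensor A₁ φ₁ p) (LinearMap.lTensor A₂ φ₂ q))
    (a : WL R ι g A₁) (b : WL R ι g A₂) :
    onForms φ (wmul B a b) = wmul B (onForms φ₁ a) (onForms φ₂ b) := by
  simp only [wmul_eq_conv]
  refine funext fun m => ?_
  refine Eq.trans ?_ (map_conv (φ₁ := fun a k => LinearMap.lTensor A₁ φ₁ (a k))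
    (φ₂ := fun b k => LinearMap.lTensor A₂ φ₂ (b k))
    (φ := LinearMap.compLeft (LinearMap.lTensor A φ) (ι →₀ ℕ))
    (μ := conv (ι →₀ ℕ) (coeffMul g B)) (μ' := conv (ι →₀ ℕ) (coeffMul g B))
    (fun a b => funext fun β => map_conv h a b β) a b m)
  rfl

theorem wmul_opW_left (e : Module.Basis ι R g) (B : A₁ →ₗ[R] A₂ →ₗ[R] A) (i : ι)
    (a : WL R ι g A₁) (b : WL R ι g A₂) :
    wmul B (opW e i a) b = opW e i (wmul B a b) := by
  have h := onForms_wmul (B := B) (φ := wedgeLeft (e.coord i)) (φ₁ := wedgeLeft (e.coord i))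
    (φ₂ := LinearMap.id)
    (fun p q => by rw [LinearMap.lTensor_id]; exact coeffMul_wedgeLeft B _ p q) a b
  have h1 : onForms LinearMap.id b = b := LinearMap.congr_fun onForms_id b
  rw [h1] at h
  exact h.symm

theorem parity_wmul (B : A₁ →ₗ[R] A₂ →ₗ[R] A) (a : WL R ι g A₁) (b : WL R ι g A₂) :
    parity (wmul B a b) = wmul B (parity a) (parity b) :=
  onForms_wmul (coeffMul_gradingInv B) a b

theorem wmul_parity_opW (e : Module.Basis ι R g) (B : A₁ →ₗ[R] A₂ →ₗ[R] A) (i : ι)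
    (a : WL R ι g A₁) (b : WL R ι g A₂) :
    wmul B (parity a) (opW e i b) = opW e i (wmul B a b) :=
  (onForms_wmul (coeffMul_gradingInv_wedgeLeft B (e.coord i)) a b).symm

theorem onCoeff_wmul_derivation {B : A₁ →ₗ[R] A₂ →ₗ[R] A}
    {ψ₁ : Module.End R (A₁ ⊗[R] ExteriorAlgebra R (Module.Dual R g))}
    {ψ₂ : Module.End R (A₂ ⊗[R] ExteriorAlgebra R (Module.Dual R g))}
    {ψ : Module.End R (A ⊗[R] ExteriorAlgebra R (Module.Dual R g))}
    (h : ∀ p q, ψ (coeffMul g B p q) = coeffMul g B (ψ₁ p) q + coeffMul g B p (ψ₂ q))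
    (a : WL R ι g A₁) (b : WL R ι g A₂) :
    onCoeff (fun _ => ψ) (wmul B a b) =
      wmul B (onCoeff (fun _ => ψ₁) a) b + wmul B a (onCoeff (fun _ => ψ₂) b) := by
  simp only [wmul_eq_conv]
  refine funext fun m => ?_
  refine Eq.trans ?_ (conv_derivation (d₁ := fun a k => ψ₁ (a k)) (d₂ := fun b k => ψ₂ (b k))
    (d := LinearMap.compLeft ψ (ι →₀ ℕ)) (μ := conv (ι →₀ ℕ) (coeffMul g B))
    (fun a b => funext fun β => conv_derivation h a b β) a b m)
  rfl

theorem onForms_wmul_derivation (B : A₁ →ₗ[R] A₂ →ₗ[R] A)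
    {φ : ExteriorAlgebra R (Module.Dual R g) →ₗ[R] ExteriorAlgebra R (Module.Dual R g)}
    (hφ : ∀ x y, φ (x * y) = φ x * y + x * φ y) (a : WL R ι g A₁) (b : WL R ι g A₂) :
    onForms φ (wmul B a b) = wmul B (onForms φ a) b + wmul B a (onForms φ b) :=
  onCoeff_wmul_derivation (coeffMul_derivation_forms B hφ) a b

theorem onAct_wmul_derivation {B : A₁ →ₗ[R] A₂ →ₗ[R] A} {f₁ : Module.End R A₁}
    {f₂ : Module.End R A₂} {f : Module.End R A}
    (hf : ∀ a b, f (B a b) = B (f₁ a) b + B a (f₂ b)) (a : WL R ι g A₁) (b : WL R ι g A₂) :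
    onAct f (wmul B a b) = wmul B (onAct f₁ a) b + wmul B a (onAct f₂ b) :=
  onCoeff_wmul_derivation (coeffMul_derivation_act hf) a b

theorem wmul_mulT_left (B : A₁ →ₗ[R] A₂ →ₗ[R] A) (a : WL R ι g A₁) (b : WL R ι g A₂) :
    wmul B (mulT a) b = mulT (wmul B a b) := by
  simp only [wmul_eq_conv]
  exact conv_shiftT_left _ a b

theorem wmul_mulT_right (B : A₁ →ₗ[R] A₂ →ₗ[R] A) (a : WL R ι g A₁) (b : WL R ι g A₂) :
    wmul B a (mulT b) = mulT (wmul B a b) := by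
  simp only [wmul_eq_conv]
  exact conv_shiftT_right _ a b

theorem wmul_swap {B : A₁ →ₗ[R] A₂ →ₗ[R] A} {l : ℕ}
    {φ : ExteriorAlgebra R (Module.Dual R g) →ₗ[R] ExteriorAlgebra R (Module.Dual R g)}
    (hφ : ∀ x ∈ ⋀[R]^l (Module.Dual R g), ∀ y, x * y = φ y * x) {a : WL R ι g A₁}
    (ha : ∀ m β, a m β ∈ coeffDegree R g A₁ l) (b : WL R ι g A₂) :
    wmul B a b = wmul B.flip (onForms φ b) a := by
  refine funext fun m => funext fun β => ?_
  rw [wmul_apply, wmul_apply, ← sum_antidiagonal_swap]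
  refine Finset.sum_congr rfl fun p _ => ?_
  rw [← sum_antidiagonal_swap]
  exact Finset.sum_congr rfl fun q _ => coeffMul_swap hφ _ (ha _ _) _

/-- The elements of antisymmetric degree `l`. -/
def antisymDegree (l : ℕ) : Submodule R (WL R ι g A) where
  carrier := {a | ∀ m β, a m β ∈ coeffDegree R g A l}
  zero_mem' _ _ := zero_mem _
  add_mem' ha hb m β := add_mem (ha m β) (hb m β)
  smul_mem' c _ ha m β := Submodule.smul_mem _ c (ha m β)

/-- The elements of total degree at least `d`. -/
def totalFiltration (d : ℕ) : Submodule R (WL R ι g A) where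
  carrier := {a | ∀ m (β : ι →₀ ℕ), 2 * m + β.degree < d → a m β = 0}
  zero_mem' _ _ _ := rfl
  add_mem' {a b} ha hb m β h := by
    change a m β + b m β = 0
    rw [ha m β h, hb m β h, add_zero]
  smul_mem' c a ha m β h := by
    change c • a m β = 0
    rw [ha m β h, smul_zero]

theorem wmul_mem_antisymDegree (B : A₁ →ₗ[R] A₂ →ₗ[R] A) {k l : ℕ} {a : WL R ι g A₁}
    {b : WL R ι g A₂} (ha : a ∈ antisymDegree k) (hb : b ∈ antisymDegree l) :
    wmul B a b ∈ antisymDegree (k + l) := fun m β => by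
  rw [wmul_apply]
  exact sum_mem fun p _ => sum_mem fun q _ => coeffMul_mem B (ha p.1 q.1) (hb p.2 q.2)

theorem wmul_mem_totalFiltration (B : A₁ →ₗ[R] A₂ →ₗ[R] A) {k l : ℕ} {a : WL R ι g A₁}
    {b : WL R ι g A₂} (ha : a ∈ totalFiltration k) (hb : b ∈ totalFiltration l) :
    wmul B a b ∈ totalFiltration (k + l) := fun m β h => by
  rw [wmul_apply]
  refine Finset.sum_eq_zero fun p hp => Finset.sum_eq_zero fun q hq => ?_
  have h1 := Finset.HasAntidiagonal.mem_antidiagonal.1 hp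
  have h2 := congrArg Finsupp.degree (Finset.HasAntidiagonal.mem_antidiagonal.1 hq)
  rw [map_add] at h2
  by_cases h3 : 2 * p.1 + q.1.degree < k
  · rw [ha _ _ h3, map_zero, LinearMap.zero_apply]
  · rw [hb _ _ (by omega), map_zero]

end WLProduct

section ElementaryOperatorsApply

variable {R : Type u} [CommRing R] {g : Type v} [LieRing g] [LieAlgebra R g]
variable {ι : Type*} {A : Type w} [AddCommGroup A] [Module R A]

theorem totalFiltration_mono {k l : ℕ} (h : k ≤ l) :
    totalFiltration l ≤ (totalFiltration k : Submodule R (WL R ι g A)) :=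
  fun _ ha m β hm => ha m β (lt_of_lt_of_le hm h)

theorem insSym_mem_totalFiltration {d : ℕ} (i : ι) {a : WL R ι g A} (ha : a ∈ totalFiltration d) :
    insSym i a ∈ totalFiltration (d - 1) := fun m β h => by
  rw [insSym_apply, ha, smul_zero]
  rw [map_add, Finsupp.degree_single]
  omega

theorem insSym_mem_antisymDegree {l : ℕ} (i : ι) {a : WL R ι g A} (ha : a ∈ antisymDegree l) :
    insSym i a ∈ antisymDegree l := fun m β => by
  rw [insSym_apply]; exact Submodule.smul_mem _ _ (ha _ _)

theorem insSym_insSym_apply (i j : ι) (a : WL R ι g A) :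
    insSym i (insSym j a) = insSym j (insSym i a) := LinearMap.congr_fun (insSym_insSym i j) a

theorem insSym_mulT_apply (i : ι) (a : WL R ι g A) :
    insSym i (mulT a) = mulT (insSym i a) := LinearMap.congr_fun (insSym_mulT i) a

theorem onForms_insSym_apply (φ : ExteriorAlgebra R (Module.Dual R g) →ₗ[R]
    ExteriorAlgebra R (Module.Dual R g)) (i : ι) (a : WL R ι g A) :
    onForms φ (insSym i a) = insSym i (onForms φ a) := LinearMap.congr_fun (onForms_insSym φ i) a

theorem onForms_mulT_apply (φ : ExteriorAlgebra R (Module.Dual R g) →ₗ[R]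
    ExteriorAlgebra R (Module.Dual R g)) (a : WL R ι g A) :
    onForms φ (mulT a) = mulT (onForms φ a) := LinearMap.congr_fun (onForms_mulT φ) a

theorem insSym_mulSym_apply [DecidableEq ι] (i j : ι) (a : WL R ι g A) :
    insSym i (mulSym j a) = mulSym j (insSym i a) + if i = j then a else 0 := by
  have h := LinearMap.congr_fun (insSym_mulSym (R := R) (g := g) (A := A) i j) a
  rw [LinearMap.add_apply, Module.End.mul_apply, Module.End.mul_apply] at h
  rw [h]
  split_ifs <;> rfl

theorem mulSym_mulT_apply (i : ι) (a : WL R ι g A) :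
    mulSym i (mulT a) = mulT (mulSym i a) := LinearMap.congr_fun (mulSym_mulT i) a

end ElementaryOperatorsApply

/-! ### Properties of the deformed product ∘. -/

section WLStar

variable {R : Type u} [CommRing R] {g : Type v} [LieRing g] [LieAlgebra R g]
variable {ι : Type*} [DecidableEq ι] [Fintype ι]
variable {A₁ : Type w₁} {A₂ : Type w₂} {A₃ : Type w₃} {A₁₂ : Type w₄} {A₂₃ : Type w₅} {A : Type w}
  [AddCommGroup A₁] [Module R A₁] [AddCommGroup A₂] [Module R A₂]
  [AddCommGroup A₃] [Module R A₃] [AddCommGroup A₁₂] [Module R A₁₂] [AddCommGroup A₂₃]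
  [Module R A₂₃] [AddCommGroup A] [Module R A]
variable (e : Module.Basis ι R g) (bi : LinearMap.BilinForm R (Module.Dual R g))

/-- The components `π^{ij} = π(e^i, e^j)`. -/
def components (i j : ι) : R := bi (e.coord i) (e.coord j)

theorem starTerm_eq_bidiff (B : A₁ →ₗ[R] A₂ →ₗ[R] A) (n : ℕ) (a : WL R ι g A₁)
    (b : WL R ι g A₂) :
    starTerm e bi B n a b = (bidiff (components e bi) insSym insSym ^ n) (wmul B) a b := by
  induction n generalizing a b with
  | zero => rfl
  | succ n ih =>
    rw [bidiff_pow_succ_apply, starTerm]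
    simp only [LinearMap.sum_apply, LinearMap.smul_apply, LinearMap.compl₁₂_apply, ih]
    rfl

theorem starTerm_mem_totalFiltration (B : A₁ →ₗ[R] A₂ →ₗ[R] A) (n : ℕ) {k l : ℕ} {a : WL R ι g A₁}
    {b : WL R ι g A₂} (ha : a ∈ totalFiltration k) (hb : b ∈ totalFiltration l) :
    starTerm e bi B n a b ∈ totalFiltration (k + l - 2 * n) := by
  induction n generalizing k l a b with
  | zero => exact wmul_mem_totalFiltration B ha hb
  | succ n ih =>
    rw [starTerm]
    simp only [LinearMap.sum_apply, LinearMap.smul_apply, LinearMap.compl₁₂_apply]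
    refine sum_mem fun i _ => sum_mem fun j _ => Submodule.smul_mem _ _ ?_
    refine totalFiltration_mono ?_ (ih (insSym_mem_totalFiltration i ha)
      (insSym_mem_totalFiltration j hb))
    omega

theorem starTerm_mem_antisymDegree (B : A₁ →ₗ[R] A₂ →ₗ[R] A) (n : ℕ) {k l : ℕ} {a : WL R ι g A₁}
    {b : WL R ι g A₂} (ha : a ∈ antisymDegree k) (hb : b ∈ antisymDegree l) :
    starTerm e bi B n a b ∈ antisymDegree (k + l) := by
  induction n generalizing a b with
  | zero => exact wmul_mem_antisymDegree B ha hb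
  | succ n ih =>
    rw [starTerm]
    simp only [LinearMap.sum_apply, LinearMap.smul_apply, LinearMap.compl₁₂_apply]
    exact sum_mem fun i _ => sum_mem fun j _ => Submodule.smul_mem _ _
      (ih (insSym_mem_antisymDegree i ha) (insSym_mem_antisymDegree j hb))

variable [Algebra ℚ R]

theorem star_apply (B : A₁ →ₗ[R] A₂ →ₗ[R] A) (a : WL R ι g A₁) (b : WL R ι g A₂) (m : ℕ)
    (β : ι →₀ ℕ) : star e bi B a b m β = ∑ n ∈ Finset.range (m + 1),
      expCoeff R n • starTerm e bi B n a b (m - n) β := rfl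

theorem star_eq_formalStar (B : A₁ →ₗ[R] A₂ →ₗ[R] A) (a : WL R ι g A₁) (b : WL R ι g A₂) :
    star e bi B a b = formalStar (components e bi) insSym insSym (wmul B) a b := by
  refine funext fun m => funext fun β => ?_
  rw [star_apply, formalStar, formalSum,
    Finset.Nat.sum_antidiagonal_eq_sum_range_succ
      (fun n k => (expCoeff R n • (bidiff (components e bi) insSym insSym ^ n) (wmul B) a b) k),
    Finset.sum_apply]
  simp only [starTerm_eq_bidiff, Pi.smul_apply]

/-- Each contraction removes two symmetric generators, and the accompanying t gives the two units of
total degree back. -/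
theorem star_mem_totalFiltration (B : A₁ →ₗ[R] A₂ →ₗ[R] A) {k l : ℕ} {a : WL R ι g A₁}
    {b : WL R ι g A₂} (ha : a ∈ totalFiltration k) (hb : b ∈ totalFiltration l) :
    star e bi B a b ∈ totalFiltration (k + l) := fun m β h => by
  rw [star_apply]
  refine Finset.sum_eq_zero fun n hn => ?_
  have hn' := Finset.mem_range.1 hn
  rw [starTerm_mem_totalFiltration e bi B n ha hb, smul_zero]
  omega

theorem star_mem_antisymDegree (B : A₁ →ₗ[R] A₂ →ₗ[R] A) {k l : ℕ} {a : WL R ι g A₁}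
    {b : WL R ι g A₂} (ha : a ∈ antisymDegree k) (hb : b ∈ antisymDegree l) :
    star e bi B a b ∈ antisymDegree (k + l) := fun m β => by
  rw [star_apply]
  exact sum_mem fun n _ => Submodule.smul_mem _ _ (starTerm_mem_antisymDegree e bi B n ha hb _ _)

theorem star_zero_apply (B : A₁ →ₗ[R] A₂ →ₗ[R] A) (a : WL R ι g A₁) (b : WL R ι g A₂) :
    star e bi B a b 0 = wmul B a b 0 := by
  refine funext fun β => ?_
  rw [star_apply, Finset.sum_range_one, expCoeff_zero, one_smul]
  rfl

/-- The coefficient pairings may differ from place to place. One statement thus covers the algebra W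
⊗ Λ, its left and right actions on A ⊗ W ⊗ Λ, and the product of A ⊗ W ⊗ Λ. -/
theorem star_assoc {B₁₂ : A₁ →ₗ[R] A₂ →ₗ[R] A₁₂} {B₂₃ : A₂ →ₗ[R] A₃ →ₗ[R] A₂₃}
    {B : A₁₂ →ₗ[R] A₃ →ₗ[R] A} {B' : A₁ →ₗ[R] A₂₃ →ₗ[R] A}
    (h : ∀ a b c, B (B₁₂ a b) c = B' a (B₂₃ b c))
    (a : WL R ι g A₁) (b : WL R ι g A₂) (c : WL R ι g A₃) :
    star e bi B (star e bi B₁₂ a b) c = star e bi B' a (star e bi B₂₃ b c) := by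
  simp only [star_eq_formalStar]
  exact formalStar_assoc (wmul_assoc h) (insSym_wmul B₁₂) (insSym_wmul B₂₃)
    insSym_insSym_apply insSym_insSym_apply insSym_insSym_apply insSym_mulT_apply insSym_mulT_apply
    (wmul_mulT_left B) (wmul_mulT_right B') a b c

/-- Multiplicative triples of operators on `A ⊗ W ⊗ Λ` are compatible with the deformed product. -/
theorem map_star {B : A₁ →ₗ[R] A₂ →ₗ[R] A} {φ₁ : Module.End R (WL R ι g A₁)}
    {φ₂ : Module.End R (WL R ι g A₂)} {φ : Module.End R (WL R ι g A)}
    (hφ : ∀ a, φ (mulT a) = mulT (φ a))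
    (hμ : ∀ a b, φ (wmul B a b) = wmul B (φ₁ a) (φ₂ b))
    (h₁ : ∀ i a, φ₁ (insSym i a) = insSym i (φ₁ a)) (h₂ : ∀ i b, φ₂ (insSym i b) = insSym i (φ₂ b))
    (a : WL R ι g A₁) (b : WL R ι g A₂) :
    φ (star e bi B a b) = star e bi B (φ₁ a) (φ₂ b) := by
  simp only [star_eq_formalStar]
  exact map_formalStar hφ hμ h₁ h₂ a b

theorem star_mulT_left (B : A₁ →ₗ[R] A₂ →ₗ[R] A) (a : WL R ι g A₁) (b : WL R ι g A₂) :
    star e bi B (mulT a) b = mulT (star e bi B a b) :=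
  (map_star e bi (φ₁ := mulT) (φ₂ := 1) (φ := mulT) (fun _ => rfl)
    (fun a b => (wmul_mulT_left B a b).symm) (fun i a => (insSym_mulT_apply i a).symm)
    (fun _ _ => rfl) a b).symm

theorem star_mulT_right (B : A₁ →ₗ[R] A₂ →ₗ[R] A) (a : WL R ι g A₁) (b : WL R ι g A₂) :
    star e bi B a (mulT b) = mulT (star e bi B a b) :=
  (map_star e bi (φ₁ := 1) (φ₂ := mulT) (φ := mulT) (fun _ => rfl)
    (fun a b => (wmul_mulT_right B a b).symm) (fun _ _ => rfl)
    (fun i a => (insSym_mulT_apply i a).symm) a b).symm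

theorem star_opW_left (B : A₁ →ₗ[R] A₂ →ₗ[R] A) (i : ι) (a : WL R ι g A₁) (b : WL R ι g A₂) :
    star e bi B (opW e i a) b = opW e i (star e bi B a b) :=
  (map_star e bi (φ₁ := opW e i) (φ₂ := 1) (φ := opW e i) (onForms_mulT_apply _)
    (fun a b => (wmul_opW_left e B i a b).symm) (onForms_insSym_apply _)
    (fun _ _ => rfl) a b).symm

theorem star_parity_opW (B : A₁ →ₗ[R] A₂ →ₗ[R] A) (i : ι) (a : WL R ι g A₁) (b : WL R ι g A₂) :
    star e bi B (parity a) (opW e i b) = opW e i (star e bi B a b) :=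
  (map_star e bi (φ₁ := parity) (φ₂ := opW e i) (φ := opW e i) (onForms_mulT_apply _)
    (fun a b => (wmul_parity_opW e B i a b).symm) (onForms_insSym_apply _)
    (onForms_insSym_apply _) a b).symm

theorem parity_star (B : A₁ →ₗ[R] A₂ →ₗ[R] A) (a : WL R ι g A₁) (b : WL R ι g A₂) :
    parity (star e bi B a b) = star e bi B (parity a) (parity b) :=
  map_star e bi (φ₁ := parity) (φ₂ := parity) (φ := parity) (onForms_mulT_apply _)
    (parity_wmul B) (onForms_insSym_apply _) (onForms_insSym_apply _) a b

theorem star_derivation {B : A₁ →ₗ[R] A₂ →ₗ[R] A} {d₁ : Module.End R (WL R ι g A₁)}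
    {d₂ : Module.End R (WL R ι g A₂)} {d : Module.End R (WL R ι g A)}
    (hd : ∀ a, d (mulT a) = mulT (d a))
    (hμ : ∀ a b, d (wmul B a b) = wmul B (d₁ a) b + wmul B a (d₂ b)) (c : ι → ι → R)
    (h₁ : ∀ i a, d₁ (insSym i a) = insSym i (d₁ a) + ∑ k, c i k • insSym k a)
    (h₂ : ∀ i a, d₂ (insSym i a) = insSym i (d₂ a) + ∑ k, c i k • insSym k a)
    (hc : ∀ k l, ∑ i, (c i k * components e bi i l + c i l * components e bi k i) = 0)
    (a : WL R ι g A₁) (b : WL R ι g A₂) :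
    d (star e bi B a b) = star e bi B (d₁ a) b + star e bi B a (d₂ b) := by
  simp only [star_eq_formalStar]
  exact formalStar_derivation hd hμ c h₁ h₂ hc a b

theorem star_mulSym_left (B : A₁ →ₗ[R] A₂ →ₗ[R] A) (z : ι) (a : WL R ι g A₁) (b : WL R ι g A₂) :
    star e bi B (mulSym z a) b = mulSym z (star e bi B a b) +
      mulT (algebraMap ℚ R (1 / 2) • ∑ j, components e bi z j • star e bi B a (insSym j b)) := by
  simp only [star_eq_formalStar]
  exact formalStar_mul_left (mulSym_mulT_apply z) (wmul_mulSym_left B z)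
    (fun i a => insSym_mulSym_apply i z a) insSym_insSym_apply a b

/-- For an element whose forms are central no sign appears, and exchanging the factors only
transposes π. Commutators therefore measure the difference between π and its transpose. -/
theorem star_swap {B : A₁ →ₗ[R] A₂ →ₗ[R] A} {l : ℕ}
    (hl : ∀ x ∈ ⋀[R]^l (Module.Dual R g), ∀ y, x * y = y * x) {a : WL R ι g A₁}
    (ha : a ∈ antisymDegree l) (b : WL R ι g A₂) :
    star e bi B.flip b a = star e bi.flip B a b := by
  simp only [star_eq_formalStar]
  refine formalStar_swap (S := (antisymDegree l : Submodule R (WL R ι g A₁)))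
    (fun a ha b => ?_) (fun i a ha => insSym_mem_antisymDegree i ha) ha b
  have h := wmul_swap (B := B) (φ := LinearMap.id) hl (fun m β => ha m β) b
  rwa [onForms_id, Module.End.one_apply] at h

theorem star_of_insSym_eq_zero (B : A₁ →ₗ[R] A₂ →ₗ[R] A) {a : WL R ι g A₁}
    (ha : ∀ i, insSym i a = 0) (b : WL R ι g A₂) : star e bi B a b = wmul B a b := by
  rw [star_eq_formalStar]
  exact formalStar_of_annihilated ha b

end WLStar

/-! ## The total covariant derivative -/

section TotalDerivative

variable {R : Type u} [CommRing R] {g : Type v} [LieRing g] [LieAlgebra R g]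
variable {ι : Type*} [DecidableEq ι] [Fintype ι]
variable {A : Type w} [AddCommGroup A] [Module R A]
variable (e : Module.Basis ι R g) (nabla : g →ₗ[R] g →ₗ[R] g) (act : g →ₗ[R] Module.End R A)

/-- The even operators `-i_s(e_i) + ∇_{e_i} + e_i ▷` on `A ⊗ W ⊗ Λ`. -/
def covD (i : ι) : Module.End R (WL R ι g A) :=
  (canonicalOperators e).d e nabla (fun i => onAct (act (e i))) i

/-- The odd derivation `-δ + D + L_A`. -/
def totalD : Module.End R (WL R ι g A) := ∑ i, opW e i * covD e nabla act i

theorem covD_apply (i : ι) (a : WL R ι g A) : covD e nabla act i a =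
    -insSym i a - ∑ j, ∑ k, e.coord k (nabla (e i) (e j)) •
      (mulSym j (insSym k a) + onForms (wedgeLeft (e.coord j) ∘ₗ insVector (e k)) a) +
      onAct (act (e i)) a := by
  have h : ∀ j k, opW e j (opI e k a) = onForms (wedgeLeft (e.coord j) ∘ₗ insVector (e k)) a :=
    fun j k => LinearMap.congr_fun (onForms_mul (wedgeLeft (e.coord j)) (insVector (e k))) a
  have h0 : covD e nabla act i a = -insSym i a + -(∑ j, ∑ k, e.coord k (nabla (e i) (e j)) •
      (mulSym j * insSym k + opW e j * opI e k : Module.End R (WL R ι g A))) a +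
      onAct (act (e i)) a := rfl
  rw [h0]
  simp only [LinearMap.sum_apply, LinearMap.smul_apply, LinearMap.add_apply, Module.End.mul_apply, h]
  rw [← sub_eq_add_neg]

theorem totalD_apply (a : WL R ι g A) :
    totalD e nabla act a = ∑ i, opW e i (covD e nabla act i a) := by
  rw [totalD, LinearMap.sum_apply]; rfl

theorem onAct_wedgeLeft (f : Module.End R A) (α : Module.Dual R g) (a : WL R ι g A) :
    onCoeff (fun _ => TensorProduct.map f (wedgeLeft α)) a = onForms (wedgeLeft α) (onAct f a) := by
  refine funext fun m => funext fun β => ?_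
  rw [onForms_apply, onAct_apply, onCoeff_apply, ← LinearMap.comp_apply,
    LinearMap.lTensor_comp_rTensor]

/-- Writing the three summands as ∑ e^i ∧ d_i makes the abstract operator identities applicable. -/
theorem totalD_eq : totalD e nabla act = -delta e + connD e nabla + leftMult e act := by
  refine LinearMap.ext fun a => ?_
  rw [totalD_apply, LinearMap.add_apply, LinearMap.add_apply, LinearMap.neg_apply, delta, connD,
    leftMult]
  simp only [LinearMap.sum_apply, LinearMap.comp_apply, onAct_wedgeLeft, covD_apply, opW, map_add,
    map_neg, LinearMap.neg_apply, Finset.sum_add_distrib,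
    Finset.sum_neg_distrib, LinearMap.smul_apply, LinearMap.add_apply, map_sum, map_smul, smul_add,
    sub_eq_add_neg]

theorem opW_mulT_apply (i : ι) (a : WL R ι g A) : opW e i (mulT a) = mulT (opW e i a) :=
  onForms_mulT_apply _ a

theorem covD_mulT_apply (i : ι) (a : WL R ι g A) :
    covD e nabla act i (mulT a) = mulT (covD e nabla act i a) := by
  have h : onAct (act (e i)) (mulT a) = mulT (onAct (act (e i)) a) :=
    LinearMap.congr_fun (onAct_mulT (act (e i))) a
  simp only [covD_apply, insSym_mulT_apply, mulSym_mulT_apply, onForms_mulT_apply, h, map_add,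
    map_sub, map_neg, map_sum, map_smul]

theorem totalD_mulT_apply (a : WL R ι g A) :
    totalD e nabla act (mulT a) = mulT (totalD e nabla act a) := by
  simp only [totalD_apply, covD_mulT_apply, opW_mulT_apply, map_sum]

theorem covD_divT_apply (i : ι) (a : WL R ι g A) :
    covD e nabla act i (divT a) = divT (covD e nabla act i a) := by
  have h1 : onAct (act (e i)) (divT a) = divT (onAct (act (e i)) a) := rfl
  have h2 : ∀ k, insSym k (divT a) = divT (insSym k a) := fun _ => rfl
  have h3 : ∀ k (a : WL R ι g A), mulSym k (divT a) = divT (mulSym k a) := fun _ _ => rfl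
  have h4 : ∀ φ, onForms φ (divT a) = divT (onForms φ a) := fun _ => rfl
  simp only [covD_apply, h1, h2, h3, h4, map_add, map_sub, map_neg, map_sum, map_smul]

theorem totalD_divT_apply (a : WL R ι g A) :
    totalD e nabla act (divT a) = divT (totalD e nabla act a) := by
  have h4 : ∀ i (a : WL R ι g A), opW e i (divT a) = divT (opW e i a) := fun _ _ => rfl
  simp only [totalD_apply, covD_divT_apply, h4, map_sum]

theorem onAct_canonical_M (i j : ι) :
    Commute (onAct (act (e i))) ((canonicalOperators (A := A) e).M j) := onAct_mulSym _ j

theorem onAct_canonical_D (i j : ι) :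
    Commute (onAct (act (e i))) ((canonicalOperators (A := A) e).D j) := onAct_insSym _ j

theorem onAct_canonical_W (i j : ι) :
    Commute (onAct (act (e i))) ((canonicalOperators (A := A) e).W j) := onAct_onForms _ _

theorem onAct_canonical_I (i j : ι) :
    Commute (onAct (act (e i))) ((canonicalOperators (A := A) e).I j) := onAct_onForms _ _

theorem onAct_canonical_P (i : ι) :
    Commute (onAct (act (e i))) (canonicalOperators (A := A) e).P := onAct_onForms _ _

theorem covD_insSym_apply (i j : ι) (a : WL R ι g A) :
    covD e nabla act i (insSym j a) = insSym j (covD e nabla act i a) +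
      ∑ k, e.coord k (nabla (e i) (e j)) • insSym k a := by
  have h := LinearMap.congr_fun ((canonicalOperators e).d_D e nabla
    (fun i j => onAct_canonical_D e act i j) i j) a
  rw [extend, LinearMap.sum_apply] at h
  exact sub_eq_iff_eq_add'.1 h

theorem parity_covD_apply (i : ι) (a : WL R ι g A) :
    parity (covD e nabla act i a) = covD e nabla act i (parity a) :=
  LinearMap.congr_fun ((canonicalOperators e).P_d e nabla (fun i => onAct_canonical_P e act i) i) a

theorem parity_opW_apply (i : ι) (a : WL R ι g A) : parity (opW e i a) = -opW e i (parity a) :=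
  LinearMap.congr_fun (opW_parity e i) a

theorem parity_totalD_apply (a : WL R ι g A) :
    parity (totalD e nabla act a) = -totalD e nabla act (parity a) := by
  simp only [totalD_apply, map_sum, parity_opW_apply, parity_covD_apply, Finset.sum_neg_distrib]

theorem totalD_totalD_apply [Algebra ℚ R] (hT : IsTorsionFree nabla)
    (hact : ∀ X Y, act ⁅X, Y⁆ = act X * act Y - act Y * act X) (a : WL R ι g A) :
    totalD e nabla act (totalD e nabla act a) + totalD e nabla act (totalD e nabla act a) =
      -∑ i, ∑ k, ∑ j, ∑ l, e.coord l (curvature nabla (e i) (e k) (e j)) •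
        opW e i (opW e k (mulSym j (insSym l a))) := by
  have ha : ∀ i k, (onAct (act (e i)) * onAct (act (e k)) - onAct (act (e k)) * onAct (act (e i)) :
      Module.End R (WL R ι g A)) = extend e (fun i => onAct (act (e i))) ⁅e i, e k⁆ := fun i k => by
    rw [onAct_mul, onAct_mul, ← onAct_sub, ← hact, extend]
    conv_lhs => rw [← e.sum_repr ⁅e i, e k⁆]
    refine LinearMap.ext fun a => funext fun m => funext fun β => ?_
    rw [LinearMap.sum_apply, Finset.sum_apply, Finset.sum_apply, onAct_apply, map_sum]
    simp only [map_smul, LinearMap.smul_apply, Pi.smul_apply, onAct_apply, Module.Basis.coord_apply]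
    simp only [← LinearMap.coe_rTensorHom, map_sum, map_smul, LinearMap.sum_apply,
      LinearMap.smul_apply]
  have h := LinearMap.congr_fun ((canonicalOperators e).two_smul_sum_W_d_sq e nabla hT
    (onAct_canonical_M e act) (onAct_canonical_D e act) (onAct_canonical_W e act)
    (onAct_canonical_I e act) ha) a
  refine Eq.trans h ?_
  simp only [LinearMap.neg_apply, LinearMap.sum_apply, LinearMap.smul_apply]
  rfl

end TotalDerivative

/-! ### Leibniz rules for the covariant derivative. -/

section Leibniz

variable {R : Type u} [CommRing R] {g : Type v} [LieRing g] [LieAlgebra R g]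
variable {ι : Type*} [DecidableEq ι] [Fintype ι]
variable {A₁ : Type w₁} {A₂ : Type w₂} {A : Type w}
  [AddCommGroup A₁] [Module R A₁] [AddCommGroup A₂] [Module R A₂] [AddCommGroup A] [Module R A]
variable {nabla : g →ₗ[R] g →ₗ[R] g}
variable (e : Module.Basis ι R g)
  {act₁ : g →ₗ[R] Module.End R A₁} {act₂ : g →ₗ[R] Module.End R A₂} {act : g →ₗ[R] Module.End R A}

theorem covD_wmul {B : A₁ →ₗ[R] A₂ →ₗ[R] A}
    (hB : ∀ X a b, act X (B a b) = B (act₁ X a) b + B a (act₂ X b)) (i : ι)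
    (a : WL R ι g A₁) (b : WL R ι g A₂) :
    covD e nabla act i (wmul B a b) =
      wmul B (covD e nabla act₁ i a) b + wmul B a (covD e nabla act₂ i b) := by
  have h1 : ∀ j k, onForms (wedgeLeft (e.coord j) ∘ₗ insVector (e k)) (wmul B a b) =
      wmul B (onForms (wedgeLeft (e.coord j) ∘ₗ insVector (e k)) a) b +
        wmul B a (onForms (wedgeLeft (e.coord j) ∘ₗ insVector (e k)) b) := fun j k =>
    onForms_wmul_derivation B (fun x y => wedgeLeft_insVector_mul (e.coord j) (e k) x y) a b
  simp only [covD_apply, insSym_wmul, h1, onAct_wmul_derivation (hB (e i)), map_add, map_sub,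
    map_neg, map_sum, map_smul, LinearMap.add_apply, LinearMap.sub_apply, LinearMap.neg_apply,
    LinearMap.sum_apply, LinearMap.smul_apply, wmul_mulSym_left, wmul_mulSym_right, smul_add,
    Finset.sum_add_distrib]
  abel

variable [Algebra ℚ R] {bi : LinearMap.BilinForm R (Module.Dual R g)}

/-- The commutator of d_i with symmetric insertions is given by Christoffel symbols. The condition
for compatibility with contractions is then that π is parallel, read off on the dual basis. -/
theorem covD_star (hbi : IsCovariantlyConstant nabla bi) {B : A₁ →ₗ[R] A₂ →ₗ[R] A}
    (hB : ∀ X a b, act X (B a b) = B (act₁ X a) b + B a (act₂ X b)) (i : ι)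
    (a : WL R ι g A₁) (b : WL R ι g A₂) :
    covD e nabla act i (star e bi B a b) =
      star e bi B (covD e nabla act₁ i a) b + star e bi B a (covD e nabla act₂ i b) := by
  refine star_derivation e bi (covD_mulT_apply e nabla act i) (covD_wmul e hB i)
    (fun j k => e.coord k (nabla (e i) (e j))) (covD_insSym_apply e nabla act₁ i)
    (covD_insSym_apply e nabla act₂ i) (fun k l => ?_) a b
  have h : ∀ k, nablaDual nabla (e i) (e.coord k) =
      -∑ j, e.coord k (nabla (e i) (e j)) • e.coord j := fun k => by
    refine e.ext fun j => ?_
    simp [nablaDual, Finsupp.single_apply]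
  have h1 := hbi (e i) (e.coord k) (e.coord l)
  rw [h, h] at h1
  simp only [map_neg, map_sum, map_smul, LinearMap.neg_apply, LinearMap.sum_apply,
    LinearMap.smul_apply, smul_eq_mul] at h1
  rw [← neg_add, neg_eq_zero, ← Finset.sum_add_distrib] at h1
  exact h1

theorem totalD_star (hbi : IsCovariantlyConstant nabla bi) {B : A₁ →ₗ[R] A₂ →ₗ[R] A}
    (hB : ∀ X a b, act X (B a b) = B (act₁ X a) b + B a (act₂ X b))
    (a : WL R ι g A₁) (b : WL R ι g A₂) :
    totalD e nabla act (star e bi B a b) =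
      star e bi B (totalD e nabla act₁ a) b + star e bi B (parity a) (totalD e nabla act₂ b) := by
  simp only [totalD_apply, covD_star e hbi hB, map_add, map_sum, LinearMap.sum_apply,
    star_opW_left, star_parity_opW, Finset.sum_add_distrib]

end Leibniz

/-! ## Symplectic linear algebra -/

section Symplectic

variable {R : Type u} [CommRing R] {g : Type v} [LieRing g] [LieAlgebra R g]

theorem bivectorForm_eq {r : ExteriorAlgebra R g} (hr : r ∈ ⋀[R]^2 g) (α β : Module.Dual R g) :
    bivectorForm r α β = β (sharp r α) := by
  have h := contractLeft_mem α hr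
  rw [ExteriorAlgebra.exteriorPower, pow_one] at h
  obtain ⟨x, hx⟩ := h
  have h1 : bivectorForm r α β = ExteriorAlgebra.algebraMapInv (insCovector β (insCovector α r)) :=
    rfl
  have h2 : sharp r α = ExteriorAlgebra.ιInv (CliffordAlgebra.contractLeft α r) := rfl
  rw [h1, h2, ← hx, insCovector, insCovector, ← hx, ExteriorAlgebra.ι_leftInverse]
  have h3 : CliffordAlgebra.contractLeft β (ExteriorAlgebra.ι R x) =
      algebraMap R (ExteriorAlgebra R g) (β x) :=
    CliffordAlgebra.contractLeft_ι (Q := (0 : QuadraticForm R g)) β x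
  rw [h3, ExteriorAlgebra.algebraMap_leftInverse]

theorem bivectorForm_swap (r : ExteriorAlgebra R g) (α β : Module.Dual R g) :
    bivectorForm r α β = -bivectorForm r β α := by
  have h : ∀ α β, bivectorForm r α β =
    ExteriorAlgebra.algebraMapInv (insCovector β (insCovector α r)) := fun _ _ => rfl
  rw [h, h, ← map_neg]
  congr 1
  exact CliffordAlgebra.contractLeft_comm (Q := (0 : QuadraticForm R g)) _ _ _

theorem omega_sharp {r : ExteriorAlgebra R g} (hr : Function.Bijective (sharp r))
    (α : Module.Dual R g) (Y : g) : omega r hr (sharp r α) Y = α Y := by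
  have h : omega r hr (sharp r α) = (LinearEquiv.ofBijective (sharp r) hr).symm
    (LinearEquiv.ofBijective (sharp r) hr α) := rfl
  rw [h, LinearEquiv.symm_apply_apply]

theorem omega_swap {r : ExteriorAlgebra R g} (h2 : r ∈ ⋀[R]^2 g)
    (hr : Function.Bijective (sharp r)) (X Y : g) : omega r hr X Y = -omega r hr Y X := by
  obtain ⟨α, rfl⟩ := hr.2 X
  obtain ⟨β, rfl⟩ := hr.2 Y
  rw [omega_sharp, omega_sharp, ← bivectorForm_eq h2, ← bivectorForm_eq h2, bivectorForm_swap]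

theorem sum_bivectorForm_omega {ι : Type*} [Fintype ι] (e : Module.Basis ι R g)
    {r : ExteriorAlgebra R g} (h2 : r ∈ ⋀[R]^2 g) (hr : Function.Bijective (sharp r))
    (α : Module.Dual R g) (X : g) :
    ∑ u, bivectorForm r α (e.coord u) * omega r hr (e u) X = α X := by
  rw [← omega_sharp hr α X]
  conv_rhs => rw [← e.sum_repr (sharp r α)]
  simp only [bivectorForm_eq h2, map_sum, map_smul, LinearMap.sum_apply, LinearMap.smul_apply,
    smul_eq_mul, Module.Basis.coord_apply]

/-- As ω is parallel, its inverse ♯ commutes with ∇; the assertion is the parallelism of ω evaluated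
on ♯α and ♯β. -/
theorem bivectorForm_covariantlyConstant {r : ExteriorAlgebra R g} (h2 : r ∈ ⋀[R]^2 g)
    (hr : Function.Bijective (sharp r)) {nabla : g →ₗ[R] g →ₗ[R] g}
    (hS : IsSymplectic (omega r hr) nabla) : IsCovariantlyConstant nabla (bivectorForm r) := by
  intro X α β
  have h : ∀ α, nablaDual nabla X α = omega r hr (nabla X (sharp r α)) := fun α =>
    LinearMap.ext fun Y => by
      rw [eq_neg_of_add_eq_zero_left (hS X (sharp r α) Y), omega_sharp]; rfl
  have h' : ∀ x, sharp r (omega r hr x) = x := fun x =>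
    (LinearEquiv.ofBijective (sharp r) hr).apply_symm_apply x
  rw [bivectorForm_eq h2, bivectorForm_eq h2, h, h, h', add_comm, ← omega_sharp hr β]
  exact hS X _ _

/-- Every ∇_X is skew for ω, hence so is the curvature operator; for an antisymmetric form, lowering
the index of a skew operator gives a symmetric tensor. Thus 𝓡 really lies in Sym². -/
theorem curvature_omega_symm {om : LinearMap.BilinForm R g} (hom : ∀ X Y, om X Y = -om Y X)
    {nabla : g →ₗ[R] g →ₗ[R] g} (hS : IsSymplectic om nabla) (X Y Z U : g) :
    om Z (curvature nabla X Y U) = om U (curvature nabla X Y Z) := by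
  have h1 : ∀ X Y Z, om Y (nabla X Z) = -om (nabla X Y) Z := fun X Y Z =>
    eq_neg_of_add_eq_zero_right (hS X Y Z)
  rw [curvature, curvature, map_sub, map_sub, h1, h1 Y Z, h1 ⁅X, Y⁆ Z, h1 Y (nabla X Z),
    h1 X (nabla Y Z), map_sub, map_sub, hom U, hom U, hom U]
  ring

/-- The curvature is built from commutators and values of ∇, all of which annihilate s as
derivations. This removes the second-order terms of the commutator with 𝓡. -/
theorem curvature_covariantlyConstant {s : LinearMap.BilinForm R (Module.Dual R g)}
    {nabla : g →ₗ[R] g →ₗ[R] g} (hs : IsCovariantlyConstant nabla s) (X Y : g)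
    (α β : Module.Dual R g) :
    s (α ∘ₗ (nabla X ∘ₗ nabla Y - nabla Y ∘ₗ nabla X - nabla ⁅X, Y⁆)) β +
      s α (β ∘ₗ (nabla X ∘ₗ nabla Y - nabla Y ∘ₗ nabla X - nabla ⁅X, Y⁆)) = 0 := by
  have h1 : ∀ X α β, s (α ∘ₗ nabla X) β = -s α (β ∘ₗ nabla X) := fun X α β => by
    have := hs X α β
    rw [nablaDual, nablaDual, map_neg, map_neg, LinearMap.neg_apply, ← neg_add, neg_eq_zero] at this
    exact eq_neg_of_add_eq_zero_left this
  simp only [LinearMap.comp_sub, map_sub, LinearMap.sub_apply, ← LinearMap.comp_assoc, h1]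
  ring

end Symplectic

/-! ## The square of the total covariant derivative -/

section Unit

variable {R : Type u} [CommRing R] {g : Type v} [LieRing g] [LieAlgebra R g]
variable {ι : Type*} [DecidableEq ι] {A : Type w} [AddCommGroup A] [Module R A]

variable (R g ι) in
/-- The unit of `W ⊗ Λ`. -/
def unit : WL R ι g R := incl (Pi.single 0 1)

theorem unit_apply_of_ne {m : ℕ} {β : ι →₀ ℕ} (h : m ≠ 0 ∨ β ≠ 0) : unit R g ι m β = 0 := by
  rw [unit, incl, ofSeries]
  by_cases hβ : β = 0
  · have hm : m ≠ 0 := h.resolve_right (fun h => h hβ)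
    rw [if_pos hβ, Pi.single_eq_of_ne hm, TensorProduct.zero_tmul]
  · rw [if_neg hβ]

theorem unit_zero_zero : unit R g ι 0 0 = 1 ⊗ₜ 1 := by
  rw [unit, incl, ofSeries, if_pos rfl, Pi.single_eq_same]

theorem insSym_unit (i : ι) : insSym i (unit R g ι) = 0 := by
  refine funext fun m => funext fun β => ?_
  rw [insSym_apply, unit_apply_of_ne, smul_zero]; rfl
  right
  intro h
  have := congrArg (fun γ => γ i) h
  simp at this

theorem coeffMul_one (x : A ⊗[R] ExteriorAlgebra R (Module.Dual R g)) :
    coeffMul g (LinearMap.lsmul R A) (1 ⊗ₜ 1) x = x := by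
  induction x using TensorProduct.induction_on with
  | zero => rw [map_zero]
  | add x y hx hy => rw [map_add, hx, hy]
  | tmul a x => rw [coeffMul_tmul, one_mul, LinearMap.lsmul_apply, one_smul]

theorem wmul_unit (a : WL R ι g A) : wmul (LinearMap.lsmul R A) (unit R g ι) a = a := by
  refine funext fun m => funext fun β => ?_
  rw [wmul_apply, Finset.sum_eq_single (0, m), Finset.sum_eq_single (0, β), unit_zero_zero,
    coeffMul_one]
  · rintro ⟨p, q⟩ hp hne
    rw [unit_apply_of_ne, map_zero, LinearMap.zero_apply]
    refine Or.inr fun h => hne ?_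
    have := Finset.HasAntidiagonal.mem_antidiagonal.1 hp
    simp only at this h
    rw [h, zero_add] at this
    rw [h, this]
  · intro h
    exact absurd (Finset.HasAntidiagonal.mem_antidiagonal.2 (zero_add β)) h
  · rintro ⟨p, q⟩ hp hne
    refine Finset.sum_eq_zero fun x _ => ?_
    rw [unit_apply_of_ne, map_zero, LinearMap.zero_apply]
    refine Or.inl fun h => hne ?_
    have := Finset.HasAntidiagonal.mem_antidiagonal.1 hp
    simp only at this h
    rw [h, zero_add] at this
    rw [h, this]
  · intro h
    exact absurd (Finset.HasAntidiagonal.mem_antidiagonal.2 (zero_add m)) h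

theorem unit_mem_antisymDegree : unit R g ι ∈ antisymDegree 0 := fun m β => by
  rw [unit, incl, ofSeries]
  split_ifs
  · refine tmul_mem_coeffDegree _ ?_
    rw [ExteriorAlgebra.exteriorPower, pow_zero]
    exact Submodule.one_le.1 le_rfl
  · exact zero_mem _

theorem mulSym_mem_antisymDegree {l : ℕ} (i : ι) {a : WL R ι g A} (ha : a ∈ antisymDegree l) :
    mulSym i a ∈ antisymDegree l := fun m β => by
  rw [mulSym_apply]
  split_ifs
  · exact zero_mem _
  · exact ha _ _

theorem onForms_mem_antisymDegree {k l : ℕ} {φ : ExteriorAlgebra R (Module.Dual R g) →ₗ[R]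
    ExteriorAlgebra R (Module.Dual R g)}
    (hφ : ∀ x ∈ ⋀[R]^k (Module.Dual R g), φ x ∈ ⋀[R]^l (Module.Dual R g)) {a : WL R ι g A}
    (ha : a ∈ antisymDegree k) : onForms φ a ∈ antisymDegree l := fun m β => by
  rw [onForms_apply]
  refine coeffDegree_induction (p := fun x => LinearMap.lTensor A φ x ∈ coeffDegree R g A l)
    ?_ (fun a x hx => ?_) (fun x y hx hy => ?_) (ha m β)
  · rw [map_zero]; exact zero_mem _
  · rw [LinearMap.lTensor_tmul]; exact tmul_mem_coeffDegree a (hφ x hx)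
  · rw [map_add]; exact add_mem hx hy

theorem opW_mem_antisymDegree (e : Module.Basis ι R g) (i : ι) {l : ℕ} {a : WL R ι g A}
    (ha : a ∈ antisymDegree l) : opW e i a ∈ antisymDegree (l + 1) :=
  onForms_mem_antisymDegree (fun _ hx => wedgeLeft_mem _ hx) ha

theorem opW_mulSym_apply (e : Module.Basis ι R g) (i j : ι) (a : WL R ι g A) :
    opW e i (mulSym j a) = mulSym j (opW e i a) := LinearMap.congr_fun (onForms_mulSym _ j) a

theorem mulSym_mem_totalFiltration {d : ℕ} (i : ι) {a : WL R ι g A} (ha : a ∈ totalFiltration d) :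
    mulSym i a ∈ totalFiltration (d + 1) := fun m β h => by
  rw [mulSym_apply]
  split_ifs with h0
  · rfl
  · apply ha
    have hs : Finsupp.single i 1 ≤ β := by simpa [Nat.one_le_iff_ne_zero] using h0
    have h1 := congrArg Finsupp.degree (tsub_add_cancel_of_le hs)
    rw [map_add, Finsupp.degree_single] at h1
    omega

end Unit

/-! ### The curvature element and its commutator. -/

section CurvatureElement

variable {R : Type u} [CommRing R] [Algebra ℚ R] {g : Type v} [LieRing g] [LieAlgebra R g]
variable {ι : Type*} [DecidableEq ι] [Fintype ι] {A : Type w} [AddCommGroup A] [Module R A]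
variable (e : Module.Basis ι R g) (bi : LinearMap.BilinForm R (Module.Dual R g))

theorem star_unit (a : WL R ι g A) : star e bi (LinearMap.lsmul R A) (unit R g ι) a = a := by
  rw [star_of_insSym_eq_zero e bi _ insSym_unit, wmul_unit]

/-- A quadratic polynomial admits at most two contractions, so the exponential breaks off after t²;
two single contractions carry 1/2 and the double one 1/4. -/
theorem star_quadratic (z u i j : ι) (a : WL R ι g A) :
    star e bi (LinearMap.lsmul R A) (mulSym z (mulSym u (opW e i (opW e j (unit R g ι))))) a =
      mulSym z (mulSym u (opW e i (opW e j a))) +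
      algebraMap ℚ R (1 / 2) • mulT (∑ k, (components e bi u k •
        mulSym z (opW e i (opW e j (insSym k a))) + components e bi z k •
        mulSym u (opW e i (opW e j (insSym k a))))) +
      algebraMap ℚ R (1 / 4) • mulT (mulT (∑ k, ∑ l, (components e bi z k * components e bi u l) •
        opW e i (opW e j (insSym l (insSym k a))))) := by
  have h4 : algebraMap ℚ R (1 / 4) = algebraMap ℚ R (1 / 2) * algebraMap ℚ R (1 / 2) := by
    rw [← map_mul]; norm_num
  simp only [star_mulSym_left, star_opW_left, star_unit, map_add, smul_add, map_sum, map_smul,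
    Finset.sum_add_distrib, h4, Finset.smul_sum, smul_smul, mulSym_mulT_apply]
  have h : ∀ k l, algebraMap ℚ R (1 / 2) * (components e bi z k *
      (algebraMap ℚ R (1 / 2) * components e bi u l)) =
      algebraMap ℚ R (1 / 2) * algebraMap ℚ R (1 / 2) *
        (components e bi z k * components e bi u l) := fun k l => by ring
  simp only [h]
  abel

theorem curvElt_eq (om : LinearMap.BilinForm R g) (nabla : g →ₗ[R] g →ₗ[R] g) :
    curvElt e om nabla = algebraMap ℚ R (1 / 4) • ∑ z, ∑ u, ∑ i, ∑ j,
      om (e z) (curvature nabla (e i) (e j) (e u)) •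
        mulSym z (mulSym u (opW e i (opW e j (unit R g ι)))) := by
  have h : ∀ i j, onForms (wedgeLeft (e.coord i) ∘ₗ wedgeLeft (e.coord j)) (incl (Pi.single 0 1)) =
      opW e i (opW e j (unit R g ι)) := fun i j =>
    (LinearMap.congr_fun (onForms_mul (wedgeLeft (e.coord i)) (wedgeLeft (e.coord j))) _).symm
  rw [curvElt]
  simp only [h]

theorem curvElt_mem_antisymDegree (om : LinearMap.BilinForm R g) (nabla : g →ₗ[R] g →ₗ[R] g) :
    curvElt e om nabla ∈ antisymDegree 2 := by
  rw [curvElt_eq]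
  exact Submodule.smul_mem _ _ (sum_mem fun z _ => sum_mem fun u _ => sum_mem fun i _ =>
    sum_mem fun j _ => Submodule.smul_mem _ _ (mulSym_mem_antisymDegree _
      (mulSym_mem_antisymDegree _ (opW_mem_antisymDegree _ _ (opW_mem_antisymDegree _ _
        unit_mem_antisymDegree)))))

theorem curvElt_mem_totalFiltration (om : LinearMap.BilinForm R g) (nabla : g →ₗ[R] g →ₗ[R] g) :
    curvElt e om nabla ∈ totalFiltration 2 := by
  rw [curvElt_eq]
  exact Submodule.smul_mem _ _ (sum_mem fun z _ => sum_mem fun u _ => sum_mem fun i _ =>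
    sum_mem fun j _ => Submodule.smul_mem _ _ (mulSym_mem_totalFiltration _
      (mulSym_mem_totalFiltration _ (fun m β h => absurd h (Nat.not_lt_zero _)))))

/-- Contraction of a symmetric matrix with the antisymmetric part of a tensor of second order. -/
theorem sum_smul_antisymmetrize {V : Type*} [AddCommGroup V] [Module R V]
    {π r K ρ : ι → ι → R} (hr : ∀ i j, π i j - π j i = 2 * r i j) (hK : ∀ z u, K z u = K u z)
    (hKr : ∀ z j, ∑ u, K z u * r u j = -ρ j z) (X : ι → ι → V) :
    ∑ z, ∑ u, K z u • ∑ k, (π u k • X z k + π z k • X u k) -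
      ∑ z, ∑ u, K z u • ∑ k, (π k u • X z k + π k z • X u k) =
      -((4 : R) • ∑ z, ∑ k, ρ k z • X z k) := by
  have h1 : ∀ p : ι → ι → R, ∑ z, ∑ u, K z u • ∑ k, (p u k • X z k + p z k • X u k) =
      (2 : R) • ∑ z, ∑ k, (∑ u, K z u * p u k) • X z k := fun p => by
    simp only [Finset.smul_sum, smul_add, Finset.sum_add_distrib, smul_smul, Finset.sum_smul,
      two_mul, add_smul]
    have e1 : ∑ z, ∑ u, ∑ k, (K z u * p u k) • X z k = ∑ z, ∑ k, ∑ u, (K z u * p u k) • X z k :=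
      Finset.sum_congr rfl fun z _ => Finset.sum_comm
    have e2 : ∑ z, ∑ u, ∑ k, (K z u * p z k) • X u k = ∑ z, ∑ u, ∑ k, (K z u * p u k) • X z k := by
      rw [Finset.sum_comm]
      simp only [hK]
    rw [e2, e1]
  rw [h1, h1 fun i j => π j i, ← smul_sub, ← Finset.sum_sub_distrib]
  simp only [← Finset.sum_sub_distrib, ← sub_smul, ← mul_sub, hr, mul_left_comm _ (2 : R),
    ← Finset.mul_sum, hKr, mul_smul, neg_smul, Finset.sum_neg_distrib, smul_neg, ← Finset.smul_sum]
  rw [smul_smul]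
  norm_num

/-- Transposing π = r + s changes the sign of r, so in the difference only the mixed products of r
and s survive. Contracting K with r recovers the curvature operator ρ up to sign, and `hρ` says that
ρ annihilates s. -/
theorem sum_smul_antisymmetrize_second {V : Type*} [AddCommGroup V] [Module R V]
    {r s K ρ : ι → ι → R} (hr : ∀ i j, r i j = - r j i) (hs : ∀ i j, s i j = s j i)
    (hK : ∀ z u, K z u = K u z) (hKr : ∀ z j, ∑ u, K z u * r u j = -ρ j z)
    (hρ : ∀ j k, ∑ u, (ρ j u * s u k + ρ k u * s u j) = 0) (Y : ι → ι → V) :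
    ∑ z, ∑ u, K z u • ∑ k, ∑ l, ((r z k + s z k) * (r u l + s u l)) • Y k l =
      ∑ z, ∑ u, K z u • ∑ k, ∑ l, ((r k z + s k z) * (r l u + s l u)) • Y k l := by
  rw [← sub_eq_zero]
  simp only [← Finset.sum_sub_distrib, ← sub_smul, Finset.smul_sum, smul_smul]
  have h1 : ∀ F : ι → ι → ι → ι → V, ∑ z, ∑ u, ∑ k, ∑ l, F z u k l = ∑ k, ∑ l, ∑ z, ∑ u, F z u k l :=
    fun F => by
      conv_lhs => enter [2, z]; rw [Finset.sum_comm]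
      rw [Finset.sum_comm]
      refine Finset.sum_congr rfl fun k _ => ?_
      conv_lhs => enter [2, z]; rw [Finset.sum_comm]
      rw [Finset.sum_comm]
  rw [h1]
  refine Finset.sum_eq_zero fun k _ => Finset.sum_eq_zero fun l _ => ?_
  simp only [← Finset.sum_smul]
  have h2 : ∑ z, ∑ u, (K z u * ((r z k + s z k) * (r u l + s u l)) -
      K z u * ((r k z + s k z) * (r l u + s l u))) =
      2 * ∑ z, (∑ u, K z u * r u l) * s z k + 2 * ∑ u, (∑ z, K u z * r z k) * s u l := by
    simp only [Finset.mul_sum, Finset.sum_mul]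
    rw [Finset.sum_comm (f := fun u z => 2 * (K u z * r z k * s u l)), ← Finset.sum_add_distrib]
    refine Finset.sum_congr rfl fun z _ => ?_
    rw [← Finset.sum_add_distrib]
    refine Finset.sum_congr rfl fun u _ => ?_
    rw [hr k z, hr l u, hs k z, hs l u, hK u z]
    ring
  rw [h2]
  simp only [hKr, neg_mul, Finset.sum_neg_distrib]
  rw [mul_neg, mul_neg, ← neg_add, ← mul_add, ← Finset.sum_add_distrib]
  have h3 := hρ l k
  rw [h3, mul_zero, neg_zero, zero_smul]

theorem sum_comm_pairs {Z : Type*} [AddCommMonoid Z] (F : ι → ι → ι → ι → Z) :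
    ∑ z, ∑ u, ∑ k, ∑ l, F z u k l = ∑ k, ∑ l, ∑ z, ∑ u, F z u k l := by
  conv_lhs => enter [2, z]; rw [Finset.sum_comm]
  rw [Finset.sum_comm]
  refine Finset.sum_congr rfl fun k _ => ?_
  conv_lhs => enter [2, z]; rw [Finset.sum_comm]
  rw [Finset.sum_comm]

theorem sum_smul_quadratic {V : Type*} [AddCommGroup V] [Module R V] (T : Module.End R V)
    (K : ι → ι → R) (p q : R) (x y w : ι → ι → V) :
    ∑ z, ∑ u, K z u • (x z u + p • T (y z u) + q • T (T (w z u))) =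
      ∑ z, ∑ u, K z u • x z u + p • T (∑ z, ∑ u, K z u • y z u) +
        q • T (T (∑ z, ∑ u, K z u • w z u)) := by
  simp only [smul_add, Finset.sum_add_distrib, map_sum, map_smul, Finset.smul_sum, smul_smul,
    mul_comm]

theorem star_curvElt (om : LinearMap.BilinForm R g) (nabla : g →ₗ[R] g →ₗ[R] g) (a : WL R ι g A) :
    star e bi (LinearMap.lsmul R A) (curvElt e om nabla) a = algebraMap ℚ R (1 / 4) • ∑ i, ∑ j,
      (∑ z, ∑ u, om (e z) (curvature nabla (e i) (e j) (e u)) •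
          mulSym z (mulSym u (opW e i (opW e j a))) +
        algebraMap ℚ R (1 / 2) • mulT (∑ z, ∑ u, om (e z) (curvature nabla (e i) (e j) (e u)) •
          ∑ k, (components e bi u k • mulSym z (opW e i (opW e j (insSym k a))) +
            components e bi z k • mulSym u (opW e i (opW e j (insSym k a))))) +
        algebraMap ℚ R (1 / 4) • mulT (mulT (∑ z, ∑ u,
          om (e z) (curvature nabla (e i) (e j) (e u)) • ∑ k, ∑ l,
            (components e bi z k * components e bi u l) •
              opW e i (opW e j (insSym l (insSym k a)))))) := by
  rw [curvElt_eq, map_smul, LinearMap.smul_apply]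
  congr 1
  have h : ∀ x : ι → ι → ι → ι → WL R ι g R,
      star e bi (LinearMap.lsmul R A) (∑ z, ∑ u, ∑ i, ∑ j,
        om (e z) (curvature nabla (e i) (e j) (e u)) • x z u i j) a =
      ∑ z, ∑ u, ∑ i, ∑ j, om (e z) (curvature nabla (e i) (e j) (e u)) •
        star e bi (LinearMap.lsmul R A) (x z u i j) a := fun x => by
    simp only [map_sum, LinearMap.sum_apply, map_smul, LinearMap.smul_apply]
  rw [h, sum_comm_pairs]
  refine Finset.sum_congr rfl fun i _ => Finset.sum_congr rfl fun j _ => ?_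
  simp only [star_quadratic]
  exact sum_smul_quadratic mulT _ _ _ _ _ _

set_option maxHeartbeats 2000000 in
/-- The square of the total covariant derivative is an inner derivation. -/
theorem mulT_totalD_totalD {r : ExteriorAlgebra R g} (h2 : r ∈ ⋀[R]^2 g)
    (hr : Function.Bijective (sharp r)) {s : LinearMap.BilinForm R (Module.Dual R g)}
    (hs : ∀ α β, s α β = s β α) {nabla : g →ₗ[R] g →ₗ[R] g} (hT : IsTorsionFree nabla)
    (hS : IsSymplectic (omega r hr) nabla) (hCC : IsCovariantlyConstant nabla s)
    {act : g →ₗ[R] Module.End R A} (hact : ∀ X Y, act ⁅X, Y⁆ = act X * act Y - act Y * act X)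
    (a : WL R ι g A) :
    mulT (totalD e nabla act (totalD e nabla act a)) =
      star e (bivectorForm r + s) (LinearMap.lsmul R A) (curvElt e (omega r hr) nabla) a -
      star e (bivectorForm r + s) (LinearMap.lsmul R A).flip a (curvElt e (omega r hr) nabla) := by
  -- The curvature element is a two-form, so right multiplication by it is left multiplication for
  -- the transposed π.
  rw [star_swap e _ (l := 2) (fun x hx y => mem_center_of_mem_two.{u, max v u} hx y)
    (curvElt_mem_antisymDegree e _ _), star_curvElt, star_curvElt, ← smul_sub]
  have hK : ∀ i j z u, omega r hr (e z) (curvature nabla (e i) (e j) (e u)) =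
      omega r hr (e u) (curvature nabla (e i) (e j) (e z)) := fun i j z u =>
    curvature_omega_symm (omega_swap h2 hr) hS _ _ _ _
  -- Raising with r the index lowered by ω returns the curvature operator.
  have hKr : ∀ i j z k, ∑ u, omega r hr (e z) (curvature nabla (e i) (e j) (e u)) *
      bivectorForm r (e.coord u) (e.coord k) = -e.coord k (curvature nabla (e i) (e j) (e z)) :=
    fun i j z k => by
      rw [← sum_bivectorForm_omega e h2 hr, ← Finset.sum_neg_distrib]
      refine Finset.sum_congr rfl fun u _ => ?_
      rw [hK, bivectorForm_swap]
      ring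
  -- The t² terms of the two products agree, because the curvature annihilates the parallel s.
  have hsec : ∀ i j (Y : ι → ι → WL R ι g A),
      ∑ z, ∑ u, omega r hr (e z) (curvature nabla (e i) (e j) (e u)) • ∑ k, ∑ l,
        (components e (bivectorForm r + s) z k * components e (bivectorForm r + s) u l) • Y k l =
      ∑ z, ∑ u, omega r hr (e z) (curvature nabla (e i) (e j) (e u)) • ∑ k, ∑ l,
        (components e (bivectorForm r + s).flip z k *
          components e (bivectorForm r + s).flip u l) • Y k l := fun i j Y =>
    sum_smul_antisymmetrize_second (fun i j => bivectorForm_swap r _ _) (fun i j => hs _ _)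
      (hK i j) (hKr i j) (fun k l => by
        have h := curvature_covariantlyConstant hCC (e i) (e j) (e.coord k) (e.coord l)
        have hexp : ∀ (α : Module.Dual R g) (φ : g →ₗ[R] g),
            α ∘ₗ φ = ∑ u, α (φ (e u)) • e.coord u := fun α φ => by
          refine e.ext fun u => ?_
          simp [Finsupp.single_apply]
        rw [hexp, hexp (e.coord l)] at h
        simp only [map_sum, map_smul, LinearMap.sum_apply, LinearMap.smul_apply, smul_eq_mul] at h
        rw [Finset.sum_add_distrib, ← h]
        congr 1
        exact Finset.sum_congr rfl fun u _ => by rw [hs (e.coord u) (e.coord k)]; rfl) Y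
  have hfst : ∀ i j (X : ι → ι → WL R ι g A),
      ∑ z, ∑ u, omega r hr (e z) (curvature nabla (e i) (e j) (e u)) • ∑ k,
        (components e (bivectorForm r + s) u k • X z k +
          components e (bivectorForm r + s) z k • X u k) -
      ∑ z, ∑ u, omega r hr (e z) (curvature nabla (e i) (e j) (e u)) • ∑ k,
        (components e (bivectorForm r + s).flip u k • X z k +
          components e (bivectorForm r + s).flip z k • X u k) =
      -((4 : R) • ∑ z, ∑ k, e.coord k (curvature nabla (e i) (e j) (e z)) • X z k) := fun i j X =>
    sum_smul_antisymmetrize (fun k l => by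
      change (bivectorForm r _ _ + s _ _) - (bivectorForm r _ _ + s _ _) = _
      rw [bivectorForm_swap r (e.coord l), hs (e.coord l)]; ring) (hK i j) (hKr i j) X
  have h4 := totalD_totalD_apply e nabla act hT hact a
  have h5 : totalD e nabla act (totalD e nabla act a) =
      algebraMap ℚ R (1 / 2) • (totalD e nabla act (totalD e nabla act a) +
        totalD e nabla act (totalD e nabla act a)) := by
    rw [← two_smul R, smul_smul, ← map_ofNat (algebraMap ℚ R) 2, ← map_mul]
    norm_num
  rw [h5, h4]
  -- The normalization ¼ of the curvature element is fixed here: ¼ from the element, ½ from a single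
  -- contraction and 4 from `hfst` give the ½ of the square.
  have hfin : ∀ X : ι → ι → ι → ι → WL R ι g A,
      algebraMap ℚ R (1 / 2) • -∑ i, ∑ j, ∑ z, ∑ k,
        e.coord k (curvature nabla (e i) (e j) (e z)) • mulT (X i j z k) =
      algebraMap ℚ R (1 / 4) • ∑ i, ∑ j, algebraMap ℚ R (1 / 2) • mulT (-((4 : R) • ∑ z, ∑ k,
        e.coord k (curvature nabla (e i) (e j) (e z)) • X i j z k)) := fun X => by
    simp only [map_neg, smul_neg, Finset.sum_neg_distrib, map_smul, map_sum, ← Finset.smul_sum]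
    rw [smul_smul, smul_smul, ← map_ofNat (algebraMap ℚ R) 4, ← map_mul, ← map_mul]
    norm_num
  have hL : mulT (algebraMap ℚ R (1 / 2) • -∑ i, ∑ k, ∑ j, ∑ l,
      e.coord l (curvature nabla (e i) (e k) (e j)) •
        opW e i (opW e k (mulSym j (insSym l a)))) =
      algebraMap ℚ R (1 / 2) • -∑ i, ∑ j, ∑ z, ∑ k,
        e.coord k (curvature nabla (e i) (e j) (e z)) •
          mulT (mulSym z (opW e i (opW e j (insSym k a)))) := by
    simp only [map_smul, map_neg, map_sum, opW_mulSym_apply]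
  rw [hL, hfin fun i j z k => mulSym z (opW e i (opW e j (insSym k a)))]
  congr 1
  rw [← Finset.sum_sub_distrib]
  refine Finset.sum_congr rfl fun i _ => ?_
  rw [← Finset.sum_sub_distrib]
  refine Finset.sum_congr rfl fun j _ => ?_
  rw [hsec, add_sub_add_right_eq_sub, add_sub_add_left_eq_sub, ← smul_sub, ← map_sub, hfst]

end CurvatureElement

/-! ## Bianchi identity and closed two-forms -/

section Filtration

variable {R : Type u} [CommRing R] {g : Type v} [LieRing g] [LieAlgebra R g]
variable {ι : Type*} [DecidableEq ι] [Fintype ι] {A : Type w} [AddCommGroup A] [Module R A]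

theorem onCoeff_mem_totalFiltration {d : ℕ} (φ : ℕ → (A ⊗[R] ExteriorAlgebra R (Module.Dual R g)) →ₗ[R]
      (A ⊗[R] ExteriorAlgebra R (Module.Dual R g))) {a : WL R ι g A}
    (ha : a ∈ totalFiltration d) : onCoeff φ a ∈ totalFiltration d := fun m β h => by
  rw [onCoeff_apply, ha m β h, map_zero]

theorem divT_mem_totalFiltration {d : ℕ} {a : WL R ι g A} (ha : a ∈ totalFiltration (d + 2)) :
    divT a ∈ totalFiltration d := fun m β h => by
  rw [divT_apply]
  exact ha _ _ (by omega)

theorem mulSym_insSym_mem_totalFiltration {d : ℕ} (i j : ι) {a : WL R ι g A}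
    (ha : a ∈ totalFiltration d) : mulSym i (insSym j a) ∈ totalFiltration d :=
  totalFiltration_mono (by omega)
    (mulSym_mem_totalFiltration i (insSym_mem_totalFiltration j ha))

variable (e : Module.Basis ι R g) (nabla : g →ₗ[R] g →ₗ[R] g) (act : g →ₗ[R] Module.End R A)

theorem connD_mem_totalFiltration {d : ℕ} {a : WL R ι g A} (ha : a ∈ totalFiltration d) :
    connD e nabla a ∈ totalFiltration d := by
  rw [connD, LinearMap.sum_apply]
  refine sum_mem fun i _ => ?_
  rw [LinearMap.comp_apply]
  refine onCoeff_mem_totalFiltration _ ?_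
  rw [LinearMap.neg_apply]
  simp only [LinearMap.sum_apply, LinearMap.smul_apply, LinearMap.add_apply, LinearMap.comp_apply]
  exact neg_mem (sum_mem fun j _ => sum_mem fun k _ => Submodule.smul_mem _ _
    (add_mem (mulSym_insSym_mem_totalFiltration j k ha) (onCoeff_mem_totalFiltration _ ha)))

theorem leftMult_mem_totalFiltration {d : ℕ} {a : WL R ι g A} (ha : a ∈ totalFiltration d) :
    leftMult e act a ∈ totalFiltration d := by
  rw [leftMult, LinearMap.sum_apply]
  exact sum_mem fun i _ => onCoeff_mem_totalFiltration _ ha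

theorem delta_mem_totalFiltration {d : ℕ} {a : WL R ι g A} (ha : a ∈ totalFiltration d) :
    delta e a ∈ totalFiltration (d - 1) := by
  rw [delta, LinearMap.sum_apply]
  refine sum_mem fun i _ => ?_
  rw [LinearMap.comp_apply]
  exact onCoeff_mem_totalFiltration _ (insSym_mem_totalFiltration i ha)

theorem totalD_mem_totalFiltration {d : ℕ} {a : WL R ι g A} (ha : a ∈ totalFiltration d) :
    totalD e nabla act a ∈ totalFiltration (d - 1) := by
  rw [totalD_eq, LinearMap.add_apply, LinearMap.add_apply, LinearMap.neg_apply]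
  exact add_mem (add_mem (neg_mem (delta_mem_totalFiltration e ha))
    (totalFiltration_mono (Nat.sub_le _ _) (connD_mem_totalFiltration e nabla ha)))
    (totalFiltration_mono (Nat.sub_le _ _) (leftMult_mem_totalFiltration e act ha))

theorem parity_of_mem {l : ℕ} {a : WL R ι g A} (ha : a ∈ antisymDegree l) :
    parity a = ((-1) ^ l : R) • a := by
  refine funext fun m => funext fun β => ?_
  refine coeffDegree_induction (p := fun x => LinearMap.lTensor A gradingInv x = ((-1) ^ l : R) • x)
    ?_ (fun a x hx => ?_) (fun x y hx hy => ?_) (ha m β)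
  · rw [map_zero, smul_zero]
  · rw [LinearMap.lTensor_tmul]
    have h : gradingInv x = ((-1) ^ l : R) • x := formScale_of_mem.{u, max v u} _ hx
    rw [h, TensorProduct.tmul_smul]
  · rw [map_add, hx, hy, smul_add]

/-- All partial derivatives of y vanish, so y is constant in the symmetric variables; exponents are
nonzero integers and can be divided out. -/
theorem eq_zero_of_insSym [Algebra ℚ R] {y : WL R ι g A} (h : ∀ i, insSym i y = 0)
    (h0 : ∀ m, y m 0 = 0) : y = 0 := by
  refine funext fun m => funext fun β => ?_
  by_cases hβ : β = 0
  · rw [hβ, h0]; rfl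
  · obtain ⟨i, hi⟩ : ∃ i, β i ≠ 0 := by
      by_contra! hc
      exact hβ (Finsupp.ext hc)
    have hs : Finsupp.single i 1 ≤ β := by simpa [Nat.one_le_iff_ne_zero] using hi
    have h1 := congrFun (congrFun (h i) m) (β - Finsupp.single i 1)
    rw [insSym_apply, tsub_add_cancel_of_le hs, Nat.cast_smul_eq_nsmul] at h1
    exact eq_zero_of_nsmul_eq_zero (R := R) (Nat.succ_ne_zero _) h1

end Filtration

section Bianchi

variable {R : Type u} [CommRing R] [Algebra ℚ R] {g : Type v} [LieRing g] [LieAlgebra R g]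
variable {ι : Type*} [DecidableEq ι] [Fintype ι] {A : Type w} [AddCommGroup A] [Module R A]
variable (e : Module.Basis ι R g)

theorem divT_curvElt (om : LinearMap.BilinForm R g) (nabla : g →ₗ[R] g →ₗ[R] g) :
    divT (curvElt e om nabla) = 0 := by
  have h0 : divT (unit R g ι) = 0 := by
    refine funext fun m => funext fun β => ?_
    rw [divT_apply, unit_apply_of_ne (Or.inl (Nat.succ_ne_zero m))]; rfl
  have h3 : ∀ k (a : WL R ι g R), divT (mulSym k a) = mulSym k (divT a) := fun _ _ => rfl
  have h4 : ∀ k (a : WL R ι g R), divT (opW e k a) = opW e k (divT a) := fun _ _ => rfl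
  rw [curvElt_eq]
  simp only [map_smul, map_sum, h3, h4, h0, map_zero, smul_zero, Finset.sum_const_zero]

variable {r : ExteriorAlgebra R g} {s : LinearMap.BilinForm R (Module.Dual R g)}
  {nabla : g →ₗ[R] g →ₗ[R] g}

/-- If the square of an odd derivation `D` is inner, then its generator is `D`-central. -/
theorem derivation_of_inner_square {V : Type*} [AddCommGroup V] [Module R V]
    {D T L Q L' Q' P : Module.End R V} (hsq : ∀ a, T (D (D a)) = L a - Q a)
    (hT : ∀ a, D (T a) = T (D a)) (hL : ∀ a, D (L a) = L' a + L (D a))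
    (hQ : ∀ a, D (Q a) = Q (D a) + Q' (P a)) (a : V) : L' a = Q' (P a) := by
  -- The cube of D is computed both as D applied to the square and as the square applied to D a.
  have h := congrArg D (hsq a)
  rw [hT, hsq, map_sub, hL, hQ] at h
  have h' : L' a - Q' (P a) = 0 := by
    rw [← sub_eq_zero] at h
    rw [← neg_eq_zero, ← h]; abel
  exact sub_eq_zero.1 h'

theorem isCovariantlyConstant_add (h2 : r ∈ ⋀[R]^2 g) (hr : Function.Bijective (sharp r))
    (hS : IsSymplectic (omega r hr) nabla) (hCC : IsCovariantlyConstant nabla s) :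
    IsCovariantlyConstant nabla (bivectorForm r + s) := fun X α β => by
  have h := bivectorForm_covariantlyConstant h2 hr hS X α β
  have h' := hCC X α β
  rw [LinearMap.add_apply, LinearMap.add_apply, LinearMap.add_apply, LinearMap.add_apply,
    add_add_add_comm, h, h', add_zero]

theorem parity_curvElt (om : LinearMap.BilinForm R g) (nabla : g →ₗ[R] g →ₗ[R] g) :
    parity (curvElt e om nabla) = curvElt e om nabla := by
  rw [parity_of_mem (curvElt_mem_antisymDegree e om nabla), neg_one_sq, one_smul]

/-- The square of the derivation is the commutator with 𝓡, so commuting the derivation with its own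
square shows that its value on 𝓡 is graded central. -/
theorem star_totalD_curvElt (h2 : r ∈ ⋀[R]^2 g)
    (hr : Function.Bijective (sharp r))
    (hs : ∀ α β, s α β = s β α) (hT : IsTorsionFree nabla)
    (hS : IsSymplectic (omega r hr) nabla) (hCC : IsCovariantlyConstant nabla s) (a : WL R ι g R) :
    star e (bivectorForm r + s) (LinearMap.lsmul R R)
        (totalD e nabla 0 (curvElt e (omega r hr) nabla)) a =
      star e (bivectorForm r + s) (LinearMap.lsmul R R).flip (parity a)
        (totalD e nabla 0 (curvElt e (omega r hr) nabla)) := by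
  have hCCπ := isCovariantlyConstant_add h2 hr hS hCC
  have hB : ∀ X (a b : R), (0 : g →ₗ[R] Module.End R R) X (LinearMap.lsmul R R a b) =
      LinearMap.lsmul R R ((0 : g →ₗ[R] Module.End R R) X a) b +
        LinearMap.lsmul R R a ((0 : g →ₗ[R] Module.End R R) X b) := fun X a b => by simp
  have hB' : ∀ X (a b : R), (0 : g →ₗ[R] Module.End R R) X ((LinearMap.lsmul R R).flip a b) =
      (LinearMap.lsmul R R).flip ((0 : g →ₗ[R] Module.End R R) X a) b +
        (LinearMap.lsmul R R).flip a ((0 : g →ₗ[R] Module.End R R) X b) := fun X a b => by simp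
  refine derivation_of_inner_square (D := totalD e nabla 0) (T := mulT) (P := parity)
    (L := star e (bivectorForm r + s) (LinearMap.lsmul R R) (curvElt e (omega r hr) nabla))
    (Q := (star e (bivectorForm r + s) (LinearMap.lsmul R R).flip).flip
      (curvElt e (omega r hr) nabla))
    (L' := star e (bivectorForm r + s) (LinearMap.lsmul R R)
      (totalD e nabla 0 (curvElt e (omega r hr) nabla)))
    (Q' := (star e (bivectorForm r + s) (LinearMap.lsmul R R).flip).flip
      (totalD e nabla 0 (curvElt e (omega r hr) nabla)))
    (fun a => mulT_totalD_totalD e h2 hr hs hT hS hCC (fun X Y => by simp) a)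
    (totalD_mulT_apply e nabla 0) (fun a => ?_) (fun a => ?_) a
  · rw [totalD_star e hCCπ hB, parity_curvElt]
  · rw [LinearMap.flip_apply, totalD_star e hCCπ hB']; rfl

/-- Testing centrality on a generator e^b leaves one contraction with the difference of π and its
transpose, hence -t ∑ r^{bj} i_s(e_j) y = 0 up to sign. Contracting with ω inverts r. -/
theorem insSym_eq_zero_of_central (h2 : r ∈ ⋀[R]^2 g)
    (hr : Function.Bijective (sharp r)) (hs : ∀ α β, s α β = s β α) {y : WL R ι g R}
    (hy : ∀ a, star e (bivectorForm r + s) (LinearMap.lsmul R R) y a =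
      star e (bivectorForm r + s) (LinearMap.lsmul R R).flip (parity a) y) (j : ι) :
    insSym j y = 0 := by
  have h6 : ∀ b, ∑ j, bivectorForm r (e.coord b) (e.coord j) • insSym j y = 0 := fun b => by
    have hm : mulSym b (unit R g ι) ∈ antisymDegree 0 :=
      mulSym_mem_antisymDegree b unit_mem_antisymDegree
    have h7 := hy (mulSym b (unit R g ι))
    rw [parity_of_mem hm, pow_zero, one_smul] at h7
    have hfl : (LinearMap.lsmul R R).flip = LinearMap.lsmul R R :=
      LinearMap.ext fun a => LinearMap.ext fun b => mul_comm b a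
    have h8 := star_swap e (bivectorForm r + s) (l := 0) (B := (LinearMap.lsmul R R))
      (fun x hx y => by
        rw [ExteriorAlgebra.exteriorPower, pow_zero, Submodule.mem_one] at hx
        obtain ⟨c, rfl⟩ := hx
        exact Algebra.commutes c y) hm y
    rw [hfl] at h7 h8
    rw [h8, star_mulSym_left, star_mulSym_left] at h7
    simp only [star_unit] at h7
    have h9 := sub_eq_zero.2 (mulT_injective (add_left_cancel h7))
    replace h9 := (smul_sub _ _ _).trans h9
    rw [← Finset.sum_sub_distrib] at h9
    have h10 : ∀ j, components e (bivectorForm r + s).flip b j • insSym j y -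
        components e (bivectorForm r + s) b j • insSym j y =
        (-2 : R) • bivectorForm r (e.coord b) (e.coord j) • insSym j y := fun j => by
      refine (sub_smul _ _ _).symm.trans ?_
      rw [smul_smul]
      congr 1
      change (bivectorForm r _ _ + s _ _) - (bivectorForm r _ _ + s _ _) = _
      rw [bivectorForm_swap r (e.coord j), hs (e.coord j)]; ring
    simp only [h10] at h9
    rw [← Finset.smul_sum, smul_smul] at h9
    have h11 : algebraMap ℚ R (1 / 2) * -2 = -1 := by
      rw [← map_ofNat (algebraMap ℚ R) 2, ← map_neg, ← map_mul]; norm_num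
    rw [h11] at h9
    exact neg_eq_zero.1 ((neg_one_smul R _).symm.trans h9)
  have h12 : ∑ b, omega r hr (e b) (e j) •
      ∑ k, bivectorForm r (e.coord b) (e.coord k) • insSym k y = -insSym j y := by
    simp only [Finset.smul_sum, smul_smul]
    rw [Finset.sum_comm]
    simp only [← Finset.sum_smul]
    have h13 : ∀ k, ∑ b, omega r hr (e b) (e j) * bivectorForm r (e.coord b) (e.coord k) =
        -e.coord k (e j) := fun k => by
      rw [← sum_bivectorForm_omega e h2 hr, ← Finset.sum_neg_distrib]
      refine Finset.sum_congr rfl fun u _ => ?_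
      rw [bivectorForm_swap]
      ring
    simp only [h13, Module.Basis.coord_apply, Module.Basis.repr_self, neg_smul,
      Finset.sum_neg_distrib]
    rw [Finset.sum_eq_single j (fun b _ hb => by rw [Finsupp.single_eq_of_ne hb, zero_smul])
      (by simp), Finsupp.single_eq_same, one_smul]
  simp only [h6, smul_zero, Finset.sum_const_zero] at h12
  exact neg_eq_zero.1 h12.symm

/-- The second Bianchi identity. -/
theorem totalD_curvElt (h2 : r ∈ ⋀[R]^2 g)
    (hr : Function.Bijective (sharp r))
    (hs : ∀ α β, s α β = s β α) (hT : IsTorsionFree nabla)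
    (hS : IsSymplectic (omega r hr) nabla) (hCC : IsCovariantlyConstant nabla s) :
    totalD e nabla 0 (curvElt e (omega r hr) nabla) = 0 := by
  refine eq_zero_of_insSym (insSym_eq_zero_of_central e h2 hr hs
    (star_totalD_curvElt e h2 hr hs hT hS hCC)) fun m => ?_
  -- What remains is the part of symmetric degree zero. At t⁰ it vanishes because 𝓡 has total degree
  -- 2 and the derivation lowers it by at most one; at higher powers because 𝓡 contains no t.
  cases m with
  | zero => exact totalD_mem_totalFiltration e nabla 0 (curvElt_mem_totalFiltration e _ _) 0 0 (by simp)
  | succ m =>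
    have h9 := totalD_divT_apply e nabla 0 (curvElt e (omega r hr) nabla)
    rw [divT_curvElt, map_zero] at h9
    exact (congrFun (congrFun h9 m) 0).symm

/-- Antisymmetrization by e^i ∧ e^j replaces ∇ by half of its antisymmetric part, which is the
bracket by torsion-freeness. Hence D restricts to the Chevalley-Eilenberg differential on pure
forms. -/
theorem sum_nabla_wedge_eq_ceDifferential (hT : IsTorsionFree nabla)
    (x : ExteriorAlgebra R (Module.Dual R g)) :
    ∑ i, ∑ j, ∑ k, e.coord k (nabla (e i) (e j)) •
      wedgeLeft (e.coord i) (wedgeLeft (e.coord j) (insVector (e k) x)) = -ceDifferential e x := by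
  have h1 : ∑ i, ∑ j, ∑ k, e.coord k (nabla (e j) (e i)) •
      wedgeLeft (e.coord i) (wedgeLeft (e.coord j) (insVector (e k) x)) =
      -∑ i, ∑ j, ∑ k, e.coord k (nabla (e i) (e j)) •
      wedgeLeft (e.coord i) (wedgeLeft (e.coord j) (insVector (e k) x)) := by
    rw [Finset.sum_comm, ← Finset.sum_neg_distrib]
    refine Finset.sum_congr rfl fun i _ => ?_
    rw [← Finset.sum_neg_distrib]
    refine Finset.sum_congr rfl fun j _ => ?_
    rw [← Finset.sum_neg_distrib]
    refine Finset.sum_congr rfl fun k _ => ?_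
    rw [← smul_neg]
    congr 1
    exact LinearMap.congr_fun (wedgeLeft_wedgeLeft (e.coord j) (e.coord i)) _
  have hT' : ∀ X Y : g, ⁅X, Y⁆ = nabla X Y - nabla Y X := fun X Y => (hT X Y).symm
  rw [ceDifferential]
  simp only [hT', map_sub, sub_smul, Finset.sum_sub_distrib,
    LinearMap.smul_apply, LinearMap.sum_apply, LinearMap.comp_apply, h1,
    neg_smul, neg_neg, sub_neg_eq_add]
  rw [← two_smul R, smul_smul, ← map_ofNat (algebraMap ℚ R) 2, ← map_mul]
  norm_num

/-- A formal series of two-forms as a central element of `W ⊗ Λ`. -/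
def formSeries (Om : ℕ → ExteriorAlgebra R (Module.Dual R g)) : WL R ι g R :=
  ofSeries fun m => 1 ⊗ₜ[R] Om m

theorem insSym_ofSeries (i : ι) (x : ℕ → A ⊗[R] ExteriorAlgebra R (Module.Dual R g)) :
    insSym i (ofSeries x : WL R ι g A) = 0 := by
  refine funext fun m => funext fun β => ?_
  rw [insSym_apply, ofSeries, if_neg, smul_zero]; rfl
  intro h
  have := congrArg (fun γ => γ i) h
  simp at this

theorem formSeries_mem_antisymDegree {Om : ℕ → ExteriorAlgebra R (Module.Dual R g)}
    (hOm : ∀ k, Om k ∈ ⋀[R]^2 (Module.Dual R g)) :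
    formSeries Om ∈ (antisymDegree 2 : Submodule R (WL R ι g R)) := fun m β => by
  rw [formSeries, ofSeries]
  split_ifs
  · exact tmul_mem_coeffDegree _ (hOm m)
  · exact zero_mem _

theorem formSeries_mem_totalFiltration {Om : ℕ → ExteriorAlgebra R (Module.Dual R g)}
    (hOm : Om 0 = 0) : formSeries Om ∈ (totalFiltration 2 : Submodule R (WL R ι g R)) := fun m β h => by
  rw [formSeries, ofSeries]
  split_ifs
  · have : m = 0 := by omega
    rw [this, hOm, TensorProduct.tmul_zero]
  · rfl

theorem totalD_formSeries (hT : IsTorsionFree nabla)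
    {Om : ℕ → ExteriorAlgebra R (Module.Dual R g)} (hOm : ∀ k, ceDifferential e (Om k) = 0) :
    totalD e nabla 0 (formSeries Om : WL R ι g R) = 0 := by
  have h0 : ∀ a : WL R ι g R, onAct (0 : Module.End R R) a = 0 := fun a => by
    refine funext fun m => funext fun β => ?_
    rw [onAct_apply, LinearMap.rTensor_zero]; rfl
  have hins : ∀ k, insSym k (formSeries Om : WL R ι g R) = 0 := fun k => insSym_ofSeries k _
  simp only [totalD_apply, covD_apply, hins, map_zero, neg_zero, zero_sub, zero_add,
    LinearMap.zero_apply, h0, add_zero, map_neg, map_sum, map_smul, opW]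
  rw [Finset.sum_neg_distrib, neg_eq_zero]
  refine funext fun m => funext fun β => ?_
  simp only [Finset.sum_apply, Pi.smul_apply, onForms_apply, Pi.zero_apply]
  by_cases hβ : β = 0
  · have h1 : (formSeries Om : WL R ι g R) m β = 1 ⊗ₜ Om m := by rw [formSeries, ofSeries, if_pos hβ]
    simp only [h1, LinearMap.lTensor_tmul, LinearMap.comp_apply, ← TensorProduct.tmul_smul,
      ← TensorProduct.tmul_sum]
    rw [sum_nabla_wedge_eq_ceDifferential e hT, hOm, neg_zero, TensorProduct.tmul_zero]
  · have h1 : (formSeries Om : WL R ι g R) m β = 0 := by rw [formSeries, ofSeries, if_neg hβ]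
    simp only [h1, map_zero, smul_zero, Finset.sum_const_zero]

/-- Ω has no symmetric generators to contract and consists of two-forms, so both products are the
undeformed one without signs. Centrality of Ω is what allows it in the equation for ϱ. -/
theorem star_formSeries (bi : LinearMap.BilinForm R (Module.Dual R g))
    {Om : ℕ → ExteriorAlgebra R (Module.Dual R g)}
    (hOm : ∀ k, Om k ∈ ⋀[R]^2 (Module.Dual R g)) (a : WL R ι g A) :
    star e bi (LinearMap.lsmul R A) (formSeries Om) a =
      star e bi (LinearMap.lsmul R A).flip a (formSeries Om) := by
  have hins : ∀ k, insSym k (formSeries Om : WL R ι g R) = 0 := fun k => insSym_ofSeries k _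
  rw [star_swap e bi (l := 2) (fun x hx y => mem_center_of_mem_two.{u, max v u} hx y)
    (formSeries_mem_antisymDegree hOm), star_of_insSym_eq_zero e _ _ hins,
    star_of_insSym_eq_zero e _ _ hins]

end Bianchi

/-! ## The homotopy operator -/

section FormScaleProjection

variable {R : Type u} [CommRing R] {V : Type w} [AddCommGroup V] [Module R V]

theorem formScale_zero_degree (x : ExteriorAlgebra R V) :
    formScale (fun l => if l = 0 then 1 else 0) x =
      algebraMap R _ (ExteriorAlgebra.algebraMapInv x) := by
  have : formScale (R := R) (V := V) (fun l => if l = 0 then 1 else 0) =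
      Algebra.linearMap R _ ∘ₗ ExteriorAlgebra.algebraMapInv.toLinearMap := by
    refine exterior_linearMap_ext fun l x hx => ?_
    rw [formScale_of_mem _ hx]
    cases l with
    | zero =>
      rw [ExteriorAlgebra.exteriorPower, pow_zero, Submodule.mem_one] at hx
      obtain ⟨c, rfl⟩ := hx
      simp
    | succ l =>
      induction hx using exteriorPower_succ_induction with
      | h_mul v x hx => simp [ExteriorAlgebra.algebraMapInv]
      | h_add x _ y _ hx hy => rw [smul_add, hx, hy, map_add]
  exact LinearMap.congr_fun this x

theorem formScale_natCast_add (k : ℕ) :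
    formScale (R := R) (V := V) (fun l => ((k + l : ℕ) : R)) =
      (k : R) • LinearMap.id + formScale fun l : ℕ => (l : R) :=
  exterior_linearMap_ext fun l x hx => by
    rw [LinearMap.add_apply, LinearMap.smul_apply, LinearMap.id_apply, formScale_of_mem _ hx,
      formScale_of_mem _ hx, Nat.cast_add, add_smul]

end FormScaleProjection

section Homotopy

variable {R : Type u} [CommRing R] {g : Type v} [LieRing g] [LieAlgebra R g]
variable {ι : Type*} {A : Type w} [AddCommGroup A] [Module R A]

/-- Multiplication by `f (k + l)` on symmetric degree `k` and antisymmetric degree `l`. -/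
def degreeScale (f : ℕ → R) : Module.End R (WL R ι g A) :=
  onCoeff fun k => LinearMap.lTensor A (formScale fun l => f (k + l))

theorem degreeScale_apply (f : ℕ → R) (a : WL R ι g A) (m : ℕ) (β : ι →₀ ℕ) :
    degreeScale f a m β = LinearMap.lTensor A (formScale fun l => f (β.degree + l)) (a m β) := rfl

theorem degreeScale_mul (f h : ℕ → R) :
    (degreeScale f * degreeScale h : Module.End R (WL R ι g A)) = degreeScale (f * h) := by
  refine LinearMap.ext fun a => funext fun m => funext fun β => ?_
  rw [Module.End.mul_apply, degreeScale_apply, degreeScale_apply, degreeScale_apply,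
    ← LinearMap.comp_apply, ← LinearMap.lTensor_comp]
  exact congrArg (fun φ => LinearMap.lTensor A φ (a m β)) (formScale_comp.{u, max v u} _ _)

theorem degreeScale_add (f h : ℕ → R) :
    (degreeScale (f + h) : Module.End R (WL R ι g A)) = degreeScale f + degreeScale h := by
  refine LinearMap.ext fun a => funext fun m => funext fun β => ?_
  have h1 : (formScale fun l => (f + h) (β.degree + l)) = (formScale fun l => f (β.degree + l)) +
      (formScale fun l => h (β.degree + l) : ExteriorAlgebra R (Module.Dual R g) →ₗ[R] _) :=
    exterior_linearMap_ext fun l x hx => by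
      rw [LinearMap.add_apply, formScale_of_mem _ hx, formScale_of_mem _ hx,
        formScale_of_mem _ hx, Pi.add_apply, add_smul]
  rw [degreeScale_apply, h1, LinearMap.lTensor_add]
  rfl

theorem degreeScale_one : (degreeScale (fun _ => 1) : Module.End R (WL R ι g A)) = 1 := by
  refine LinearMap.ext fun a => funext fun m => funext fun β => ?_
  rw [degreeScale_apply]
  have h1 : (formScale fun _ => (1 : R)) =
      (LinearMap.id : ExteriorAlgebra R (Module.Dual R g) →ₗ[R] _) := formScale_one.{u, max v u}
  rw [h1, LinearMap.lTensor_id]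
  rfl

theorem degreeScale_mem_antisymDegree (f : ℕ → R) {l : ℕ} {a : WL R ι g A}
    (ha : a ∈ antisymDegree l) : degreeScale f a ∈ antisymDegree l := fun m β => by
  rw [degreeScale_apply]
  refine coeffDegree_induction (p := fun x => LinearMap.lTensor A _ x ∈ coeffDegree R g A l)
    ?_ (fun a x hx => ?_) (fun x y hx hy => ?_) (ha m β)
  · rw [map_zero]; exact zero_mem _
  · rw [LinearMap.lTensor_tmul, formScale_of_mem _ hx]
    exact tmul_mem_coeffDegree _ (Submodule.smul_mem _ _ hx)
  · rw [map_add]; exact add_mem hx hy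

theorem insSym_degreeScale (i : ι) (f : ℕ → R) :
    (insSym i * degreeScale f : Module.End R (WL R ι g A)) =
      degreeScale (fun n => f (n + 1)) * insSym i := by
  refine LinearMap.ext fun a => funext fun m => funext fun β => ?_
  rw [Module.End.mul_apply, Module.End.mul_apply, insSym_apply, degreeScale_apply,
    degreeScale_apply, insSym_apply, map_smul, map_add, Finsupp.degree_single]
  simp only [add_right_comm]

theorem degreeScale_mulSym (i : ι) (f : ℕ → R) :
    (degreeScale f * mulSym i : Module.End R (WL R ι g A)) =
      mulSym i * degreeScale (fun n => f (n + 1)) := by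
  refine LinearMap.ext fun a => funext fun m => funext fun β => ?_
  rw [Module.End.mul_apply, Module.End.mul_apply, mulSym_apply, degreeScale_apply,
    degreeScale_apply, mulSym_apply]
  split_ifs with h
  · rw [map_zero]
  · have h1 : β - Finsupp.single i 1 + Finsupp.single i 1 = β :=
      tsub_add_cancel_of_le (by simpa [Nat.one_le_iff_ne_zero] using h)
    have h2 := congrArg Finsupp.degree h1
    rw [map_add, Finsupp.degree_single] at h2
    simp only [← h2, add_right_comm]

variable (e : Module.Basis ι R g)

theorem degreeScale_opW (i : ι) (f : ℕ → R) :
    (degreeScale f * opW e i : Module.End R (WL R ι g A)) =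
      opW e i * degreeScale (fun n => f (n + 1)) := by
  refine LinearMap.ext fun a => funext fun m => funext fun β => ?_
  rw [Module.End.mul_apply, Module.End.mul_apply, opW, onForms_apply, degreeScale_apply,
    degreeScale_apply, onForms_apply, ← LinearMap.comp_apply, ← LinearMap.lTensor_comp,
    ← LinearMap.comp_apply, ← LinearMap.lTensor_comp]
  refine congrArg (fun φ => LinearMap.lTensor A φ (a m β)) (LinearMap.ext fun x => ?_)
  exact formScale_wedgeLeft _ _ _

theorem opI_degreeScale (i : ι) (f : ℕ → R) :
    (opI e i * degreeScale f : Module.End R (WL R ι g A)) =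
      degreeScale (fun n => f (n + 1)) * opI e i := by
  refine LinearMap.ext fun a => funext fun m => funext fun β => ?_
  rw [Module.End.mul_apply, Module.End.mul_apply, opI, onForms_apply, degreeScale_apply,
    degreeScale_apply, onForms_apply, ← LinearMap.comp_apply, ← LinearMap.lTensor_comp,
    ← LinearMap.comp_apply, ← LinearMap.lTensor_comp]
  refine congrArg (fun φ => LinearMap.lTensor A φ (a m β)) (LinearMap.ext fun x => ?_)
  exact insVector_formScale _ _ _

theorem opI_mem_antisymDegree [DecidableEq ι] (i : ι) {l : ℕ} {a : WL R ι g A} (ha : a ∈ antisymDegree (l + 1)) :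
    opI e i a ∈ antisymDegree l :=
  onForms_mem_antisymDegree (fun _ hx => insVector_mem _ hx) ha

theorem opI_of_mem_zero (i : ι) {a : WL R ι g A} (ha : a ∈ antisymDegree 0) : opI e i a = 0 := by
  refine funext fun m => funext fun β => ?_
  rw [opI, onForms_apply]
  refine coeffDegree_induction (p := fun x => LinearMap.lTensor A (insVector (e i)) x = 0)
    (map_zero _) (fun a x hx => ?_) (fun x y hx hy => ?_) (ha m β)
  · rw [LinearMap.lTensor_tmul, insVector_of_mem_zero _ hx, TensorProduct.tmul_zero]
  · rw [map_add, hx, hy, add_zero]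

variable [Fintype ι]

theorem delta_eq : (delta e : Module.End R (WL R ι g A)) = ∑ i, opW e i * insSym i := rfl

theorem deltaStar_eq : (deltaStar e : Module.End R (WL R ι g A)) = ∑ i, mulSym i * opI e i := rfl

theorem delta_degreeScale (f : ℕ → R) :
    (delta e * degreeScale f : Module.End R (WL R ι g A)) = degreeScale f * delta e := by
  rw [delta_eq, Finset.sum_mul, Finset.mul_sum]
  refine Finset.sum_congr rfl fun i _ => ?_
  rw [mul_assoc, insSym_degreeScale, ← mul_assoc, ← mul_assoc, degreeScale_opW]

theorem deltaStar_degreeScale (f : ℕ → R) :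
    (deltaStar e * degreeScale f : Module.End R (WL R ι g A)) = degreeScale f * deltaStar e := by
  rw [deltaStar_eq, Finset.sum_mul, Finset.mul_sum]
  refine Finset.sum_congr rfl fun i _ => ?_
  rw [mul_assoc, opI_degreeScale, ← mul_assoc, ← mul_assoc, degreeScale_mulSym]

theorem sum_mulSym_insSym_apply (a : WL R ι g A) (m : ℕ) (β : ι →₀ ℕ) :
    ∑ i, mulSym i (insSym i a) m β = (β.degree : R) • a m β := by
  have h : ∀ i, mulSym i (insSym i a) m β = (β i : R) • a m β := fun i => by
    rw [mulSym_apply, insSym_apply]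
    split_ifs with h
    · rw [h, Nat.cast_zero, zero_smul]
    · have h1 : β - Finsupp.single i 1 + Finsupp.single i 1 = β :=
        tsub_add_cancel_of_le (by simpa [Nat.one_le_iff_ne_zero] using h)
      have h2 := DFunLike.congr_fun h1 i
      rw [Finsupp.add_apply, Finsupp.single_eq_same] at h2
      rw [h1, h2]
  simp only [h]
  rw [← Finset.sum_smul, ← Nat.cast_sum, Finsupp.degree_eq_sum]

theorem sum_opW_opI_add_sum_mulSym_insSym :
    (∑ i, opW e i * opI e i + ∑ i, mulSym i * insSym i : Module.End R (WL R ι g A)) =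
      degreeScale fun n => (n : R) := by
  refine LinearMap.ext fun a => funext fun m => funext fun β => ?_
  have h1 : (∑ i, opW e i * opI e i : Module.End R (WL R ι g A)) =
      onForms (∑ i, wedgeLeft (e.coord i) ∘ₗ insVector (e i)) := by
    refine LinearMap.ext fun a => funext fun m => funext fun β => ?_
    simp only [opW, opI, onForms_mul, LinearMap.sum_apply, Finset.sum_apply, onForms_apply,
      ← LinearMap.coe_lTensorHom, map_sum]
  have h2 : (∑ i, mulSym i * insSym i : Module.End R (WL R ι g A)) a m β =
      (β.degree : R) • a m β := by
    rw [← sum_mulSym_insSym_apply, LinearMap.sum_apply, Finset.sum_apply, Finset.sum_apply]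
    rfl
  rw [LinearMap.add_apply, Pi.add_apply, Pi.add_apply, h2, h1, onForms_apply, degreeScale_apply,
    sum_wedgeLeft_insVector, formScale_natCast_add, add_comm, LinearMap.lTensor_add,
    LinearMap.lTensor_smul, LinearMap.lTensor_id]
  rfl

theorem delta_deltaStar_add :
    (delta e * deltaStar e + deltaStar e * delta e : Module.End R (WL R ι g A)) =
      degreeScale fun n => (n : R) := by
  classical
  exact ((canonicalOperators e).delta_deltaStar).trans (sum_opW_opI_add_sum_mulSym_insSym e)

/-- The projection onto symmetric and antisymmetric degree zero. -/
def projZero : Module.End R (WL R ι g A) := degreeScale fun n => if n = 0 then 1 else 0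

theorem projZero_apply (a : WL R ι g A) : projZero a = incl (sigma a) := by
  refine funext fun m => funext fun β => ?_
  rw [projZero, degreeScale_apply, incl, ofSeries]
  split_ifs with h
  · subst h
    have h1 : (formScale fun l => if (0 : ι →₀ ℕ).degree + l = 0 then (1 : R) else 0) =
        Algebra.linearMap R (ExteriorAlgebra R (Module.Dual R g)) ∘ₗ
          ExteriorAlgebra.algebraMapInv.toLinearMap := by
      refine LinearMap.ext fun x => ?_
      rw [map_zero]
      simp only [zero_add]
      exact formScale_zero_degree x
    rw [h1, sigma]
    induction a m 0 using TensorProduct.induction_on with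
    | zero => simp
    | tmul x y => simp [TensorProduct.tmul_smul, Algebra.algebraMap_eq_smul_one,
        TensorProduct.smul_tmul']
    | add x y hx hy => simp only [map_add, hx, hy, TensorProduct.add_tmul]
  · have h1 : (formScale fun l => if β.degree + l = 0 then (1 : R) else 0) =
        (0 : ExteriorAlgebra R (Module.Dual R g) →ₗ[R] _) := by
      have h2 : (fun l => if β.degree + l = 0 then (1 : R) else 0) = fun _ => 0 := by
        funext l
        rw [if_neg]
        intro hc
        exact h ((Finsupp.degree_eq_zero_iff β).1 (by omega))
      rw [h2]
      exact exterior_linearMap_ext fun l x hx => by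
        rw [formScale_of_mem _ hx, zero_smul, LinearMap.zero_apply]
    rw [h1, LinearMap.lTensor_zero]; rfl

theorem projZero_of_mem {l : ℕ} {a : WL R ι g A} (ha : a ∈ antisymDegree (l + 1)) :
    projZero a = 0 := by
  refine funext fun m => funext fun β => ?_
  rw [projZero, degreeScale_apply]
  refine coeffDegree_induction (p := fun x => LinearMap.lTensor A (formScale fun l =>
    if β.degree + l = 0 then (1 : R) else 0) x = 0)
    (map_zero _) (fun a x hx => ?_) (fun x y hx hy => ?_) (ha m β)
  · rw [LinearMap.lTensor_tmul, formScale_of_mem _ hx, if_neg (by omega), zero_smul,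
      TensorProduct.tmul_zero]
  · rw [map_add, hx, hy, add_zero]

variable [Algebra ℚ R] [DecidableEq ι]

/-- Division by the degree, and zero in degree zero. -/
def invDegree (n : ℕ) : R := if n = 0 then 0 else algebraMap ℚ R (1 / n)

theorem deltaInv_eq :
    (deltaInv e : Module.End R (WL R ι g A)) = deltaStar e * degreeScale invDegree := by
  simp only [deltaInv, degreeScale, invDegree, Nat.cast_add]
  rfl

theorem deltaInv_deltaInv (a : WL R ι g A) : deltaInv e (deltaInv e a) = 0 := by
  have h := LinearMap.congr_fun ((canonicalOperators e).deltaStar_deltaStar (E := Module.End R (WL R ι g A)))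
    (degreeScale invDegree (degreeScale invDegree a))
  have h0 : deltaStar e (deltaStar e (degreeScale invDegree (degreeScale invDegree a))) = 0 := by
    refine eq_zero_of_nsmul_eq_zero (R := R) two_ne_zero ?_
    rw [two_nsmul]
    exact h
  rw [deltaInv_eq, Module.End.mul_apply, Module.End.mul_apply, ← Module.End.mul_apply (degreeScale _),
    ← deltaStar_degreeScale, Module.End.mul_apply, h0]

/-- The operators δ and δ* preserve the sum of the degrees, and δδ* + δ*δ is multiplication by this
sum. Dividing by it gives the identity except in degree zero, where σ takes over. -/
theorem delta_deltaInv_add (a : WL R ι g A) :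
    delta e (deltaInv e a) + deltaInv e (delta e a) = a - incl (sigma a) := by
  have h1 : (delta e * deltaInv e + deltaInv e * delta e : Module.End R (WL R ι g A)) =
      1 - projZero := by
    rw [deltaInv_eq, mul_assoc, ← delta_degreeScale, ← mul_assoc, ← mul_assoc, ← add_mul,
      delta_deltaStar_add, degreeScale_mul, eq_sub_iff_add_eq, projZero, ← degreeScale_add,
      ← degreeScale_one]
    congr 1
    funext n
    rw [Pi.add_apply, Pi.mul_apply, invDegree]
    split_ifs with h
    · simp
    · rw [add_zero, ← map_natCast (algebraMap ℚ R), ← map_mul,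
        mul_one_div_cancel (by exact_mod_cast h), map_one]
  have h2 := LinearMap.congr_fun h1 a
  rw [LinearMap.sub_apply, projZero_apply] at h2
  exact h2

theorem deltaInv_mem_antisymDegree {l : ℕ} {a : WL R ι g A} (ha : a ∈ antisymDegree (l + 1)) :
    deltaInv e a ∈ antisymDegree l := by
  rw [deltaInv_eq, Module.End.mul_apply, deltaStar_eq, LinearMap.sum_apply]
  exact sum_mem fun i _ => mulSym_mem_antisymDegree i
    (opI_mem_antisymDegree e i (degreeScale_mem_antisymDegree _ ha))

theorem deltaInv_of_mem_zero {a : WL R ι g A} (ha : a ∈ antisymDegree 0) : deltaInv e a = 0 := by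
  rw [deltaInv_eq, Module.End.mul_apply, deltaStar_eq, LinearMap.sum_apply]
  refine Finset.sum_eq_zero fun i _ => ?_
  rw [Module.End.mul_apply, opI_of_mem_zero e i (degreeScale_mem_antisymDegree _ ha), map_zero]

theorem deltaInv_mem_totalFiltration {d : ℕ} {a : WL R ι g A} (ha : a ∈ totalFiltration d) :
    deltaInv e a ∈ totalFiltration (d + 1) := by
  rw [deltaInv_eq, Module.End.mul_apply, deltaStar_eq, LinearMap.sum_apply]
  exact sum_mem fun i _ => mulSym_mem_totalFiltration i
    (onCoeff_mem_totalFiltration _ (onCoeff_mem_totalFiltration _ ha))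

theorem deltaInv_mulT_apply (a : WL R ι g A) : deltaInv e (mulT a) = mulT (deltaInv e a) := by
  have h1 : degreeScale invDegree (mulT a) = mulT (degreeScale invDegree a) := by
    refine funext fun m => funext fun β => ?_
    cases m with
    | zero => rw [degreeScale_apply, mulT_zero, mulT_zero, map_zero]
    | succ m => rfl
  have h2 : ∀ i (b : WL R ι g A), opI e i (mulT b) = mulT (opI e i b) := fun i b =>
    onForms_mulT_apply _ b
  rw [deltaInv_eq, Module.End.mul_apply, Module.End.mul_apply, h1, deltaStar_eq]
  simp only [LinearMap.sum_apply, map_sum, Module.End.mul_apply, h2, mulSym_mulT_apply]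

theorem sigma_deltaInv (a : WL R ι g A) : sigma (deltaInv e a) = 0 := by
  funext m
  have h : deltaInv e a m 0 = 0 := by
    rw [deltaInv_eq, Module.End.mul_apply, deltaStar_eq, LinearMap.sum_apply, Finset.sum_apply,
      Finset.sum_apply]
    refine Finset.sum_eq_zero fun i _ => ?_
    rw [Module.End.mul_apply, mulSym_apply, if_pos Finsupp.zero_apply]
  rw [sigma, h, map_zero, map_zero, Pi.zero_apply]

end Homotopy

/-! ## Fixed points of contractions -/

section FixedPoint

variable {R : Type u} [CommRing R] {g : Type v} [LieRing g] [LieAlgebra R g]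
variable {ι : Type*} {A : Type w} [AddCommGroup A] [Module R A]

theorem eq_of_sub_mem_totalFiltration {x y : WL R ι g A} (h : ∀ n, x - y ∈ totalFiltration n) :
    x = y := by
  refine funext fun m => funext fun β => ?_
  exact sub_eq_zero.1 (h (2 * m + β.degree + 1) m β (Nat.lt_succ_self _))

/-- A coefficient in a given position is determined modulo high total degree, so the conditions on
the form degree pass to limits. -/
theorem mem_antisymDegree_of_approx {l : ℕ} {x : WL R ι g A}
    (h : ∀ n, ∃ y ∈ antisymDegree l, x - y ∈ totalFiltration n) : x ∈ antisymDegree l := fun m β => by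
  obtain ⟨y, hy, hxy⟩ := h (2 * m + β.degree + 1)
  rw [show x m β = y m β from sub_eq_zero.1 (hxy m β (Nat.lt_succ_self _))]
  exact hy m β

theorem mem_totalFiltration_of_approx {d : ℕ} {x : WL R ι g A}
    (h : ∀ n, ∃ y ∈ totalFiltration d, x - y ∈ totalFiltration n) : x ∈ totalFiltration d := by
  obtain ⟨y, hy, hxy⟩ := h d
  simpa using add_mem hxy hy

/-- A map that raises the total degree of differences has a unique fixed point. -/
theorem existsUnique_fixedPoint {S : Set (WL R ι g A)} (hne : S.Nonempty)
    (hclosed : ∀ x, (∀ n, ∃ y ∈ S, x - y ∈ totalFiltration n) → x ∈ S)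
    {Φ : WL R ι g A → WL R ι g A} (hΦ : ∀ x ∈ S, Φ x ∈ S)
    (hc : ∀ d, ∀ x ∈ S, ∀ y ∈ S, x - y ∈ totalFiltration d → Φ x - Φ y ∈ totalFiltration (d + 1)) :
    ∃! x, x ∈ S ∧ Φ x = x := by
  obtain ⟨x₀, h₀⟩ := hne
  have hS : ∀ n, Φ^[n] x₀ ∈ S := fun n => by
    induction n with
    | zero => exact h₀
    | succ n ih => rw [Function.iterate_succ_apply']; exact hΦ _ ih
  have hstep : ∀ n, Φ^[n + 1] x₀ - Φ^[n] x₀ ∈ totalFiltration n := fun n => by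
    induction n with
    | zero => exact fun m β h => absurd h (Nat.not_lt_zero _)
    | succ n ih =>
      rw [Function.iterate_succ_apply', Function.iterate_succ_apply' Φ n]
      rw [Function.iterate_succ_apply'] at ih
      exact hc n _ (hΦ _ (hS n)) _ (hS n) ih
  have hcauchy : ∀ n k, Φ^[n + k] x₀ - Φ^[n] x₀ ∈ totalFiltration n := fun n k => by
    induction k with
    | zero => rw [add_zero, sub_self]; exact zero_mem _
    | succ k ih =>
      have h := add_mem (totalFiltration_mono (Nat.le_add_right n k) (hstep (n + k))) ih
      rwa [sub_add_sub_cancel] at h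
  -- The limit of the iterates: the coefficient at t^m and exponent β no longer changes once the
  -- number of iterations exceeds its total degree 2m + |β|.
  set x : WL R ι g A := fun m β => Φ^[2 * m + β.degree + 1] x₀ m β with hx
  have hlim : ∀ n, x - Φ^[n] x₀ ∈ totalFiltration n := fun n m β h => by
    obtain ⟨k, rfl⟩ := Nat.exists_eq_add_of_le (Nat.succ_le_of_lt h)
    have h1 := hcauchy (2 * m + β.degree + 1) k m β (Nat.lt_succ_self _)
    rw [← neg_eq_zero, ← h1]
    exact neg_sub _ _
  have hxS : x ∈ S := hclosed x fun n => ⟨_, hS n, hlim n⟩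
  refine ⟨x, ⟨hxS, eq_of_sub_mem_totalFiltration fun n => ?_⟩, ?_⟩
  · have h1 := hc n _ hxS _ (hS n) (hlim n)
    have h2 := sub_mem h1 (hlim (n + 1))
    rw [Function.iterate_succ_apply', sub_sub_sub_cancel_right] at h2
    exact totalFiltration_mono (Nat.le_succ n) h2
  · rintro y ⟨hyS, hy⟩
    refine eq_of_sub_mem_totalFiltration fun n => ?_
    induction n with
    | zero => exact fun m β h => absurd h (Nat.not_lt_zero _)
    | succ n ih =>
      have h1 := hc n _ hyS _ hxS ih
      have hfx : Φ x = x := by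
        refine eq_of_sub_mem_totalFiltration fun n => ?_
        have h1 := hc n _ hxS _ (hS n) (hlim n)
        have h2 := sub_mem h1 (hlim (n + 1))
        rw [Function.iterate_succ_apply', sub_sub_sub_cancel_right] at h2
        exact totalFiltration_mono (Nat.le_succ n) h2
      rwa [hy, hfx] at h1

variable {H : Module.End R (WL R ι g A)}

/-- Solving (1 - H) x = a means finding a fixed point of the contraction x ↦ a + H x; this is the
geometric series in the complete total-degree filtration. -/
theorem isUnit_one_sub (hH : ∀ d, ∀ a ∈ totalFiltration d, H a ∈ totalFiltration (d + 1)) :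
    IsUnit (1 - H) := by
  have h : ∀ a, ∃! x, x ∈ Set.univ ∧ a + H x = x := fun a =>
    existsUnique_fixedPoint (S := Set.univ) ⟨0, trivial⟩ (fun _ _ => trivial) (fun _ _ => trivial)
      fun d x _ y _ hxy => by
        rw [add_sub_add_left_eq_sub, ← map_sub]
        exact hH d _ hxy
  have h' : ∀ a x, (1 - H) x = a ↔ x ∈ Set.univ ∧ a + H x = x := fun a x => by
    rw [LinearMap.sub_apply, Module.End.one_apply, sub_eq_iff_eq_add, eq_comm]
    simp
  rw [Module.End.isUnit_iff]
  refine Function.bijective_iff_existsUnique _ |>.2 fun a => ?_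
  simp only [h']
  exact h a

/-- The same equation can be solved inside the closed subspace of degree l; injectivity of 1 - H
identifies that solution with x. -/
theorem mem_antisymDegree_of_one_sub
    (hH : ∀ d, ∀ a ∈ totalFiltration d, H a ∈ totalFiltration (d + 1)) {l : ℕ}
    (hl : ∀ a ∈ antisymDegree l, H a ∈ antisymDegree l) {x : WL R ι g A}
    (hx : (1 - H) x ∈ antisymDegree l) : x ∈ antisymDegree l := by
  have hΦ : ∀ y ∈ (antisymDegree l : Submodule R (WL R ι g A)), (1 - H) x + H y ∈ antisymDegree l :=
    fun y hy => add_mem hx (hl y hy)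
  obtain ⟨y, ⟨hy, hy'⟩, -⟩ := existsUnique_fixedPoint (S := ((antisymDegree l : Submodule R (WL R ι g A)) : Set (WL R ι g A)))
    (Φ := fun y => (1 - H) x + H y) ⟨0, zero_mem (antisymDegree l : Submodule R (WL R ι g A))⟩
    (fun _ h => mem_antisymDegree_of_approx h) hΦ
    fun d x _ y _ hxy => by
      rw [add_sub_add_left_eq_sub, ← map_sub]
      exact hH d _ hxy
  have h1 : (1 - H) y = (1 - H) x := by
    rw [LinearMap.sub_apply, Module.End.one_apply, sub_eq_iff_eq_add]
    exact hy'.symm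
  rw [← ((Module.End.isUnit_iff _).1 (isUnit_one_sub hH)).injective h1]
  exact hy

end FixedPoint

/-! ## The covariant derivative `D + L_A + (1/t) ad(ϱ) - δ` -/

section Ad

variable {R : Type u} [CommRing R] [Algebra ℚ R] {g : Type v} [LieRing g] [LieAlgebra R g]
variable {ι : Type*} [DecidableEq ι] [Fintype ι] {A : Type w} [AddCommGroup A] [Module R A]
variable (e : Module.Basis ι R g) {bi : LinearMap.BilinForm R (Module.Dual R g)}
  {nabla : g →ₗ[R] g →ₗ[R] g} {ρ : WL R ι g R}

theorem lsmul_self : LinearMap.lsmul R R = LinearMap.mul R R := rfl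

theorem lsmul_flip_self : (LinearMap.lsmul R R).flip = LinearMap.lsmul R R :=
  LinearMap.ext fun a => LinearMap.ext fun b => mul_comm b a

theorem ad_apply (a : WL R ι g A) : ad e bi 1 ρ a =
    star e bi (LinearMap.lsmul R A) ρ a - star e bi (LinearMap.lsmul R A).flip (parity a) ρ := by
  have h : (onForms (formScale fun l => (-1) ^ (1 * l)) : WL R ι g A →ₗ[R] WL R ι g A) = parity := by
    rw [parity]
    congr 1
    refine exterior_linearMap_ext fun l x hx => ?_
    rw [formScale_of_mem _ hx, one_mul]
    exact (formScale_of_mem.{u, max v u} _ hx).symm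
  rw [ad, h]
  rfl

theorem parity_mulT_apply (a : WL R ι g A) : parity (mulT a) = mulT (parity a) :=
  onForms_mulT_apply _ _

/-- At t⁰ the product is graded commutative, so the graded commutator with a one-form vanishes there
and division by t loses nothing. -/
theorem mulT_divT_ad (hρ : ρ ∈ antisymDegree 1) (a : WL R ι g A) :
    mulT (divT (ad e bi 1 ρ a)) = ad e bi 1 ρ a := by
  refine mulT_divT ?_
  rw [ad_apply, Pi.sub_apply, star_zero_apply, star_zero_apply, sub_eq_zero]
  exact congrFun (wmul_swap (fun x hx y => mul_eq_gradeInv_mul_of_mem_one.{u, max v u} hx y) hρ a) 0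

theorem parity_of_mem_one (hρ : ρ ∈ antisymDegree 1) : parity ρ = -ρ := by
  have h := parity_of_mem hρ
  rw [pow_one] at h
  refine h.trans (funext fun m => funext fun β => ?_)
  exact neg_one_smul R (ρ m β)

theorem parity_parity_apply (a : WL R ι g A) : parity (parity a) = a :=
  LinearMap.congr_fun parity_parity a

/-- At t⁰ an odd element anticommutes with itself, so twice its square vanishes, and 2 is
invertible. -/
theorem star_self_zero (hρ : ρ ∈ antisymDegree 1) :
    mulT (divT (star e bi (LinearMap.mul R R) ρ ρ)) = star e bi (LinearMap.mul R R) ρ ρ := by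
  refine mulT_divT ?_
  have h1 := wmul_swap (B := LinearMap.mul R R)
    (fun x hx y => mul_eq_gradeInv_mul_of_mem_one.{u, max v u} hx y) hρ ρ
  have h2 : onForms (gradeInv.{u, max v u} (R := R) (V := Module.Dual R g)) ρ = -ρ :=
    parity_of_mem_one hρ
  have h3 : (LinearMap.mul R R).flip = LinearMap.mul R R := lsmul_flip_self
  rw [h2, h3, map_neg, LinearMap.neg_apply] at h1
  rw [star_zero_apply]
  refine funext fun β => eq_zero_of_nsmul_eq_zero (R := R) two_ne_zero ?_
  rw [two_nsmul]
  nth_rw 1 [h1]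
  exact neg_add_cancel _

theorem ad_mulT_apply (a : WL R ι g A) : ad e bi 1 ρ (mulT a) = mulT (ad e bi 1 ρ a) := by
  rw [ad_apply, ad_apply, parity_mulT_apply, star_mulT_left, star_mulT_right, map_sub]

theorem map_neg_sub_neg_apply {V W U : Type*} [AddCommGroup V] [AddCommGroup W] [AddCommGroup U]
    [Module R V] [Module R W] [Module R U] (f : V →ₗ[R] W →ₗ[R] U) (x y : V) (z : W) :
    f (-x - -y) z = -f x z - -f y z := by
  rw [map_sub, map_neg, map_neg]
  rfl

theorem map_neg_apply₂ {V W U : Type*} [AddCommGroup V] [AddCommGroup W] [AddCommGroup U]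
    [Module R V] [Module R W] [Module R U] (f : V →ₗ[R] W →ₗ[R] U) (x : V) (z : W) :
    f (-x) z = -f x z := by
  rw [map_neg]
  rfl

/-- In the double graded commutator the terms ρ ∘ a ∘ ρ occur with opposite signs since ρ is odd;
what remains is the commutator with ρ ∘ ρ. -/
theorem ad_ad (hρ : ρ ∈ antisymDegree 1) (a : WL R ι g A) : ad e bi 1 ρ (ad e bi 1 ρ a) =
    star e bi (LinearMap.lsmul R A) (star e bi (LinearMap.mul R R) ρ ρ) a -
      star e bi (LinearMap.lsmul R A).flip a (star e bi (LinearMap.mul R R) ρ ρ) := by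
  have h4 : parity (star e bi (LinearMap.lsmul R A) ρ a) =
      -star e bi (LinearMap.lsmul R A) ρ (parity a) := by
    rw [parity_star]
    exact (congrArg (fun x => star e bi (LinearMap.lsmul R A) x (parity a))
      (parity_of_mem_one hρ)).trans (map_neg_apply₂ _ _ _)
  have h5 : parity (star e bi (LinearMap.lsmul R A).flip (parity a) ρ) =
      -star e bi (LinearMap.lsmul R A).flip a ρ := by
    rw [parity_star, parity_parity_apply]
    exact (congrArg (fun x => star e bi (LinearMap.lsmul R A).flip a x)
      (parity_of_mem_one hρ)).trans (map_neg _ _)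
  have h1 : star e bi (LinearMap.lsmul R A) ρ (star e bi (LinearMap.lsmul R A) ρ a) =
      star e bi (LinearMap.lsmul R A) (star e bi (LinearMap.mul R R) ρ ρ) a :=
    (star_assoc e bi (B₁₂ := LinearMap.mul R R) (B₂₃ := LinearMap.lsmul R A) (B := LinearMap.lsmul R A)
      (B' := LinearMap.lsmul R A) (fun x y z => by
        rw [LinearMap.lsmul_apply, LinearMap.mul_apply', mul_smul]; rfl) ρ ρ a).symm
  have h2 : star e bi (LinearMap.lsmul R A).flip (star e bi (LinearMap.lsmul R A) ρ (parity a)) ρ =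
      star e bi (LinearMap.lsmul R A) ρ (star e bi (LinearMap.lsmul R A).flip (parity a) ρ) :=
    star_assoc e bi (B₁₂ := LinearMap.lsmul R A) (B₂₃ := (LinearMap.lsmul R A).flip)
      (B := (LinearMap.lsmul R A).flip) (B' := LinearMap.lsmul R A) (fun x y z => by
        simp only [LinearMap.flip_apply, LinearMap.lsmul_apply, smul_comm z x]) ρ (parity a) ρ
  have h3 : star e bi (LinearMap.lsmul R A).flip (star e bi (LinearMap.lsmul R A).flip a ρ) ρ =
      star e bi (LinearMap.lsmul R A).flip a (star e bi (LinearMap.mul R R) ρ ρ) :=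
    star_assoc e bi (B₁₂ := (LinearMap.lsmul R A).flip) (B₂₃ := LinearMap.mul R R)
      (B := (LinearMap.lsmul R A).flip) (B' := (LinearMap.lsmul R A).flip) (fun x y z => by
      simp only [LinearMap.flip_apply, LinearMap.lsmul_apply, LinearMap.mul_apply', smul_smul,
        mul_comm]) a ρ ρ
  have h6 : star e bi (LinearMap.lsmul R A) ρ (ad e bi 1 ρ a) = _ :=
    (congrArg (star e bi (LinearMap.lsmul R A) ρ) (ad_apply e a)).trans
      ((map_sub _ _ _).trans (congrArg (· - _) h1))
  have h7 : parity (ad e bi 1 ρ a) = _ :=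
    (congrArg parity (ad_apply e a)).trans ((map_sub _ _ _).trans (congrArg₂ (· - ·) h4 h5))
  have h8 : star e bi (LinearMap.lsmul R A).flip (parity (ad e bi 1 ρ a)) ρ = _ :=
    (congrArg (fun x => star e bi (LinearMap.lsmul R A).flip x ρ) h7).trans
      ((map_neg_sub_neg_apply _ _ _ _).trans
        (congrArg₂ (fun x y => -x - -y) h2 h3))
  exact (ad_apply e _).trans ((congrArg₂ (· - ·) h6 h8).trans (by abel))

/-- By the graded Leibniz rule the derivative falls on ρ or on a, and the latter terms are cancelled
by the second summand. -/
theorem totalD_ad_add (hbi : IsCovariantlyConstant nabla bi) (act : g →ₗ[R] Module.End R A)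
    (hρ : ρ ∈ antisymDegree 1) (a : WL R ι g A) :
    totalD e nabla act (ad e bi 1 ρ a) + ad e bi 1 ρ (totalD e nabla act a) =
      star e bi (LinearMap.lsmul R A) (totalD e nabla 0 ρ) a -
        star e bi (LinearMap.lsmul R A).flip a (totalD e nabla 0 ρ) := by
  have hB : ∀ X (a : R) (b : A), act X (LinearMap.lsmul R A a b) =
      LinearMap.lsmul R A ((0 : g →ₗ[R] Module.End R R) X a) b + LinearMap.lsmul R A a (act X b) :=
    fun X a b => by simp
  have hB' : ∀ X (a : A) (b : R), act X ((LinearMap.lsmul R A).flip a b) =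
      (LinearMap.lsmul R A).flip (act X a) b +
        (LinearMap.lsmul R A).flip a ((0 : g →ₗ[R] Module.End R R) X b) :=
    fun X a b => by simp
  have h : totalD e nabla act (parity a) = -parity (totalD e nabla act a) := by
    rw [parity_totalD_apply, neg_neg]
  have h1 : star e bi (LinearMap.lsmul R A) (parity ρ) (totalD e nabla act a) =
      -star e bi (LinearMap.lsmul R A) ρ (totalD e nabla act a) :=
    (congrArg (fun x => star e bi (LinearMap.lsmul R A) x (totalD e nabla act a))
      (parity_of_mem_one hρ)).trans (map_neg_apply₂ _ _ _)
  have h3 : star e bi (LinearMap.lsmul R A).flip (totalD e nabla act (parity a)) ρ =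
      -star e bi (LinearMap.lsmul R A).flip (parity (totalD e nabla act a)) ρ :=
    (congrArg (fun x => star e bi (LinearMap.lsmul R A).flip x ρ) h).trans (map_neg_apply₂ _ _ _)
  have h4 : totalD e nabla act (ad e bi 1 ρ a) = _ :=
    (congrArg (totalD e nabla act) (ad_apply e a)).trans ((map_sub _ _ _).trans
      (congrArg₂ (· - ·) ((totalD_star e hbi hB ρ a).trans (congrArg (_ + ·) h1))
        ((totalD_star e hbi hB' (parity a) ρ).trans (congrArg₂ (· + ·) h3
          (congrArg (fun x => star e bi (LinearMap.lsmul R A).flip x (totalD e nabla 0 ρ))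
            (parity_parity_apply a))))))
  exact (congrArg₂ (· + ·) h4 (ad_apply e _)).trans (by abel)

/-- The covariant derivative `-δ + D + L_A + (1/t) ad(ϱ)`. -/
def fedosovD (bi : LinearMap.BilinForm R (Module.Dual R g)) (nabla : g →ₗ[R] g →ₗ[R] g)
    (ρ : WL R ι g R) (act : g →ₗ[R] Module.End R A) : Module.End R (WL R ι g A) :=
  totalD e nabla act + divT ∘ₗ ad e bi 1 ρ

theorem fedosovD_apply (act : g →ₗ[R] Module.End R A) (a : WL R ι g A) :
    fedosovD e bi nabla ρ act a = totalD e nabla act a + divT (ad e bi 1 ρ a) := rfl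

theorem mulT_fedosovD (hρ : ρ ∈ antisymDegree 1) (act : g →ₗ[R] Module.End R A) (a : WL R ι g A) :
    mulT (fedosovD e bi nabla ρ act a) = mulT (totalD e nabla act a) + ad e bi 1 ρ a := by
  rw [fedosovD_apply, map_add, mulT_divT_ad e hρ]

theorem fedosovD_mulT_apply (hρ : ρ ∈ antisymDegree 1) (act : g →ₗ[R] Module.End R A)
    (a : WL R ι g A) :
    fedosovD e bi nabla ρ act (mulT a) = mulT (fedosovD e bi nabla ρ act a) := by
  rw [mulT_fedosovD e hρ, fedosovD_apply, totalD_mulT_apply, ad_mulT_apply, divT_mulT]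

theorem fedosovD_fedosovD {r : ExteriorAlgebra R g} (h2 : r ∈ ⋀[R]^2 g)
    (hr : Function.Bijective (sharp r)) {s : LinearMap.BilinForm R (Module.Dual R g)}
    (hs : ∀ α β, s α β = s β α) (hT : IsTorsionFree nabla) (hS : IsSymplectic (omega r hr) nabla)
    (hCC : IsCovariantlyConstant nabla s) {act : g →ₗ[R] Module.End R A}
    (hact : ∀ X Y, act ⁅X, Y⁆ = act X * act Y - act Y * act X) (hρ : ρ ∈ antisymDegree 1)
    {F : WL R ι g R} (hF : F = curvElt e (omega r hr) nabla + totalD e nabla 0 ρ +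
      divT (star e (bivectorForm r + s) (LinearMap.mul R R) ρ ρ)) (a : WL R ι g A) :
    mulT (fedosovD e (bivectorForm r + s) nabla ρ act
      (fedosovD e (bivectorForm r + s) nabla ρ act a)) =
    star e (bivectorForm r + s) (LinearMap.lsmul R A) F a -
      star e (bivectorForm r + s) (LinearMap.lsmul R A).flip a F := by
  have hbi := isCovariantlyConstant_add h2 hr hS hCC
  have h1 := mulT_totalD_totalD e h2 hr hs hT hS hCC hact a
  have h2 := totalD_ad_add e hbi act hρ a
  have h3 := ad_ad e (bi := bivectorForm r + s) hρ a
  rw [← star_self_zero e hρ, star_mulT_left, star_mulT_right, ← map_sub] at h3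
  -- Both factors 1/t are cleared by working with t² times the square; its three parts are the
  -- square of the connection, the mixed term and the square of `ad`.
  have h4 : mulT (fedosovD e (bivectorForm r + s) nabla ρ act
      (mulT (fedosovD e (bivectorForm r + s) nabla ρ act a))) =
      mulT (mulT (totalD e nabla act (totalD e nabla act a))) +
      mulT (totalD e nabla act (ad e (bivectorForm r + s) 1 ρ a) +
        ad e (bivectorForm r + s) 1 ρ (totalD e nabla act a)) +
      ad e (bivectorForm r + s) 1 ρ (ad e (bivectorForm r + s) 1 ρ a) := by
    rw [mulT_fedosovD e hρ, mulT_fedosovD e hρ, map_add (totalD e nabla act), map_add (ad _ _ _ _),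
      totalD_mulT_apply, ad_mulT_apply, map_add mulT, map_add mulT]
    abel
  rw [fedosovD_mulT_apply e hρ, h1, h2, h3, ← map_add, ← map_add] at h4
  rw [mulT_injective h4, hF]
  simp only [map_add, LinearMap.add_apply]
  abel

end Ad

/-! ## Degrees of the operators -/

section Degrees

variable {R : Type u} [CommRing R] {g : Type v} [LieRing g] [LieAlgebra R g]
variable {ι : Type*} [DecidableEq ι] [Fintype ι] {A : Type w} [AddCommGroup A] [Module R A]
variable (e : Module.Basis ι R g) (nabla : g →ₗ[R] g →ₗ[R] g) (act : g →ₗ[R] Module.End R A)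

theorem divT_mem_antisymDegree {l : ℕ} {a : WL R ι g A} (ha : a ∈ antisymDegree l) :
    divT a ∈ antisymDegree l := fun m β => ha (m + 1) β

theorem onAct_mem_antisymDegree (f : Module.End R A) {l : ℕ} {a : WL R ι g A}
    (ha : a ∈ antisymDegree l) : onAct f a ∈ antisymDegree l := fun m β => by
  rw [onAct_apply]
  refine coeffDegree_induction (p := fun x => LinearMap.rTensor _ f x ∈ coeffDegree R g A l)
    ?_ (fun a x hx => ?_) (fun x y hx hy => ?_) (ha m β)
  · rw [map_zero]; exact zero_mem _
  · rw [LinearMap.rTensor_tmul]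
    exact tmul_mem_coeffDegree _ hx
  · rw [map_add]; exact add_mem hx hy

theorem parity_mem_antisymDegree {l : ℕ} {a : WL R ι g A} (ha : a ∈ antisymDegree l) :
    parity a ∈ antisymDegree l := by
  rw [parity_of_mem ha]
  exact Submodule.smul_mem _ _ ha

theorem covD_mem_antisymDegree (i : ι) {l : ℕ} {a : WL R ι g A} (ha : a ∈ antisymDegree l) :
    covD e nabla act i a ∈ antisymDegree l := by
  have h : ∀ j k, onForms (wedgeLeft (e.coord j) ∘ₗ insVector (e k)) a ∈ antisymDegree l :=
    fun j k => onForms_mem_antisymDegree (fun x hx => by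
      cases l with
      | zero => rw [LinearMap.comp_apply, insVector_of_mem_zero _ hx, map_zero]; exact zero_mem _
      | succ l => exact wedgeLeft_mem _ (insVector_mem _ hx)) ha
  rw [covD_apply]
  exact add_mem (sub_mem (neg_mem (insSym_mem_antisymDegree i ha)) (sum_mem fun j _ => sum_mem
    fun k _ => Submodule.smul_mem _ _ (add_mem (mulSym_mem_antisymDegree _
      (insSym_mem_antisymDegree _ ha)) (h j k)))) (onAct_mem_antisymDegree _ ha)

theorem totalD_mem_antisymDegree {l : ℕ} {a : WL R ι g A} (ha : a ∈ antisymDegree l) :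
    totalD e nabla act a ∈ antisymDegree (l + 1) := by
  rw [totalD_apply]
  exact sum_mem fun i _ => opW_mem_antisymDegree e i (covD_mem_antisymDegree e nabla act i ha)

theorem delta_mem_antisymDegree {l : ℕ} {a : WL R ι g A} (ha : a ∈ antisymDegree l) :
    delta e a ∈ antisymDegree (l + 1) := by
  rw [delta_eq, LinearMap.sum_apply]
  exact sum_mem fun i _ => opW_mem_antisymDegree e i (insSym_mem_antisymDegree i ha)

theorem leftMult_zero : (leftMult e 0 : WL R ι g A →ₗ[R] WL R ι g A) = 0 := by
  refine LinearMap.ext fun a => ?_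
  rw [leftMult, LinearMap.sum_apply]
  refine Finset.sum_eq_zero fun i _ => funext fun m => funext fun β => ?_
  rw [onCoeff_apply, LinearMap.zero_apply, TensorProduct.map_zero_left]
  rfl

theorem connD_apply_eq (a : WL R ι g A) : connD e nabla a = delta e a + totalD e nabla 0 a := by
  rw [totalD_eq, leftMult_zero, add_zero, LinearMap.add_apply, LinearMap.neg_apply,
    add_neg_cancel_left]

theorem connD_mem_antisymDegree {l : ℕ} {a : WL R ι g A} (ha : a ∈ antisymDegree l) :
    connD e nabla a ∈ antisymDegree (l + 1) := by
  rw [connD_apply_eq]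
  exact add_mem (delta_mem_antisymDegree e ha) (totalD_mem_antisymDegree e nabla 0 ha)

variable [Algebra ℚ R] {bi : LinearMap.BilinForm R (Module.Dual R g)} {ρ : WL R ι g R}

theorem ad_mem_antisymDegree (hρ : ρ ∈ antisymDegree 1) {l : ℕ} {a : WL R ι g A}
    (ha : a ∈ antisymDegree l) : ad e bi 1 ρ a ∈ antisymDegree (l + 1) := by
  rw [ad_apply]
  have h := star_mem_antisymDegree e bi (LinearMap.lsmul R A) hρ ha
  rw [add_comm] at h
  exact sub_mem h (star_mem_antisymDegree e bi _ (parity_mem_antisymDegree ha) hρ)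

theorem ad_mem_totalFiltration {k d : ℕ} (hρ : ρ ∈ totalFiltration k) {a : WL R ι g A}
    (ha : a ∈ totalFiltration d) : ad e bi 1 ρ a ∈ totalFiltration (d + k) := by
  rw [ad_apply]
  have h := star_mem_totalFiltration e bi (LinearMap.lsmul R A) hρ ha
  rw [add_comm] at h
  exact sub_mem h (star_mem_totalFiltration e bi _ (onCoeff_mem_totalFiltration _ ha) hρ)

theorem divT_ad_mem_totalFiltration {d : ℕ} (hρ : ρ ∈ totalFiltration 2) {a : WL R ι g A}
    (ha : a ∈ totalFiltration d) : divT (ad e bi 1 ρ a) ∈ totalFiltration d :=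
  divT_mem_totalFiltration (ad_mem_totalFiltration e hρ ha)

/-- In the homotopy identity the term with δ⁻¹ a drops out by assumption, and σ vanishes in positive
antisymmetric degree. -/
theorem deltaInv_delta_of_mem {l : ℕ} {a : WL R ι g A} (ha : a ∈ antisymDegree (l + 1))
    (h : deltaInv e a = 0) : deltaInv e (delta e a) = a := by
  have h1 := delta_deltaInv_add e a
  rwa [h, map_zero, zero_add, ← projZero_apply, projZero_of_mem ha, sub_zero] at h1

end Degrees

/-! ## The Fedosov element -/

section Element

variable {R : Type u} [CommRing R] [Algebra ℚ R] {g : Type v} [LieRing g] [LieAlgebra R g]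
variable {ι : Type*} [DecidableEq ι] [Fintype ι]
variable (e : Module.Basis ι R g)

/-- A torsion-free symplectic connection and a parallel symmetric bivector. -/
structure IsFedosovSetup (r : ExteriorAlgebra R g) (hr : Function.Bijective (sharp r))
    (s : LinearMap.BilinForm R (Module.Dual R g)) (nabla : g →ₗ[R] g →ₗ[R] g) : Prop where
  mem : r ∈ ⋀[R]^2 g
  symm : ∀ α β, s α β = s β α
  torsionFree : IsTorsionFree nabla
  symplectic : IsSymplectic (omega r hr) nabla
  parallel : IsCovariantlyConstant nabla s

variable {r : ExteriorAlgebra R g} {hr : Function.Bijective (sharp r)}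
  {s : LinearMap.BilinForm R (Module.Dual R g)} {nabla : g →ₗ[R] g →ₗ[R] g}
  {Om : ℕ → ExteriorAlgebra R (Module.Dual R g)} {ρ : WL R ι g R}

/-- The right hand side `R + D ϱ + (1/t) ϱ ∘ ϱ + Ω` of the equation for `δ ϱ`. -/
def fedosovRhs (r : ExteriorAlgebra R g) (hr : Function.Bijective (sharp r))
    (s : LinearMap.BilinForm R (Module.Dual R g)) (nabla : g →ₗ[R] g →ₗ[R] g)
    (Om : ℕ → ExteriorAlgebra R (Module.Dual R g)) (ρ : WL R ι g R) : WL R ι g R :=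
  curvElt e (omega r hr) nabla + connD e nabla ρ +
    divT (star e (bivectorForm r + s) (LinearMap.mul R R) ρ ρ) + formSeries Om

theorem isFedosovElement_iff : IsFedosovElement e (bivectorForm r + s) (omega r hr) nabla Om ρ ↔
    ρ ∈ antisymDegree 1 ∧ ρ ∈ totalFiltration 2 ∧ delta e ρ = fedosovRhs e r hr s nabla Om ρ ∧
      deltaInv e ρ = 0 :=
  ⟨fun h => ⟨h.1, h.2, h.3, h.4⟩, fun h => ⟨h.1, h.2.1, h.2.2.1, h.2.2.2⟩⟩

theorem fedosovRhs_mem_antisymDegree (hOm : ∀ k, Om k ∈ ⋀[R]^2 (Module.Dual R g))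
    (hρ : ρ ∈ antisymDegree 1) : fedosovRhs e r hr s nabla Om ρ ∈ antisymDegree 2 := by
  have h1 := curvElt_mem_antisymDegree e (omega r hr) nabla
  have h2 := connD_mem_antisymDegree e nabla hρ
  have h3 := divT_mem_antisymDegree
    (star_mem_antisymDegree e (bivectorForm r + s) (LinearMap.mul R R) hρ hρ)
  have h4 : formSeries Om ∈ (antisymDegree 2 : Submodule R (WL R ι g R)) :=
    formSeries_mem_antisymDegree hOm
  rw [one_add_one_eq_two] at h2 h3
  exact add_mem (add_mem (add_mem h1 h2) h3) h4

theorem fedosovRhs_mem_totalFiltration (hOm : Om 0 = 0) (hρ : ρ ∈ totalFiltration 2) :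
    fedosovRhs e r hr s nabla Om ρ ∈ totalFiltration 2 :=
  add_mem (add_mem (add_mem (curvElt_mem_totalFiltration e _ _) (connD_mem_totalFiltration e nabla hρ))
    (divT_mem_totalFiltration (star_mem_totalFiltration e _ _ hρ hρ)))
    (formSeries_mem_totalFiltration hOm)

/-- The quadratic term is polarized as (ρ-ρ')∘ρ + ρ'∘(ρ-ρ'). The factor of total degree at least 2
makes up for the division by t. -/
theorem fedosovRhs_sub_mem_totalFiltration {d : ℕ} {ρ' : WL R ι g R} (hρ : ρ ∈ totalFiltration 2)
    (hρ' : ρ' ∈ totalFiltration 2) (h : ρ - ρ' ∈ totalFiltration d) :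
    fedosovRhs e r hr s nabla Om ρ - fedosovRhs e r hr s nabla Om ρ' ∈ totalFiltration d := by
  have h1 : star e (bivectorForm r + s) (LinearMap.mul R R) ρ ρ -
      star e (bivectorForm r + s) (LinearMap.mul R R) ρ' ρ' =
      star e (bivectorForm r + s) (LinearMap.mul R R) (ρ - ρ') ρ +
      star e (bivectorForm r + s) (LinearMap.mul R R) ρ' (ρ - ρ') := by
    rw [map_sub, map_sub, LinearMap.sub_apply]; abel
  have h2 := star_mem_totalFiltration e (bivectorForm r + s) (LinearMap.mul R R) h hρ
  have h3 := star_mem_totalFiltration e (bivectorForm r + s) (LinearMap.mul R R) hρ' h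
  rw [add_comm 2 d] at h3
  have h4 := divT_mem_totalFiltration (add_mem h2 h3)
  rw [← h1, map_sub] at h4
  have h5 := connD_mem_totalFiltration e nabla h
  rw [map_sub] at h5
  have h6 := add_mem h5 h4
  rw [fedosovRhs, fedosovRhs]
  convert h6 using 1
  abel

theorem deltaInv_fedosovRhs_of_isFedosovElement
    (h : IsFedosovElement e (bivectorForm r + s) (omega r hr) nabla Om ρ) :
    deltaInv e (fedosovRhs e r hr s nabla Om ρ) = ρ := by
  obtain ⟨h1, -, h3, h4⟩ := (isFedosovElement_iff e).1 h
  rw [← h3, deltaInv_delta_of_mem e h1 h4]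

/-- The Bianchi identity for the curvature of `-δ + D + (1/t) ad(ϱ)`. -/
theorem fedosovD_curvature (hd : IsFedosovSetup r hr s nabla)
    (hOm : ∀ k, Om k ∈ ⋀[R]^2 (Module.Dual R g)) (hOm' : ∀ k, ceDifferential e (Om k) = 0)
    (hρ : ρ ∈ antisymDegree 1) :
    fedosovD e (bivectorForm r + s) nabla ρ 0 (fedosovRhs e r hr s nabla Om ρ - delta e ρ) = 0 := by
  have hbi := isCovariantlyConstant_add hd.mem hr hd.symplectic hd.parallel
  have hF : fedosovRhs e r hr s nabla Om ρ - delta e ρ = curvElt e (omega r hr) nabla +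
      totalD e nabla 0 ρ + divT (star e (bivectorForm r + s) (LinearMap.mul R R) ρ ρ) +
        formSeries Om := by
    rw [fedosovRhs, connD_apply_eq]; abel
  have hfl : (LinearMap.lsmul R R).flip = LinearMap.lsmul R R := lsmul_flip_self
  have had : ∀ a : WL R ι g R, a ∈ antisymDegree 2 → ad e (bivectorForm r + s) 1 ρ a =
      star e (bivectorForm r + s) (LinearMap.lsmul R R) ρ a -
        star e (bivectorForm r + s) (LinearMap.lsmul R R) a ρ := fun a ha => by
    have hp : parity a = a := by
      refine (parity_of_mem ha).trans (funext fun m => funext fun β => ?_)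
      rw [neg_one_sq]
      exact one_smul R (a m β)
    refine (ad_apply e a).trans (congrArg (HSub.hSub (star e (bivectorForm r + s) (LinearMap.lsmul R R) ρ a)) ?_)
    rw [hfl]
    exact congrArg (fun x => star e (bivectorForm r + s) (LinearMap.lsmul R R) x ρ) hp
  have hKD := totalD_curvElt e hd.mem hr hd.symm hd.torsionFree hd.symplectic hd.parallel
  have hOD : totalD e nabla 0 (formSeries Om : WL R ι g R) = 0 :=
    totalD_formSeries e hd.torsionFree hOm'
  have hDD := mulT_totalD_totalD e hd.mem hr hd.symm hd.torsionFree hd.symplectic hd.parallel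
    (act := (0 : g →ₗ[R] Module.End R R)) (fun X Y => by simp) ρ
  have hKa := had _ (curvElt_mem_antisymDegree e (omega r hr) nabla)
  have hOa : ad e (bivectorForm r + s) 1 ρ (formSeries Om) = 0 := by
    rw [had _ (formSeries_mem_antisymDegree hOm), star_formSeries e _ hOm, hfl, sub_self]
  have hDa := had _ (totalD_mem_antisymDegree e nabla 0 hρ)
  have hsq := star_mem_antisymDegree e (bivectorForm r + s) (LinearMap.mul R R) hρ hρ
  have hSa := had _ hsq
  have hass : star e (bivectorForm r + s) (LinearMap.lsmul R R)
      (star e (bivectorForm r + s) (LinearMap.mul R R) ρ ρ) ρ =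
      star e (bivectorForm r + s) (LinearMap.lsmul R R) ρ
        (star e (bivectorForm r + s) (LinearMap.mul R R) ρ ρ) :=
    star_assoc e _ (B₁₂ := LinearMap.mul R R) (B₂₃ := LinearMap.mul R R) (B := LinearMap.lsmul R R)
      (B' := LinearMap.lsmul R R) (fun x y z => mul_assoc x y z) ρ ρ ρ
  have hleib := totalD_star e hbi (act₁ := (0 : g →ₗ[R] Module.End R R))
    (act₂ := (0 : g →ₗ[R] Module.End R R)) (act := (0 : g →ₗ[R] Module.End R R))
    (B := LinearMap.mul R R) (fun X a b => by simp) ρ ρ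
  have hp : star e (bivectorForm r + s) (LinearMap.mul R R) (parity ρ) (totalD e nabla 0 ρ) =
      -star e (bivectorForm r + s) (LinearMap.mul R R) ρ (totalD e nabla 0 ρ) :=
    (congrArg (fun x => star e (bivectorForm r + s) (LinearMap.mul R R) x (totalD e nabla 0 ρ))
      (parity_of_mem_one hρ)).trans (map_neg_apply₂ _ _ _)
  have hT0 : ad e (bivectorForm r + s) 1 ρ
      (divT (star e (bivectorForm r + s) (LinearMap.mul R R) ρ ρ)) = 0 := by
    refine mulT_injective ?_
    rw [← ad_mulT_apply, star_self_zero e hρ, hSa, hass, sub_self, map_zero]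
  have hT1 : mulT (totalD e nabla 0 (divT (star e (bivectorForm r + s) (LinearMap.mul R R) ρ ρ))) =
      totalD e nabla 0 (star e (bivectorForm r + s) (LinearMap.mul R R) ρ ρ) := by
    rw [← totalD_mulT_apply, star_self_zero e hρ]
  -- After multiplication by t the derivatives of 𝓡 and Ω and the commutators of ρ with Ω and ρ∘ρ
  -- vanish. The second derivative of ρ cancels against [ρ, 𝓡], and the derivative of ρ∘ρ against
  -- the commutator of ρ with its derivative.
  refine mulT_injective ?_
  rw [hF, mulT_fedosovD e hρ]
  simp only [map_add, hKD, hOD, hDD, hKa, hOa, hDa, hT1, hleib, hp, hfl, map_zero, hT0]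
  simp only [← lsmul_self]
  abel

/-- The defect F of the equation satisfies δ⁻¹F = 0 and the Bianchi identity 𝒟F = 0. Hence F =
δ⁻¹(DF + (1/t)[ρ, F]), and since δ⁻¹ raises the total degree, F lies in every filtration step and
vanishes. -/
theorem isFedosovElement_of_deltaInv_fedosovRhs (hd : IsFedosovSetup r hr s nabla)
    (hOm : ∀ k, Om k ∈ ⋀[R]^2 (Module.Dual R g)) (hOm' : ∀ k, ceDifferential e (Om k) = 0)
    (hρ : ρ ∈ antisymDegree 1) (hρ' : ρ ∈ totalFiltration 2)
    (h : deltaInv e (fedosovRhs e r hr s nabla Om ρ) = ρ) :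
    IsFedosovElement e (bivectorForm r + s) (omega r hr) nabla Om ρ := by
  have h0 : deltaInv e ρ = 0 := by rw [← h, deltaInv_deltaInv]
  refine (isFedosovElement_iff e).2 ⟨hρ, hρ', ?_, h0⟩
  set F := fedosovRhs e r hr s nabla Om ρ - delta e ρ with hF
  have hF2 : F ∈ antisymDegree 2 :=
    sub_mem (fedosovRhs_mem_antisymDegree e hOm hρ) (delta_mem_antisymDegree e hρ)
  have hF0 : deltaInv e F = 0 := by
    rw [hF, map_sub, h, deltaInv_delta_of_mem e hρ h0, sub_self]
  have hB := fedosovD_curvature e hd hOm hOm' hρ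
  rw [← hF, fedosovD_apply] at hB
  have hδ : delta e F = connD e nabla F + divT (ad e (bivectorForm r + s) 1 ρ F) := by
    rw [connD_apply_eq, add_assoc, hB, add_zero]
  have hF1 := deltaInv_delta_of_mem e hF2 hF0
  have hFd : ∀ d, F - 0 ∈ totalFiltration d := fun d => by
    rw [sub_zero]
    induction d with
    | zero => exact fun m β h => absurd h (Nat.not_lt_zero _)
    | succ d ih =>
      rw [← hF1, hδ]
      exact deltaInv_mem_totalFiltration e (add_mem (connD_mem_totalFiltration e nabla ih)
        (divT_ad_mem_totalFiltration e hρ' ih))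
  exact (sub_eq_zero.1 (eq_of_sub_mem_totalFiltration hFd)).symm

/-- The solutions are exactly the fixed points of ρ ↦ δ⁻¹(right hand side) in form degree 1 and
total degree at least 2. The right hand side keeps the total degree of differences and δ⁻¹ gains
one, so this map is a contraction. -/
theorem existsUnique_isFedosovElement (hd : IsFedosovSetup r hr s nabla)
    (hOm : ∀ k, Om k ∈ ⋀[R]^2 (Module.Dual R g)) (hOm₀ : Om 0 = 0)
    (hOm' : ∀ k, ceDifferential e (Om k) = 0) :
    ∃! ρ, IsFedosovElement e (bivectorForm r + s) (omega r hr) nabla Om ρ := by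
  obtain ⟨ρ, ⟨⟨h1, h2⟩, h3⟩, huniq⟩ := existsUnique_fixedPoint
    (S := {ρ : WL R ι g R | ρ ∈ (antisymDegree 1 : Submodule R (WL R ι g R)) ∧
      ρ ∈ (totalFiltration 2 : Submodule R (WL R ι g R))})
    (Φ := fun ρ => deltaInv e (fedosovRhs e r hr s nabla Om ρ))
    ⟨0, zero_mem _, zero_mem _⟩
    (fun x hx => ⟨mem_antisymDegree_of_approx fun n => (hx n).imp fun y hy => ⟨hy.1.1, hy.2⟩,
      mem_totalFiltration_of_approx fun n => (hx n).imp fun y hy => ⟨hy.1.2, hy.2⟩⟩)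
    (fun ρ hρ => ⟨deltaInv_mem_antisymDegree e (fedosovRhs_mem_antisymDegree e hOm hρ.1),
      totalFiltration_mono (Nat.le_succ 2) (deltaInv_mem_totalFiltration e
        (fedosovRhs_mem_totalFiltration e hOm₀ hρ.2))⟩)
    (fun d x hx y hy hxy => by
      rw [← map_sub]
      exact deltaInv_mem_totalFiltration e (fedosovRhs_sub_mem_totalFiltration e hx.2 hy.2 hxy))
  refine ⟨ρ, isFedosovElement_of_deltaInv_fedosovRhs e hd hOm hOm' h1 h2 h3, fun ρ' h => ?_⟩
  obtain ⟨h1', h2', -, -⟩ := (isFedosovElement_iff e).1 h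
  exact huniq ρ' ⟨⟨h1', h2'⟩, deltaInv_fedosovRhs_of_isFedosovElement e h⟩

/-- The fixed-point equation gains one degree over the required 2. As a result (1/t) ad(ϱ) raises
the total degree strictly and does not affect the first order of the Taylor series. -/
theorem IsFedosovElement.mem_totalFiltration_three (hOm₀ : Om 0 = 0)
    (h : IsFedosovElement e (bivectorForm r + s) (omega r hr) nabla Om ρ) :
    ρ ∈ totalFiltration 3 := by
  rw [← deltaInv_fedosovRhs_of_isFedosovElement e h]
  exact deltaInv_mem_totalFiltration e (fedosovRhs_mem_totalFiltration e hOm₀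
    ((isFedosovElement_iff e).1 h).2.1)

end Element

/-! ## The Taylor series -/

section SigmaIncl

variable {R : Type u} [CommRing R] {g : Type v} [LieRing g] [LieAlgebra R g]
variable {ι : Type*} {A : Type w} [AddCommGroup A] [Module R A]

variable (R g ι A) in
/-- The projection `σ` as a linear map. -/
def sigmaLin : WL R ι g A →ₗ[R] (ℕ → A) where
  toFun := sigma
  map_add' a b := by funext m; simp [sigma]
  map_smul' c a := by funext m; simp [sigma]

variable (R g ι A) in
/-- The inclusion `A[[t]] → A ⊗ W ⊗ Λ` as a linear map. -/
def inclLin : (ℕ → A) →ₗ[R] WL R ι g A where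
  toFun := incl
  map_add' a b := by
    funext m β
    simp only [incl, ofSeries, Pi.add_apply]
    split_ifs
    · rw [TensorProduct.add_tmul]
    · rw [add_zero]
  map_smul' c a := by
    funext m β
    simp only [incl, ofSeries, Pi.smul_apply, RingHom.id_apply]
    split_ifs
    · rw [TensorProduct.smul_tmul']
    · rw [smul_zero]

theorem sigma_mulT (a : WL R ι g A) : sigma (mulT a) = shiftT (R := R) (sigma a) := by
  funext m
  cases m with
  | zero => rw [sigma, mulT_zero, map_zero, map_zero]; rfl
  | succ m => rfl

theorem incl_shiftT (ξ : ℕ → A) : (incl (shiftT (R := R) ξ) : WL R ι g A) = mulT (incl ξ) := by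
  funext m β
  cases m with
  | zero =>
    rw [incl, ofSeries, mulT_zero]
    split_ifs
    · exact TensorProduct.zero_tmul _ _
    · rfl
  | succ m => rfl

theorem sigma_incl (ξ : ℕ → A) : sigma (incl ξ : WL R ι g A) = ξ := by
  funext m
  rw [sigma, incl, ofSeries, if_pos rfl, LinearMap.lTensor_tmul]
  simp

theorem incl_zero : (incl (0 : ℕ → A) : WL R ι g A) = 0 := (inclLin R g ι A).map_zero

theorem incl_injective : Function.Injective (incl : (ℕ → A) → WL R ι g A) :=
  fun ξ η h => by rw [← sigma_incl (R := R) (g := g) (ι := ι) ξ, h, sigma_incl]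

theorem sigma_of_mem [Fintype ι] {l : ℕ} {a : WL R ι g A} (ha : a ∈ antisymDegree (l + 1)) : sigma a = 0 :=
  incl_injective (R := R) (g := g) (ι := ι)
    (by rw [← projZero_apply, projZero_of_mem ha, incl_zero])

theorem incl_mem_antisymDegree (ξ : ℕ → A) : (incl ξ : WL R ι g A) ∈ antisymDegree 0 := fun m β => by
  rw [incl, ofSeries]
  split_ifs
  · refine tmul_mem_coeffDegree _ ?_
    rw [ExteriorAlgebra.exteriorPower, pow_zero]
    exact Submodule.one_le.1 le_rfl
  · exact zero_mem _

theorem eq_tmul_one_of_mem_coeffDegree_zero {x : A ⊗[R] ExteriorAlgebra R (Module.Dual R g)}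
    (hx : x ∈ coeffDegree R g A 0) :
    x = TensorProduct.rid R A (LinearMap.lTensor A ExteriorAlgebra.algebraMapInv.toLinearMap x) ⊗ₜ 1 := by
  refine coeffDegree_induction (p := fun x => x = TensorProduct.rid R A
    (LinearMap.lTensor A ExteriorAlgebra.algebraMapInv.toLinearMap x) ⊗ₜ 1) ?_ (fun a x hx => ?_)
    (fun x y hx hy => ?_) hx
  · rw [map_zero, map_zero, TensorProduct.zero_tmul]
  · rw [ExteriorAlgebra.exteriorPower, pow_zero, Submodule.mem_one] at hx
    obtain ⟨c, rfl⟩ := hx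
    simp [Algebra.algebraMap_eq_smul_one, TensorProduct.tmul_smul, TensorProduct.smul_tmul']
  · rw [map_add, map_add, TensorProduct.add_tmul, ← hx, ← hy]

theorem apply_zero_of_mem {a : WL R ι g A} (ha : a ∈ antisymDegree 0) (m : ℕ) :
    a m 0 = sigma a m ⊗ₜ 1 := eq_tmul_one_of_mem_coeffDegree_zero (ha m 0)

theorem seriesSMul_eq_formalSum (c : PowerSeries R) (ξ : ℕ → A) :
    seriesSMul c ξ = formalSum fun n => PowerSeries.coeff n c • ξ := rfl

theorem map_seriesSMul {B : Type*} [AddCommGroup B] [Module R B] {Φ : (ℕ → A) →ₗ[R] (ℕ → B)}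
    (hΦ : ∀ a, Φ (shiftT (R := R) a) = shiftT (R := R) (Φ a)) (c : PowerSeries R) (ξ : ℕ → A) :
    Φ (seriesSMul c ξ) = seriesSMul c (Φ ξ) := by
  rw [seriesSMul_eq_formalSum, map_formalSum hΦ, seriesSMul_eq_formalSum]
  simp only [map_smul]

end SigmaIncl

section Taylor

variable {R : Type u} [CommRing R] [Algebra ℚ R] {g : Type v} [LieRing g] [LieAlgebra R g]
variable {ι : Type*} [DecidableEq ι] [Fintype ι] {A : Type w} [AddCommGroup A] [Module R A]
variable (e : Module.Basis ι R g)

section Homotopy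

variable (bi : LinearMap.BilinForm R (Module.Dual R g)) (nabla : g →ₗ[R] g →ₗ[R] g)
  {ρ : WL R ι g R} (act : g →ₗ[R] Module.End R A)

theorem connD_add_leftMult_add_ad_apply (a : WL R ι g A) :
    (connD e nabla + leftMult e act + divT ∘ₗ ad e bi 1 ρ : Module.End R (WL R ι g A)) a =
      delta e a + fedosovD e bi nabla ρ act a := by
  rw [fedosovD_apply, totalD_eq]
  simp only [LinearMap.add_apply, LinearMap.neg_apply, LinearMap.comp_apply]
  abel

theorem homotopyOp_apply (a : WL R ι g A) : homotopyOp e bi nabla ρ act a =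
    deltaInv e (delta e a + fedosovD e bi nabla ρ act a) +
      (delta e (deltaInv e a) + fedosovD e bi nabla ρ act (deltaInv e a)) := by
  rw [homotopyOp, LinearMap.add_apply, LinearMap.comp_apply, LinearMap.comp_apply,
    connD_add_leftMult_add_ad_apply, connD_add_leftMult_add_ad_apply]

/-- The operator inside the commutator is δ + 𝒟, and the part of the commutator coming from δ is id
- σ. In antisymmetric degree 0 only σ and δ⁻¹𝒟 remain. -/
theorem one_sub_homotopyOp_apply (a : WL R ι g A) : (1 - homotopyOp e bi nabla ρ act) a =
    incl (sigma a) - deltaInv e (fedosovD e bi nabla ρ act a) -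
      fedosovD e bi nabla ρ act (deltaInv e a) := by
  have h : incl (sigma a) = a - (delta e (deltaInv e a) + deltaInv e (delta e a)) := by
    rw [delta_deltaInv_add, sub_sub_cancel]
  rw [LinearMap.sub_apply, homotopyOp_apply, h, Module.End.one_apply, map_add]
  abel

theorem fedosovD_mem_antisymDegree (hρ : ρ ∈ antisymDegree 1) {l : ℕ} {a : WL R ι g A}
    (ha : a ∈ antisymDegree l) : fedosovD e bi nabla ρ act a ∈ antisymDegree (l + 1) := by
  rw [fedosovD_apply]
  exact add_mem (totalD_mem_antisymDegree e nabla act ha)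
    (divT_mem_antisymDegree (ad_mem_antisymDegree e hρ ha))

theorem homotopyOp_mem_antisymDegree_zero (hρ : ρ ∈ antisymDegree 1) {a : WL R ι g A}
    (ha : a ∈ antisymDegree 0) : homotopyOp e bi nabla ρ act a ∈ antisymDegree 0 := by
  rw [homotopyOp_apply, deltaInv_of_mem_zero e ha, map_zero, map_zero, add_zero, add_zero]
  exact deltaInv_mem_antisymDegree e (add_mem (delta_mem_antisymDegree e ha)
    (fedosovD_mem_antisymDegree e bi nabla act hρ ha))

theorem homotopyOp_mem_totalFiltration (hρ : ρ ∈ totalFiltration 2) (d : ℕ) (a : WL R ι g A)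
    (ha : a ∈ totalFiltration d) : homotopyOp e bi nabla ρ act a ∈ totalFiltration (d + 1) := by
  have h : ∀ d, ∀ a ∈ (totalFiltration d : Submodule R (WL R ι g A)),
      (connD e nabla + leftMult e act + divT ∘ₗ ad e bi 1 ρ : Module.End R (WL R ι g A)) a ∈ totalFiltration d :=
    fun d a ha => add_mem (add_mem (connD_mem_totalFiltration e nabla ha)
      (leftMult_mem_totalFiltration e act ha)) (divT_ad_mem_totalFiltration e hρ ha)
  rw [homotopyOp, LinearMap.add_apply, LinearMap.comp_apply, LinearMap.comp_apply]
  exact add_mem (deltaInv_mem_totalFiltration e (h d a ha))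
    (h _ _ (deltaInv_mem_totalFiltration e ha))

theorem isUnit_one_sub_homotopyOp (hρ : ρ ∈ totalFiltration 2) :
    IsUnit (1 - homotopyOp e bi nabla ρ act) :=
  isUnit_one_sub (homotopyOp_mem_totalFiltration e bi nabla act hρ)

theorem one_sub_homotopyOp_injective (hρ : ρ ∈ totalFiltration 2) :
    Function.Injective (1 - homotopyOp e bi nabla ρ act : Module.End R (WL R ι g A)) :=
  ((Module.End.isUnit_iff _).1 (isUnit_one_sub_homotopyOp e bi nabla act hρ)).injective

theorem one_sub_homotopyOp_mulT (hρ : ρ ∈ antisymDegree 1) (a : WL R ι g A) :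
    (1 - homotopyOp e bi nabla ρ act) (mulT a) = mulT ((1 - homotopyOp e bi nabla ρ act) a) := by
  rw [one_sub_homotopyOp_apply, one_sub_homotopyOp_apply, map_sub, map_sub, sigma_mulT, incl_shiftT,
    deltaInv_mulT_apply, fedosovD_mulT_apply e hρ, fedosovD_mulT_apply e hρ, deltaInv_mulT_apply]

theorem one_sub_homotopyOp_tau (hρ : ρ ∈ totalFiltration 2) (ξ : ℕ → A) :
    (1 - homotopyOp e bi nabla ρ act) (tau e bi nabla ρ act ξ) = incl ξ := by
  rw [tau, ← Module.End.mul_apply,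
    Ring.mul_inverse_cancel _ (isUnit_one_sub_homotopyOp e bi nabla act hρ), Module.End.one_apply]

theorem tau_eq_iff (hρ : ρ ∈ totalFiltration 2) {ξ : ℕ → A} {a : WL R ι g A} :
    tau e bi nabla ρ act ξ = a ↔ (1 - homotopyOp e bi nabla ρ act) a = incl ξ := by
  rw [← one_sub_homotopyOp_tau e bi nabla act hρ ξ,
    (one_sub_homotopyOp_injective e bi nabla act hρ).eq_iff, eq_comm]

theorem tau_mem_antisymDegree (hρ : ρ ∈ totalFiltration 2) (hρ' : ρ ∈ antisymDegree 1) (ξ : ℕ → A) :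
    tau e bi nabla ρ act ξ ∈ antisymDegree 0 := by
  refine mem_antisymDegree_of_one_sub (homotopyOp_mem_totalFiltration e bi nabla act hρ)
    (fun a => homotopyOp_mem_antisymDegree_zero e bi nabla act hρ') ?_
  rw [one_sub_homotopyOp_tau e bi nabla act hρ]
  exact incl_mem_antisymDegree ξ

theorem tau_shiftT (hρ : ρ ∈ totalFiltration 2) (hρ' : ρ ∈ antisymDegree 1) (ξ : ℕ → A) :
    tau e bi nabla ρ act (shiftT (R := R) ξ) = mulT (tau e bi nabla ρ act ξ) := by
  rw [tau_eq_iff e bi nabla act hρ, one_sub_homotopyOp_mulT e bi nabla act hρ',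
    one_sub_homotopyOp_tau e bi nabla act hρ, incl_shiftT]

theorem sigma_tau (hρ : ρ ∈ totalFiltration 2) (hρ' : ρ ∈ antisymDegree 1) (ξ : ℕ → A) :
    sigma (tau e bi nabla ρ act ξ) = ξ := by
  have h := one_sub_homotopyOp_tau e bi nabla act hρ ξ
  rw [one_sub_homotopyOp_apply, deltaInv_of_mem_zero e (tau_mem_antisymDegree e bi nabla act hρ hρ' ξ),
    map_zero, sub_zero, sub_eq_iff_eq_add] at h
  have hadd : ∀ x y : WL R ι g A, sigma (x + y) = sigma x + sigma y := (sigmaLin R g ι A).map_add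
  have h1 := congrArg sigma h
  rwa [hadd, sigma_incl, sigma_incl, sigma_deltaInv, add_zero] at h1

/-- The Taylor series as a linear map. -/
def tauLin (ρ : WL R ι g R) : (ℕ → A) →ₗ[R] WL R ι g A :=
  Ring.inverse (1 - homotopyOp e bi nabla ρ act) ∘ₗ inclLin R g ι A

end Homotopy

variable {r : ExteriorAlgebra R g} {hr : Function.Bijective (sharp r)}
  {s : LinearMap.BilinForm R (Module.Dual R g)} {nabla : g →ₗ[R] g →ₗ[R] g}
  {Om : ℕ → ExteriorAlgebra R (Module.Dual R g)} {ρ : WL R ι g R}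

/-- The equation for ϱ says that the curvature of 𝒟 is -Ω, and a commutator with the central Ω
vanishes. -/
theorem fedosovD_sq_of_isFedosovElement (hd : IsFedosovSetup r hr s nabla)
    (hOm : ∀ k, Om k ∈ ⋀[R]^2 (Module.Dual R g))
    (hρ : IsFedosovElement e (bivectorForm r + s) (omega r hr) nabla Om ρ)
    {act : g →ₗ[R] Module.End R A} (hact : ∀ X Y, act ⁅X, Y⁆ = act X * act Y - act Y * act X)
    (a : WL R ι g A) : fedosovD e (bivectorForm r + s) nabla ρ act
      (fedosovD e (bivectorForm r + s) nabla ρ act a) = 0 := by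
  obtain ⟨h1, -, h3, -⟩ := (isFedosovElement_iff e).1 hρ
  have hF : -formSeries Om = curvElt e (omega r hr) nabla + totalD e nabla 0 ρ +
      divT (star e (bivectorForm r + s) (LinearMap.mul R R) ρ ρ) := by
    rw [fedosovRhs, connD_apply_eq] at h3
    rw [neg_eq_iff_add_eq_zero]
    have h4 := sub_eq_zero.2 h3.symm
    rw [← h4]
    abel
  have h5 := fedosovD_fedosovD e hd.mem hr hd.symm hd.torsionFree hd.symplectic hd.parallel hact h1 hF a
  have h6 : star e (bivectorForm r + s) (LinearMap.lsmul R A) (-formSeries Om) a = _ :=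
    (map_neg_apply₂ _ _ _).trans (congrArg Neg.neg (star_formSeries e (bivectorForm r + s) hOm a))
  have h7 := map_neg (star e (bivectorForm r + s) (LinearMap.lsmul R A).flip a) (formSeries Om)
  refine mulT_injective ?_
  rw [h5, h6, h7, sub_self, map_zero]

/-- The invertible operator σ - δ⁻¹𝒟 - 𝒟δ⁻¹ kills 𝒟τ: its form degree is one, 𝒟² = 0, and δ⁻¹𝒟τ = 0
by the equation that defines τ. -/
theorem fedosovD_tau (hd : IsFedosovSetup r hr s nabla)
    (hOm : ∀ k, Om k ∈ ⋀[R]^2 (Module.Dual R g))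
    (hρ : IsFedosovElement e (bivectorForm r + s) (omega r hr) nabla Om ρ)
    {act : g →ₗ[R] Module.End R A} (hact : ∀ X Y, act ⁅X, Y⁆ = act X * act Y - act Y * act X)
    (ξ : ℕ → A) : fedosovD e (bivectorForm r + s) nabla ρ act
      (tau e (bivectorForm r + s) nabla ρ act ξ) = 0 := by
  obtain ⟨h1, h2, -, -⟩ := (isFedosovElement_iff e).1 hρ
  have ht := tau_mem_antisymDegree e (bivectorForm r + s) nabla act h2 h1 ξ
  have hδ : deltaInv e (fedosovD e (bivectorForm r + s) nabla ρ act
      (tau e (bivectorForm r + s) nabla ρ act ξ)) = 0 := by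
    have h := one_sub_homotopyOp_tau e (bivectorForm r + s) nabla act h2 ξ
    rw [one_sub_homotopyOp_apply, deltaInv_of_mem_zero e ht, map_zero, sub_zero,
      sigma_tau e _ nabla act h2 h1, sub_eq_self] at h
    exact h
  refine one_sub_homotopyOp_injective e (bivectorForm r + s) nabla act h2 ?_
  rw [one_sub_homotopyOp_apply, fedosovD_sq_of_isFedosovElement e hd hOm hρ hact, hδ,
    sigma_of_mem (fedosovD_mem_antisymDegree e _ nabla act h1 ht), incl_zero, map_zero, map_zero,
    map_zero, sub_zero, sub_zero]

/-- For a flat element of degree 0 the operator that is inverted in τ reduces to σ, so the element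
is the Taylor series of its own projection. -/
theorem eq_tau_of_fedosovD_eq_zero
    (hρ : IsFedosovElement e (bivectorForm r + s) (omega r hr) nabla Om ρ)
    {act : g →ₗ[R] Module.End R A} {a : WL R ι g A} (ha : a ∈ antisymDegree 0)
    (h : fedosovD e (bivectorForm r + s) nabla ρ act a = 0) :
    tau e (bivectorForm r + s) nabla ρ act (sigma a) = a := by
  obtain ⟨h1, h2, -, -⟩ := (isFedosovElement_iff e).1 hρ
  rw [tau_eq_iff e _ nabla act h2, one_sub_homotopyOp_apply, h, deltaInv_of_mem_zero e ha, map_zero,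
    map_zero, sub_zero, sub_zero]

/-- The first order of the Taylor series. -/
theorem insSym_tau_zero (hOm₀ : Om 0 = 0)
    (hd : IsFedosovSetup r hr s nabla) (hOm : ∀ k, Om k ∈ ⋀[R]^2 (Module.Dual R g))
    (hρ : IsFedosovElement e (bivectorForm r + s) (omega r hr) nabla Om ρ)
    {act : g →ₗ[R] Module.End R A} (hact : ∀ X Y, act ⁅X, Y⁆ = act X * act Y - act Y * act X)
    (ξ : ℕ → A) (i : ι) :
    insSym i (tau e (bivectorForm r + s) nabla ρ act ξ) 0 0 = act (e i) (ξ 0) ⊗ₜ 1 := by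
  obtain ⟨h1, h2, -, -⟩ := (isFedosovElement_iff e).1 hρ
  have ht := tau_mem_antisymDegree e (bivectorForm r + s) nabla act h2 h1 ξ
  have hσ := apply_zero_of_mem ht 0
  rw [sigma_tau e _ nabla act h2 h1] at hσ
  have hD := fedosovD_tau e hd hOm hρ hact ξ
  set a := tau e (bivectorForm r + s) nabla ρ act ξ
  -- Since ϱ has total degree at least 3, the coefficient of ad(ϱ) a at t¹ in symmetric degree 0, of
  -- total degree 2, is zero; flatness thus involves only the connection here.
  have hD0 : totalD e nabla act a 0 0 = 0 := by
    have h3 := congrFun (congrFun hD 0) 0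
    rw [fedosovD_apply, Pi.add_apply, Pi.add_apply, divT_apply, ad_mem_totalFiltration e
      (hρ.mem_totalFiltration_three e hOm₀) (d := 0) (a := a)
      (fun m β h => absurd h (Nat.not_lt_zero _)) _ _ (by simp), add_zero] at h3
    exact h3
  -- As the derivatives of a have form degree 0, inserting e_i into ∑ e^k ∧ d_k a isolates d_i a.
  have hc : covD e nabla act i a = opI e i (totalD e nabla act a) := by
    have h4 : ∀ k, opI e i (opW e k (covD e nabla act k a)) =
        if i = k then covD e nabla act k a else 0 := fun k => by
      have h5 := LinearMap.congr_fun (opI_opW (A := A) e i k) (covD e nabla act k a)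
      rw [LinearMap.sub_apply, Module.End.mul_apply, Module.End.mul_apply,
        opI_of_mem_zero e i (covD_mem_antisymDegree e nabla act k ht), map_zero, sub_zero] at h5
      rw [h5]
      split_ifs <;> rfl
    rw [totalD_apply, map_sum]
    simp only [h4, Finset.sum_ite_eq, Finset.mem_univ, if_true]
  have hc0 : covD e nabla act i a 0 0 = 0 := by
    rw [hc, opI, onForms_apply, hD0, map_zero]
  have h6 : ∀ j k, onForms (wedgeLeft (e.coord j) ∘ₗ insVector (e k)) a = 0 := fun j k => by
    rw [← onForms_mul, Module.End.mul_apply]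
    exact (congrArg _ (opI_of_mem_zero e k ht)).trans (map_zero _)
  rw [covD_apply] at hc0
  -- The connection terms contain a factor e^j and vanish in symmetric degree 0, leaving -i_s(e_i) a
  -- + e_i ▷ ξ = 0 there.
  simp only [h6, add_zero, Pi.add_apply, Pi.sub_apply, Pi.neg_apply, Finset.sum_apply,
    Pi.smul_apply, mulSym_apply, Finsupp.zero_apply, if_true, smul_zero, Finset.sum_const_zero,
    sub_zero, onAct_apply, hσ, LinearMap.rTensor_tmul, neg_add_eq_zero] at hc0
  exact hc0

end Taylor

/-! ## The deformed product -/

section Product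

variable {R : Type u} [CommRing R] [Algebra ℚ R] {g : Type v} [LieRing g] [LieAlgebra R g]
variable {ι : Type*} [DecidableEq ι] [Fintype ι] {A : Type w} [NonUnitalRing A] [Module R A]
  [IsScalarTower R A A] [SMulCommClass R A A]
variable (e : Module.Basis ι R g)

/-- Besides ρ∘a∘b and the term with ρ on the far right, ρ stands between a and b twice with opposite
signs, and these terms cancel by associativity. -/
theorem ad_star (bi : LinearMap.BilinForm R (Module.Dual R g)) {ρ : WL R ι g R}
    (a b : WL R ι g A) : ad e bi 1 ρ (star e bi (LinearMap.mul R A) a b) =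
      star e bi (LinearMap.mul R A) (ad e bi 1 ρ a) b +
        star e bi (LinearMap.mul R A) (parity a) (ad e bi 1 ρ b) := by
  have h1 : star e bi (LinearMap.mul R A) (star e bi (LinearMap.lsmul R A) ρ a) b =
      star e bi (LinearMap.lsmul R A) ρ (star e bi (LinearMap.mul R A) a b) :=
    star_assoc e bi (B₁₂ := LinearMap.lsmul R A) (B₂₃ := LinearMap.mul R A)
      (B := LinearMap.mul R A) (B' := LinearMap.lsmul R A) (fun x y z => smul_mul_assoc x y z) ρ a b
  have h2 : star e bi (LinearMap.lsmul R A).flip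
      (star e bi (LinearMap.mul R A) (parity a) (parity b)) ρ =
      star e bi (LinearMap.mul R A) (parity a)
        (star e bi (LinearMap.lsmul R A).flip (parity b) ρ) :=
    star_assoc e bi (B₁₂ := LinearMap.mul R A) (B₂₃ := (LinearMap.lsmul R A).flip)
      (B := (LinearMap.lsmul R A).flip) (B' := LinearMap.mul R A)
      (fun x y z => (mul_smul_comm z x y).symm) (parity a) (parity b) ρ
  have h3 : star e bi (LinearMap.mul R A) (star e bi (LinearMap.lsmul R A).flip (parity a) ρ) b =
      star e bi (LinearMap.mul R A) (parity a) (star e bi (LinearMap.lsmul R A) ρ b) :=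
    star_assoc e bi (B₁₂ := (LinearMap.lsmul R A).flip) (B₂₃ := LinearMap.lsmul R A)
      (B := LinearMap.mul R A) (B' := LinearMap.mul R A)
      (fun x y z => (smul_mul_assoc y x z).trans (mul_smul_comm y x z).symm) (parity a) ρ b
  have h4 := parity_star e bi (LinearMap.mul R A) a b
  have h5 : star e bi (LinearMap.mul R A) (ad e bi 1 ρ a) b = _ :=
    (congrArg (fun x => star e bi (LinearMap.mul R A) x b) (ad_apply e a)).trans
      ((LinearMap.map_sub₂ _ _ _ _).trans (congrArg₂ (· - ·) h1 h3))
  have h6 : star e bi (LinearMap.mul R A) (parity a) (ad e bi 1 ρ b) = _ :=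
    (congrArg (star e bi (LinearMap.mul R A) (parity a)) (ad_apply e b)).trans (map_sub _ _ _)
  have h7 := (congrArg (fun x => star e bi (LinearMap.lsmul R A).flip x ρ) h4).trans h2
  exact (ad_apply e _).trans ((congrArg (HSub.hSub _) h7).trans
    (((congrArg₂ (· + ·) h5 h6).trans (by abel)).symm))

theorem fedosovD_star {bi : LinearMap.BilinForm R (Module.Dual R g)} {nabla : g →ₗ[R] g →ₗ[R] g}
    (hbi : IsCovariantlyConstant nabla bi) {ρ : WL R ι g R} (hρ : ρ ∈ antisymDegree 1)
    {act : g →ₗ[R] Module.End R A} (hact : IsDerivationAction act) (a b : WL R ι g A) :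
    fedosovD e bi nabla ρ act (star e bi (LinearMap.mul R A) a b) =
      star e bi (LinearMap.mul R A) (fedosovD e bi nabla ρ act a) b +
        star e bi (LinearMap.mul R A) (parity a) (fedosovD e bi nabla ρ act b) := by
  have h1 := totalD_star e hbi (act₁ := act) (act₂ := act) (act := act) (B := LinearMap.mul R A)
    hact.leibniz a b
  have h2 := ad_star e bi (ρ := ρ) a b
  have h3 : mulT (totalD e nabla act (star e bi (LinearMap.mul R A) a b)) = _ :=
    (congrArg mulT h1).trans ((map_add _ _ _).trans (congrArg₂ (· + ·)
      (star_mulT_left e bi _ _ b).symm (star_mulT_right e bi _ (parity a) _).symm))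
  have h4 : mulT (star e bi (LinearMap.mul R A) (fedosovD e bi nabla ρ act a) b) = _ :=
    (star_mulT_left e bi _ _ b).symm.trans ((congrArg (fun x => star e bi (LinearMap.mul R A) x b)
      (mulT_fedosovD e hρ act a)).trans (LinearMap.map_add₂ _ _ _ _))
  have h5 : mulT (star e bi (LinearMap.mul R A) (parity a) (fedosovD e bi nabla ρ act b)) = _ :=
    (star_mulT_right e bi _ (parity a) _).symm.trans
      ((congrArg (star e bi (LinearMap.mul R A) (parity a)) (mulT_fedosovD e hρ act b)).trans
        (map_add _ _ _))
  exact mulT_injective ((mulT_fedosovD e hρ act _).trans ((congrArg₂ (· + ·) h3 h2).trans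
    (Eq.trans (by abel) ((map_add _ _ _).trans (congrArg₂ (· + ·) h4 h5)).symm)))

variable {r : ExteriorAlgebra R g} {hr : Function.Bijective (sharp r)}
  {s : LinearMap.BilinForm R (Module.Dual R g)} {nabla : g →ₗ[R] g →ₗ[R] g}
  {Om : ℕ → ExteriorAlgebra R (Module.Dual R g)} {ρ : WL R ι g R}

theorem IsDerivationAction.lie_eq {act : g →ₗ[R] Module.End R A} (hact : IsDerivationAction act)
    (X Y : g) : act ⁅X, Y⁆ = act X * act Y - act Y * act X :=
  LinearMap.ext fun a => hact.lie X Y a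

/-- A product of flat elements is flat by the Leibniz rule, hence equals the Taylor series of its
projection. So τ is multiplicative, which reduces associativity of ⋆ to that of the product on A ⊗ W
⊗ Λ. -/
theorem tau_fedosovStar (hd : IsFedosovSetup r hr s nabla)
    (hOm : ∀ k, Om k ∈ ⋀[R]^2 (Module.Dual R g))
    (hρ : IsFedosovElement e (bivectorForm r + s) (omega r hr) nabla Om ρ)
    {act : g →ₗ[R] Module.End R A} (hact : IsDerivationAction act) (ξ η : ℕ → A) :
    tau e (bivectorForm r + s) nabla ρ act (fedosovStar e (bivectorForm r + s) nabla ρ act ξ η) =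
      star e (bivectorForm r + s) (LinearMap.mul R A) (tau e (bivectorForm r + s) nabla ρ act ξ)
        (tau e (bivectorForm r + s) nabla ρ act η) := by
  obtain ⟨h1, h2, -, -⟩ := (isFedosovElement_iff e).1 hρ
  rw [fedosovStar]
  have hmem := star_mem_antisymDegree e (bivectorForm r + s) (LinearMap.mul R A)
    (tau_mem_antisymDegree e (bivectorForm r + s) nabla act h2 h1 ξ)
    (tau_mem_antisymDegree e (bivectorForm r + s) nabla act h2 h1 η)
  rw [add_zero] at hmem
  have hD := fedosovD_star e (isCovariantlyConstant_add hd.mem hr hd.symplectic hd.parallel) h1 hact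
    (tau e (bivectorForm r + s) nabla ρ act ξ) (tau e (bivectorForm r + s) nabla ρ act η)
  rw [fedosovD_tau e hd hOm hρ hact.lie_eq, fedosovD_tau e hd hOm hρ hact.lie_eq, map_zero, map_zero,
    LinearMap.zero_apply, add_zero] at hD
  exact eq_tau_of_fedosovD_eq_zero e hρ hmem hD

/-- The deformed product as a bilinear map. -/
def fedosovStarLin (bi : LinearMap.BilinForm R (Module.Dual R g)) (nabla : g →ₗ[R] g →ₗ[R] g)
    (ρ : WL R ι g R) (act : g →ₗ[R] Module.End R A) : (ℕ → A) →ₗ[R] (ℕ → A) →ₗ[R] (ℕ → A) :=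
  ((star e bi (LinearMap.mul R A)).compl₁₂ (tauLin e bi nabla act ρ) (tauLin e bi nabla act ρ)).compr₂
    (sigmaLin R g ι A)

theorem fedosovStarLin_apply (bi : LinearMap.BilinForm R (Module.Dual R g))
    (nabla : g →ₗ[R] g →ₗ[R] g) (ρ : WL R ι g R) (act : g →ₗ[R] Module.End R A) (ξ η : ℕ → A) :
    fedosovStarLin e bi nabla ρ act ξ η = fedosovStar e bi nabla ρ act ξ η := rfl

theorem sigma_star_zero {bi : LinearMap.BilinForm R (Module.Dual R g)} {a b : WL R ι g A}
    (ha : a ∈ antisymDegree 0) (hb : b ∈ antisymDegree 0) :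
    sigma (star e bi (LinearMap.mul R A) a b) 0 = sigma a 0 * sigma b 0 := by
  rw [sigma, star_zero_apply, wmul_apply]
  simp [apply_zero_of_mem ha, apply_zero_of_mem hb, coeffMul_tmul]

theorem isAssociativeDeformation_fedosovStar (hd : IsFedosovSetup r hr s nabla)
    (hOm : ∀ k, Om k ∈ ⋀[R]^2 (Module.Dual R g))
    (hρ : IsFedosovElement e (bivectorForm r + s) (omega r hr) nabla Om ρ)
    {act : g →ₗ[R] Module.End R A} (hact : IsDerivationAction act) :
    IsAssociativeDeformation R (fedosovStar e (bivectorForm r + s) nabla ρ act) := by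
  obtain ⟨h1, h2, -, -⟩ := (isFedosovElement_iff e).1 hρ
  constructor
  · exact fun ξ ξ' η => LinearMap.map_add₂ (fedosovStarLin e (bivectorForm r + s) nabla ρ act) ξ ξ' η
  · exact fun ξ η η' => map_add (fedosovStarLin e (bivectorForm r + s) nabla ρ act ξ) η η'
  · intro c ξ η
    refine map_seriesSMul (Φ := (fedosovStarLin e (bivectorForm r + s) nabla ρ act).flip η)
      (fun a => ?_) c ξ
    simp only [LinearMap.flip_apply, fedosovStarLin_apply, fedosovStar]
    rw [tau_shiftT e _ nabla act h2 h1, star_mulT_left, sigma_mulT]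
  · intro c ξ η
    refine map_seriesSMul (Φ := fedosovStarLin e (bivectorForm r + s) nabla ρ act ξ)
      (fun a => ?_) c η
    simp only [fedosovStarLin_apply, fedosovStar]
    rw [tau_shiftT e _ nabla act h2 h1, star_mulT_right, sigma_mulT]
  · intro ξ η ζ
    -- Both bracketings are the projection σ of the triple product of Taylor series.
    have h := star_assoc e (bivectorForm r + s) (B₁₂ := LinearMap.mul R A) (B₂₃ := LinearMap.mul R A)
      (B := LinearMap.mul R A) (B' := LinearMap.mul R A) mul_assoc
      (tau e (bivectorForm r + s) nabla ρ act ξ) (tau e (bivectorForm r + s) nabla ρ act η)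
      (tau e (bivectorForm r + s) nabla ρ act ζ)
    exact (congrArg (fun x => sigma (star e (bivectorForm r + s) (LinearMap.mul R A) x
      (tau e (bivectorForm r + s) nabla ρ act ζ))) (tau_fedosovStar e hd hOm hρ hact ξ η)).trans
      ((congrArg sigma h).trans (congrArg (fun x => sigma (star e (bivectorForm r + s)
        (LinearMap.mul R A) (tau e (bivectorForm r + s) nabla ρ act ξ) x))
        (tau_fedosovStar e hd hOm hρ hact η ζ).symm))
  · intro ξ η
    rw [fedosovStar, sigma_star_zero e (tau_mem_antisymDegree e _ nabla act h2 h1 ξ)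
      (tau_mem_antisymDegree e _ nabla act h2 h1 η), sigma_tau e _ nabla act h2 h1,
      sigma_tau e _ nabla act h2 h1]

theorem fedosovStar_one (hd : IsFedosovSetup r hr s nabla) (hOm₀ : Om 0 = 0)
    (hOm : ∀ k, Om k ∈ ⋀[R]^2 (Module.Dual R g))
    (hρ : IsFedosovElement e (bivectorForm r + s) (omega r hr) nabla Om ρ)
    {act : g →ₗ[R] Module.End R A} (hact : IsDerivationAction act) (ξ η : A) :
    fedosovStar e (bivectorForm r + s) nabla ρ act (Pi.single 0 ξ) (Pi.single 0 η) 1 =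
      algebraMap ℚ R (1 / 2) • ∑ i, ∑ j, (bivectorForm r + s) (e.coord i) (e.coord j) •
        (act (e i) ξ * act (e j) η) := by
  obtain ⟨h1, h2, -, -⟩ := (isFedosovElement_iff e).1 hρ
  have ha := apply_zero_of_mem (tau_mem_antisymDegree e (bivectorForm r + s) nabla act h2 h1
    (Pi.single 0 ξ))
  have hb := apply_zero_of_mem (tau_mem_antisymDegree e (bivectorForm r + s) nabla act h2 h1
    (Pi.single 0 η))
  have hia := insSym_tau_zero e hOm₀ hd hOm hρ hact.lie_eq (Pi.single 0 ξ)
  have hib := insSym_tau_zero e hOm₀ hd hOm hρ hact.lie_eq (Pi.single 0 η)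
  rw [sigma_tau e _ nabla act h2 h1] at ha hb
  rw [Pi.single_eq_same] at hia hib
  rw [fedosovStar]
  set a := tau e (bivectorForm r + s) nabla ρ act (Pi.single 0 ξ)
  set b := tau e (bivectorForm r + s) nabla ρ act (Pi.single 0 η)
  -- In symmetric degree 0 the Taylor series are ξ and η without higher powers of t, so the
  -- uncontracted product has no t¹ term and only the single contraction contributes.
  have hw : wmul (LinearMap.mul R A) a b 1 0 = 0 := by
    rw [wmul_apply]
    simp [ha, hb, Finset.Nat.antidiagonal_succ]
  have hs : ∀ i j, wmul (LinearMap.mul R A) (insSym i a) (insSym j b) 0 0 =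
      (act (e i) ξ * act (e j) η) ⊗ₜ 1 := fun i j => by
    rw [wmul_apply]
    simp [hia, hib, coeffMul_tmul]
  have hstar : star e (bivectorForm r + s) (LinearMap.mul R A) a b 1 0 =
      (algebraMap ℚ R (1 / 2) • ∑ i, ∑ j, (bivectorForm r + s) (e.coord i) (e.coord j) •
        (act (e i) ξ * act (e j) η)) ⊗ₜ 1 := by
    rw [star_apply, Finset.sum_range_succ, Finset.sum_range_one]
    simp only [starTerm, LinearMap.sum_apply, LinearMap.smul_apply, LinearMap.compl₁₂_apply,
      Finset.sum_apply, Pi.smul_apply, tsub_zero, tsub_self, hw, hs, smul_zero, zero_add,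
      ← TensorProduct.smul_tmul', TensorProduct.sum_tmul, expCoeff]
    norm_num
  rw [sigma, hstar, LinearMap.lTensor_tmul]
  simp

end Product

end Fedosov

end

theorem mainTheorem1
    {R : Type*} [CommRing R] [Algebra ℚ R]
    {g : Type*} [LieRing g] [LieAlgebra R g]
    {ι : Type*} [Fintype ι] [DecidableEq ι] (e : Module.Basis ι R g)
    (r : ExteriorAlgebra R g) (hr : Fedosov.IsNondegenerateRMatrix e r)
    (s : LinearMap.BilinForm R (Module.Dual R g)) (hs : ∀ α β, s α β = s β α)
    (nabla : g →ₗ[R] g →ₗ[R] g)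
    (hT : Fedosov.IsTorsionFree nabla)
    (hS : Fedosov.IsSymplectic (Fedosov.omega r hr.sharp_bijective) nabla)
    (hCC : Fedosov.IsCovariantlyConstant nabla s)
    (Om : ℕ → ExteriorAlgebra R (Module.Dual R g))
    (hOm_two : ∀ k, Om k ∈ ⋀[R]^2 (Module.Dual R g))
    (hOm_zero : Om 0 = 0)
    (hOm_closed : ∀ k, Fedosov.ceDifferential e (Om k) = 0) :
    (∃! ρ : Fedosov.WL R ι g R,
      Fedosov.IsFedosovElement e (Fedosov.bivectorForm r + s)
        (Fedosov.omega r hr.sharp_bijective) nabla Om ρ) ∧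
    ∀ ρ : Fedosov.WL R ι g R,
      Fedosov.IsFedosovElement e (Fedosov.bivectorForm r + s)
        (Fedosov.omega r hr.sharp_bijective) nabla Om ρ →
      ∀ {A : Type*} [NonUnitalRing A] [Module R A] [IsScalarTower R A A] [SMulCommClass R A A]
        (act : g →ₗ[R] Module.End R A), Fedosov.IsDerivationAction act →
        IsUnit (1 - Fedosov.homotopyOp e (Fedosov.bivectorForm r + s) nabla ρ act) ∧
        Fedosov.IsAssociativeDeformation R
          (Fedosov.fedosovStar e (Fedosov.bivectorForm r + s) nabla ρ act) ∧
        ∀ ξ η : A,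
          Fedosov.fedosovStar e (Fedosov.bivectorForm r + s) nabla ρ act
              (Pi.single 0 ξ) (Pi.single 0 η) 0 = ξ * η ∧
          Fedosov.fedosovStar e (Fedosov.bivectorForm r + s) nabla ρ act
              (Pi.single 0 ξ) (Pi.single 0 η) 1 =
            algebraMap ℚ R (1 / 2) • ∑ i, ∑ j,
              (Fedosov.bivectorForm r + s) (e.coord i) (e.coord j) •
                (act (e i) ξ * act (e j) η) := by
  have hd : Fedosov.IsFedosovSetup r hr.sharp_bijective s nabla := ⟨hr.mem, hs, hT, hS, hCC⟩
  refine ⟨Fedosov.existsUnique_isFedosovElement e hd hOm_two hOm_zero hOm_closed,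
    fun ρ hρ A _ _ _ _ act hact => ?_⟩
  have h := Fedosov.isAssociativeDeformation_fedosovStar e hd hOm_two hρ hact
  refine ⟨Fedosov.isUnit_one_sub_homotopyOp e _ nabla act hρ.total_degree, h, fun ξ η =>
    ⟨?_, Fedosov.fedosovStar_one e hd hOm_zero hOm_two hρ hact ξ η⟩⟩
  rw [h.order_zero, Pi.single_eq_same, Pi.single_eq_same]
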